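/- Let $m\ge 1$ be an integer, $\mu\in\mathbb R$, and let $w$ be the radial profile of a vortex $\psi=e^{-i\mu t}e^{im\theta}w(r)$ of the Gross–Pitaevskii equation $i\psi_t=-\tfrac12\Delta\psi+\tfrac12r^2\psi+|\psi|^2\psi$ in $\mathbb R^2$, i.e. a non-negative, not identically zero $C^2$ solution on $(0,\infty)$ of $$-w''-\tfrac1r w'+\tfrac{m^2}{r^2}w+r^2w+2|w|^2w-2\mu w=0,$$ bounded as $r\to0^+$, with $w(r)\to0$ as $r\to\infty$. Let $J=\begin{pmatrix}0&-1\\1&0\end{pmatrix}$, $R=\begin{pmatrix}1&0\\0&-1\end{pmatrix}$, and let $A=-J(L_c+L_w)$ on $L^2(\mathbb R^2,\mathbb C^2)$ with $D(A)=D(L_c)$, where $L_c=-\tfrac12\Delta+\tfrac12r^2$ is the self-adjoint operator of the closed form $q(u,u)=\int_{\mathbb R^2}\tfrac12|\nabla u|^2+\tfrac12r^2|u|^2$ on $H^1(\mathbb R^2,\mathbb C^2)\cap L^2(\mathbb R^2,\mathbb C^2;r^2)$, and $L_w$ is multiplication by $2|w|^2+|w|^2e^{2m\theta J}R-\mu$.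 An eigenvalue $\lambda$ of $A$ is unstable if $\operatorname{Re}\lambda>0$. For $j\in\mathbb Z$ let $$L_j=\begin{pmatrix}L_j^+&0\\0&L_j^-\end{pmatrix}+|w|^2\begin{pmatrix}2&1\\1&2\end{pmatrix},\qquad L_j^\pm=-\tfrac12\Big(\partial_r^2+\tfrac1r\partial_r\Big)+\frac{(j\pm m)^2}{2r^2}+\tfrac12r^2-\mu,$$ acting in $L^2((0,\infty),\mathbb C^2;r\,dr)$ with inner product $(\cdot,\cdot)$. Its domain $D(L_j)$ consists of the $y=(y_+,y_-)$ such that $y$ and $y'$ are locally absolutely continuous on $(0,\infty)$, $y$ and $L_jy$ are in $L^2(r\,dr)$, and $\lim_{r\to0^+}y(r)$ exists. By a mode-$j$ solution for $\lambda\in\mathbb C$ we mean a $C^2$ function $y=(y_+,y_-)$ on $(0,\infty)$ with $$L_jy=i\lambda Ry,\qquad \lim_{r\to0^+}y(r)\ \text{exists},\qquad \lim_{r\to\infty}y(r)=0 .$$ (a) Unstable eigenvalues and eigenfunctions of $A$ occur only in modes $j\neq0$, $|j|<2m$: if $\operatorname{Re}\lambda>0$ and $A\Phi=\lambda\Phi$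 with $0\ne\Phi\in D(A)$, then there are mode-$j$ solutions $(y_+^j,y_-^j)$ for $\lambda$, $0<|j|<2m$, not all trivial, such that for almost every $(r,\theta)$ $$\Phi(r,\theta)=\sum_{0<|j|<2m}\Big[e^{i(j+m)\theta}y_+^j(r)\binom{1/2}{-i/2}+e^{i(j-m)\theta}y_-^j(r)\binom{1/2}{i/2}\Big].$$ (b) If $j=0$ or $|j|\ge2m$ and $y$ is a nontrivial mode-$j$ solution for $\lambda$, then $y\in D(L_j)$ and $i\lambda$ is real. (c) If $|j|\ge2m$, then $L_j$ is positive: $(L_jy,y)>0$ for every $0\neq y\in D(L_j)$. In particular every eigenvalue $\lambda$ of $-iRL_j$ (equivalently, of $L_jy=i\lambda Ry$) has positive Krein signature, i.e. $(L_jy,y)>0$ for every $y\ne0$ in its generalized eigenspace. (d) If $j=0$, then $(L_0y,y)\ge0$ for every $y\in D(L_0)$, with equality if and only if $y=\alpha(w,-w)$ for some $\alpha\in\mathbb C$. If $y$ is a nontrivial mode-$0$ solution for $\lambda$ with $(L_0y,y)=0$, then $\lambda=0$. -/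

import Mathlib

open MeasureTheory Filter Topology Set
open scoped ContDiff

namespace GPVortex

noncomputable section

/-! ### Vortex profiles -/

/-- `w` is the radial profile of a vortex `ψ = e^{-iμt} e^{imθ} w(r)`: a non-negative, nontrivial
classical solution on `(0, ∞)` of
`-w'' - w'/r + (m²/r²) w + r² w + 2 w³ - 2 μ w = 0`,
bounded as `r → 0⁺` and vanishing as `r → ∞`. Values of `w` at `r ≤ 0` are irrelevant. -/
structure IsVortexProfile (m : ℕ) (μ : ℝ) (w : ℝ → ℝ) : Prop where
  contDiffOn : ContDiffOn ℝ 2 w (Ioi 0)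
  nonneg : ∀ r, 0 < r → 0 ≤ w r
  nontrivial : ∃ r, 0 < r ∧ w r ≠ 0
  equation : ∀ r, 0 < r →
    -deriv (deriv w) r - (1 / r) * deriv w r + ((m : ℝ) ^ 2 / r ^ 2) * w r + r ^ 2 * w r
      + 2 * |w r| ^ 2 * w r - 2 * μ * w r = 0
  bounded_zero : ∃ C : ℝ, ∀ᶠ r in 𝓝[>] (0 : ℝ), |w r| ≤ C
  tendsto_atTop : Tendsto w atTop (𝓝 0)

/-! ### The linearized operator `A = -J (L_c + L_w)` on `L²(ℝ², ℂ²)`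

The plane `ℝ²` is identified with `ℂ`, so that polar coordinates of `z` are `r = ‖z‖` and
`θ = arg z`, and the two coordinate directions are `1` and `I`. -/

/-- The values `ℂ²`, with the Euclidean norm. -/
abbrev C2 := EuclideanSpace ℂ (Fin 2)

/-- The Hilbert space `L²(ℝ², ℂ²)`. -/
abbrev PlaneL2 := Lp C2 2 (volume : Measure ℂ)

/-- `g` is the weak (distributional) partial derivative of `u` in the direction `e`. -/
def IsWeakDeriv (e : ℂ) (u g : PlaneL2) : Prop :=
  ∀ φ : ℂ → ℝ, ContDiff ℝ ∞ φ → HasCompactSupport φ →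
    ∫ z, (fderiv ℝ φ z e) • u z = -∫ z, φ z • g z

/-- `u` belongs to the form domain `D(q) = H¹(ℝ², ℂ²) ∩ L²(ℝ², ℂ²; r²)`, with weak gradient
`(gx, gy)` and with `r u` equal to `h`. -/
structure InFormDomain (u gx gy h : PlaneL2) : Prop where
  weakDeriv_x : IsWeakDeriv 1 u gx
  weakDeriv_y : IsWeakDeriv Complex.I u gy
  weight : ∀ᵐ z, h z = ‖z‖ • u z

lemma integrable_smul_PlaneL2 (g : PlaneL2) {φ : ℂ → ℝ} (hφ : Continuous φ)
    (hc : HasCompactSupport φ) : Integrable (fun z => φ z • g z) := by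
  have hg : LocallyIntegrable (fun z => g z) volume :=
    (Lp.memLp g).locallyIntegrable (by norm_num)
  exact hg.integrable_smul_left_of_hasCompactSupport hφ hc

lemma IsWeakDeriv.add {e : ℂ} {u g u' g' : PlaneL2} (h : IsWeakDeriv e u g)
    (h' : IsWeakDeriv e u' g') : IsWeakDeriv e (u + u') (g + g') := by
  intro φ hφ hc
  have hd : Continuous (fun z => fderiv ℝ φ z e) :=
    (hφ.continuous_fderiv (by simp)).clm_apply continuous_const
  have hdc : HasCompactSupport (fun z => fderiv ℝ φ z e) := hc.fderiv_apply ℝ e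
  have e1 : ∫ z, (fderiv ℝ φ z e) • (u + u') z =
      ∫ z, ((fderiv ℝ φ z e) • u z + (fderiv ℝ φ z e) • u' z) := by
    apply integral_congr_ae
    filter_upwards [Lp.coeFn_add u u'] with z hz
    rw [hz, Pi.add_apply, smul_add]
  have e2 : ∫ z, φ z • (g + g') z = ∫ z, (φ z • g z + φ z • g' z) := by
    apply integral_congr_ae
    filter_upwards [Lp.coeFn_add g g'] with z hz
    rw [hz, Pi.add_apply, smul_add]
  rw [e1, e2, integral_add (integrable_smul_PlaneL2 u hd hdc) (integrable_smul_PlaneL2 u' hd hdc),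
    integral_add (integrable_smul_PlaneL2 g hφ.continuous hc)
      (integrable_smul_PlaneL2 g' hφ.continuous hc), h φ hφ hc, h' φ hφ hc, neg_add]

lemma IsWeakDeriv.smul {e : ℂ} {u g : PlaneL2} (c : ℂ) (h : IsWeakDeriv e u g) :
    IsWeakDeriv e (c • u) (c • g) := by
  intro φ hφ hc
  have e1 : ∫ z, (fderiv ℝ φ z e) • (c • u) z = ∫ z, c • ((fderiv ℝ φ z e) • u z) := by
    apply integral_congr_ae
    filter_upwards [Lp.coeFn_smul c u] with z hz
    rw [hz, Pi.smul_apply, smul_comm]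
  have e2 : ∫ z, φ z • (c • g) z = ∫ z, c • (φ z • g z) := by
    apply integral_congr_ae
    filter_upwards [Lp.coeFn_smul c g] with z hz
    rw [hz, Pi.smul_apply, smul_comm]
  rw [e1, e2, integral_smul, integral_smul, h φ hφ hc, smul_neg]

lemma InFormDomain.add {u gx gy h u' gx' gy' h' : PlaneL2} (H : InFormDomain u gx gy h)
    (H' : InFormDomain u' gx' gy' h') :
    InFormDomain (u + u') (gx + gx') (gy + gy') (h + h') := by
  refine ⟨H.1.add H'.1, H.2.add H'.2, ?_⟩
  filter_upwards [Lp.coeFn_add u u', Lp.coeFn_add h h', H.3, H'.3] with z h1 h2 h3 h4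
  rw [h1, h2, Pi.add_apply, Pi.add_apply, h3, h4, smul_add]

lemma InFormDomain.smul {u gx gy h : PlaneL2} (c : ℂ) (H : InFormDomain u gx gy h) :
    InFormDomain (c • u) (c • gx) (c • gy) (c • h) := by
  refine ⟨H.1.smul c, H.2.smul c, ?_⟩
  filter_upwards [Lp.coeFn_smul c u, Lp.coeFn_smul c h, H.3] with z h1 h2 h3
  rw [h1, h2, Pi.smul_apply, Pi.smul_apply, h3, smul_comm]

lemma isWeakDeriv_zero (e : ℂ) : IsWeakDeriv e 0 0 := by
  intro φ _ _
  rw [integral_eq_zero_of_ae, integral_eq_zero_of_ae, neg_zero]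
  all_goals
    filter_upwards [Lp.coeFn_zero C2 2 (volume : Measure ℂ)] with z hz
    simp only [hz, Pi.zero_apply, smul_zero]

lemma inFormDomain_zero : InFormDomain 0 0 0 0 := by
  refine ⟨isWeakDeriv_zero 1, isWeakDeriv_zero Complex.I, ?_⟩
  filter_upwards [Lp.coeFn_zero C2 2 (volume : Measure ℂ)] with z hz
  rw [hz, Pi.zero_apply, smul_zero]

/-- The graph of `L_c = -½ Δ + ½ r²`, the self-adjoint operator of the closed form
`q(u, u) = ∫ ½ |∇u|² + ½ r² |u|²` on `D(q)`: the pairs `(u, f)` with `u ∈ D(q)` and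
`q(v, u) = ⟪v, f⟫` for every `v ∈ D(q)`. -/
def LcGraph : Submodule ℂ (PlaneL2 × PlaneL2) where
  carrier := {p | ∃ gx gy h : PlaneL2, InFormDomain p.1 gx gy h ∧
    ∀ v kx ky l : PlaneL2, InFormDomain v kx ky l →
      (1 / 2 : ℂ) * (inner ℂ kx gx + inner ℂ ky gy) + (1 / 2 : ℂ) * inner ℂ l h
        = inner ℂ v p.2}
  add_mem' := by
    rintro p q ⟨gx, gy, h, H, K⟩ ⟨gx', gy', h', H', K'⟩
    refine ⟨gx + gx', gy + gy', h + h', H.add H', fun v kx ky l hv => ?_⟩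
    rw [Prod.snd_add, inner_add_right, inner_add_right, inner_add_right, inner_add_right,
      ← K v kx ky l hv, ← K' v kx ky l hv]
    ring
  zero_mem' := by
    refine ⟨0, 0, 0, inFormDomain_zero, fun v kx ky l hv => ?_⟩
    rw [Prod.snd_zero]
    simp only [inner_zero_right]
    ring
  smul_mem' := by
    rintro c p ⟨gx, gy, h, H, K⟩
    refine ⟨c • gx, c • gy, c • h, H.smul c, fun v kx ky l hv => ?_⟩
    rw [Prod.smul_snd, inner_smul_right, inner_smul_right, inner_smul_right, inner_smul_right,
      ← K v kx ky l hv]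
    ring

lemma IsWeakDeriv.zero_left {e : ℂ} {g : PlaneL2} (h : IsWeakDeriv e 0 g) : g = 0 := by
  have hg : LocallyIntegrable (fun z => g z) volume :=
    (Lp.memLp g).locallyIntegrable (by norm_num)
  rw [Lp.eq_zero_iff_ae_eq_zero]
  refine ae_eq_zero_of_integral_contDiff_smul_eq_zero hg fun φ hφ hc => ?_
  have h0 := h φ hφ hc
  rw [integral_eq_zero_of_ae] at h0
  · exact neg_eq_zero.1 h0.symm
  · filter_upwards [Lp.coeFn_zero C2 2 (volume : Measure ℂ)] with z hz
    rw [hz, Pi.zero_apply, smul_zero]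

/-- Test functions with values in `ℂ²`, as elements of `L²(ℝ², ℂ²)`. -/
lemma memLp_smul_const {φ : ℂ → ℝ} (hφ : Continuous φ) (hc : HasCompactSupport φ) (c : C2) :
    MemLp (fun z => φ z • c) 2 (volume : Measure ℂ) :=
  Continuous.memLp_of_hasCompactSupport (hφ.smul continuous_const) hc.smul_right

lemma isWeakDeriv_test {φ : ℂ → ℝ} (hφ : ContDiff ℝ ∞ φ) (hc : HasCompactSupport φ) (c : C2)
    (e : ℂ) (h : Continuous fun z => fderiv ℝ φ z e)
    (h' : HasCompactSupport fun z => fderiv ℝ φ z e) :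
    IsWeakDeriv e ((memLp_smul_const hφ.continuous hc c).toLp)
      ((memLp_smul_const h h' c).toLp) := by
  intro χ hχ hχc
  have hd : Continuous (fun z => fderiv ℝ χ z e) :=
    (hχ.continuous_fderiv (by simp)).clm_apply continuous_const
  have hdc : HasCompactSupport (fun z => fderiv ℝ χ z e) := hχc.fderiv_apply ℝ e
  have e1 : ∫ z, (fderiv ℝ χ z e) • ((memLp_smul_const hφ.continuous hc c).toLp) z =
      ∫ z, (fderiv ℝ χ z e * φ z) • c := by
    apply integral_congr_ae
    filter_upwards [(memLp_smul_const hφ.continuous hc c).coeFn_toLp] with z hz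
    rw [hz, smul_smul]
  have e2 : ∫ z, χ z • ((memLp_smul_const h h' c).toLp) z =
      ∫ z, (χ z * fderiv ℝ φ z e) • c := by
    apply integral_congr_ae
    filter_upwards [(memLp_smul_const h h' c).coeFn_toLp] with z hz
    rw [hz, smul_smul]
  rw [e1, e2, integral_smul_const, integral_smul_const, ← neg_smul]
  congr 1
  rw [integral_mul_fderiv_eq_neg_fderiv_mul_of_integrable, neg_neg]
  · exact (hd.mul hφ.continuous).integrable_of_hasCompactSupport hdc.mul_right
  · exact (hχ.continuous.mul h).integrable_of_hasCompactSupport hχc.mul_right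
  · exact (hχ.continuous.mul hφ.continuous).integrable_of_hasCompactSupport hχc.mul_right
  · exact fun z _ => (hχ.differentiable (by simp)).differentiableAt
  · exact fun z _ => (hφ.differentiable (by simp)).differentiableAt

/-- The relation `LcGraph` is single-valued, hence the graph of an operator. -/
lemma LcGraph_snd_eq_zero : ∀ p ∈ LcGraph, p.1 = 0 → p.2 = 0 := by
  rintro ⟨u, f⟩ ⟨gx, gy, h, H, K⟩ hu
  simp only at hu H K ⊢
  subst hu
  have hgx : gx = 0 := H.1.zero_left
  have hgy : gy = 0 := H.2.zero_left
  have hh : h = 0 := by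
    rw [Lp.eq_zero_iff_ae_eq_zero]
    filter_upwards [H.3, Lp.coeFn_zero C2 2 (volume : Measure ℂ)] with z hz hz'
    rw [hz, hz', Pi.zero_apply, smul_zero]
  subst hgx hgy hh
  have hf : LocallyIntegrable (fun z => f z) volume :=
    (Lp.memLp f).locallyIntegrable (by norm_num)
  rw [Lp.eq_zero_iff_ae_eq_zero]
  refine ae_eq_zero_of_integral_contDiff_smul_eq_zero hf fun φ hφ hc => ?_
  refine ext_inner_left ℂ fun c => ?_
  have hdx (e : ℂ) : Continuous (fun z => fderiv ℝ φ z e) :=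
    (hφ.continuous_fderiv (by simp)).clm_apply continuous_const
  have hdc (e : ℂ) : HasCompactSupport (fun z => fderiv ℝ φ z e) := hc.fderiv_apply ℝ e
  have hn : Continuous (fun z : ℂ => ‖z‖ * φ z) := continuous_norm.mul hφ.continuous
  have hnc : HasCompactSupport (fun z : ℂ => ‖z‖ * φ z) := hc.mul_left
  have key := K _ _ _ _ (InFormDomain.mk
    (isWeakDeriv_test hφ hc c 1 (hdx 1) (hdc 1))
    (isWeakDeriv_test hφ hc c Complex.I (hdx Complex.I) (hdc Complex.I))
    (h := (memLp_smul_const hn hnc c).toLp) (by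
      filter_upwards [(memLp_smul_const hn hnc c).coeFn_toLp,
        (memLp_smul_const hφ.continuous hc c).coeFn_toLp] with z h1 h2
      rw [h1, h2, smul_smul]))
  simp only [inner_zero_right, add_zero, mul_zero] at key
  rw [inner_zero_right, ← integral_inner (integrable_smul_PlaneL2 f hφ.continuous hc) c, key,
    L2.inner_def]
  apply integral_congr_ae
  filter_upwards [(memLp_smul_const hφ.continuous hc c).coeFn_toLp] with z hz
  rw [hz, ← Complex.coe_smul, ← Complex.coe_smul, inner_smul_left, inner_smul_right,
    Complex.conj_ofReal]

/-- The operator `L_c`, unbounded on `L²(ℝ², ℂ²)`. -/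
def Lc : PlaneL2 →ₗ.[ℂ] PlaneL2 := LcGraph.toLinearPMap

/-- Pointwise product of a matrix-valued function `M` with a `ℂ²`-valued function. -/
def mulFun (M : ℂ → Matrix (Fin 2) (Fin 2) ℂ) (u : ℂ → C2) (z : ℂ) : C2 :=
  Matrix.toEuclideanCLM (𝕜 := ℂ) (M z) (u z)

lemma mulFun_add (M : ℂ → Matrix (Fin 2) (Fin 2) ℂ) (u v : PlaneL2) :
    mulFun M (u + v : PlaneL2) =ᵐ[volume] mulFun M u + mulFun M v := by
  filter_upwards [Lp.coeFn_add u v] with z hz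
  simp only [mulFun, Pi.add_apply, hz, map_add]

lemma mulFun_smul (M : ℂ → Matrix (Fin 2) (Fin 2) ℂ) (c : ℂ) (u : PlaneL2) :
    mulFun M (c • u : PlaneL2) =ᵐ[volume] c • mulFun M u := by
  filter_upwards [Lp.coeFn_smul c u] with z hz
  simp only [mulFun, Pi.smul_apply, hz, map_smul]

lemma mulFun_zero (M : ℂ → Matrix (Fin 2) (Fin 2) ℂ) :
    mulFun M (0 : PlaneL2) =ᵐ[volume] 0 := by
  filter_upwards [Lp.coeFn_zero C2 2 (volume : Measure ℂ)] with z hz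
  simp only [mulFun, Pi.zero_apply, hz, map_zero]

/-- The `u ∈ L²(ℝ², ℂ²)` for which `M u` is square integrable. -/
def mulDomain (M : ℂ → Matrix (Fin 2) (Fin 2) ℂ) : Submodule ℂ PlaneL2 where
  carrier := {u | MemLp (mulFun M u) 2 volume}
  add_mem' {u v} hu hv := (memLp_congr_ae (mulFun_add M u v)).2 (MemLp.add hu hv)
  zero_mem' := (memLp_congr_ae (mulFun_zero M)).2 MemLp.zero
  smul_mem' c u hu := (memLp_congr_ae (mulFun_smul M c u)).2 (MemLp.const_smul hu c)

lemma mem_mulDomain {M : ℂ → Matrix (Fin 2) (Fin 2) ℂ} {u : PlaneL2} :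
    u ∈ mulDomain M ↔ MemLp (mulFun M u) 2 volume := Iff.rfl

/-- The operator of multiplication by a matrix-valued function `M`, with its maximal domain (which
is all of `L²(ℝ², ℂ²)` when `M` is bounded and measurable). -/
def mulOp (M : ℂ → Matrix (Fin 2) (Fin 2) ℂ) : PlaneL2 →ₗ.[ℂ] PlaneL2 where
  domain := mulDomain M
  toFun :=
    { toFun := fun u => MemLp.toLp (mulFun M u.1) (mem_mulDomain.1 u.2)
      map_add' := fun u v =>
        (MemLp.toLp_congr _ ((mem_mulDomain.1 u.2).add (mem_mulDomain.1 v.2))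
          (mulFun_add M u.1 v.1)).trans (MemLp.toLp_add _ _)
      map_smul' := fun c u =>
        (MemLp.toLp_congr _ ((mem_mulDomain.1 u.2).const_smul c)
          (mulFun_smul M c u.1)).trans (MemLp.toLp_const_smul c _) }

/-- The matrix `J`. -/
def J : Matrix (Fin 2) (Fin 2) ℂ := !![0, -1; 1, 0]

/-- The matrix `R`. -/
def R : Matrix (Fin 2) (Fin 2) ℂ := !![1, 0; 0, -1]

/-- The matrix exponential `e^{αJ} = cos α + (sin α) J`. -/
def expJ (α : ℝ) : Matrix (Fin 2) (Fin 2) ℂ := (Real.cos α : ℂ) • 1 + (Real.sin α : ℂ) • J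

/-- The symbol `2|w|² + |w|² e^{2mθJ} R - μ` of `L_w`. -/
def LwSymbol (m : ℕ) (μ : ℝ) (w : ℝ → ℝ) (z : ℂ) : Matrix (Fin 2) (Fin 2) ℂ :=
  ((2 * |w ‖z‖| ^ 2 : ℝ) : ℂ) • 1
    + ((|w ‖z‖| ^ 2 : ℝ) : ℂ) • (expJ (2 * m * Complex.arg z) * R) - (μ : ℂ) • 1

/-- The linearized operator `A = -J (L_c + L_w)`, with `D(A) = D(L_c)`. -/
def A (m : ℕ) (μ : ℝ) (w : ℝ → ℝ) : PlaneL2 →ₗ.[ℂ] PlaneL2 :=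
  ((Matrix.toEuclideanCLM (𝕜 := ℂ) (-J)).compLpL 2 volume).toLinearMap.compPMap
    (Lc + mulOp (LwSymbol m μ w))

/-- `Φ` is an eigenfunction of `A` for the eigenvalue `lam`. -/
def IsEigenfunction (m : ℕ) (μ : ℝ) (w : ℝ → ℝ) (lam : ℂ) (Φ : PlaneL2) : Prop :=
  Φ ≠ 0 ∧ ∃ h : Φ ∈ (A m μ w).domain, A m μ w ⟨Φ, h⟩ = lam • Φ

/-! ### The radial operators `L_j` -/

/-- The measure `r dr` on `(0, ∞)`. -/
def radialMeasure : Measure ℝ :=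
  (volume.restrict (Ioi 0)).withDensity (fun r => ENNReal.ofReal r)

/-- The differential expression `-½ Δ_r + k²/(2r²) + ½ r² - μ`, with `Δ_r = ∂_r² + (1/r) ∂_r`;
`L_j^±` is the case `k = j ± m`. -/
def radialExpr (μ : ℝ) (k : ℤ) (f : ℝ → ℂ) (r : ℝ) : ℂ :=
  -(1 / 2) * (deriv (deriv f) r + (1 / (r : ℂ)) * deriv f r)
    + (((k : ℝ) ^ 2 / (2 * r ^ 2) + r ^ 2 / 2 - μ : ℝ) : ℂ) * f r

/-- The first component of `L_j (y₊, y₋)`. -/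
def LjPlus (m : ℕ) (μ : ℝ) (w : ℝ → ℝ) (j : ℤ) (yp ym : ℝ → ℂ) (r : ℝ) : ℂ :=
  radialExpr μ (j + m) yp r + ((|w r| ^ 2 : ℝ) : ℂ) * (2 * yp r + ym r)

/-- The second component of `L_j (y₊, y₋)`. -/
def LjMinus (m : ℕ) (μ : ℝ) (w : ℝ → ℝ) (j : ℤ) (yp ym : ℝ → ℂ) (r : ℝ) : ℂ :=
  radialExpr μ (j - m) ym r + ((|w r| ^ 2 : ℝ) : ℂ) * (yp r + 2 * ym r)

/-- `(y₊, y₋)` is nontrivial as a function on `(0, ∞)`. -/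
def Nontriv (yp ym : ℝ → ℂ) : Prop := ∃ r, 0 < r ∧ (yp r ≠ 0 ∨ ym r ≠ 0)

/-- `(y₊, y₋)` is a (classical) solution on `(0, ∞)` of `L_j y = i λ R y` with the boundary
conditions: `y₊, y₋` have a limit as `r → 0⁺` and tend to `0` as `r → ∞`. -/
structure IsModeSolution (m : ℕ) (μ : ℝ) (w : ℝ → ℝ) (j : ℤ) (lam : ℂ) (yp ym : ℝ → ℂ) :
    Prop where
  contDiffOn_plus : ContDiffOn ℝ 2 yp (Ioi 0)
  contDiffOn_minus : ContDiffOn ℝ 2 ym (Ioi 0)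
  equation_plus : ∀ r, 0 < r → LjPlus m μ w j yp ym r = Complex.I * lam * yp r
  equation_minus : ∀ r, 0 < r → LjMinus m μ w j yp ym r = -(Complex.I * lam * ym r)
  limit_zero_plus : ∃ a : ℂ, Tendsto yp (𝓝[>] 0) (𝓝 a)
  limit_zero_minus : ∃ a : ℂ, Tendsto ym (𝓝[>] 0) (𝓝 a)
  tendsto_plus : Tendsto yp atTop (𝓝 0)
  tendsto_minus : Tendsto ym atTop (𝓝 0)

/-- `f` and `f'` are locally absolutely continuous on `(0, ∞)`, `f` has a limit as `r → 0⁺`, and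
`f ∈ L²((0, ∞); r dr)`. -/
structure IsRadialSobolev (f : ℝ → ℂ) : Prop where
  differentiableOn : DifferentiableOn ℝ f (Ioi 0)
  absolutelyContinuous : ∀ a b : ℝ, 0 < a → a ≤ b → AbsolutelyContinuousOnInterval (deriv f) a b
  limit_zero : ∃ a : ℂ, Tendsto f (𝓝[>] 0) (𝓝 a)
  memLp : MemLp f 2 radialMeasure

/-- `(y₊, y₋)` belongs to the domain `D(L_j)` of the operator `L_j` in `L²((0, ∞), ℂ²; r dr)`
(the maximal domain of the differential expression, with the boundary condition at `0`). -/
structure InDomainLj (m : ℕ) (μ : ℝ) (w : ℝ → ℝ) (j : ℤ) (yp ym : ℝ → ℂ) : Prop where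
  sobolev_plus : IsRadialSobolev yp
  sobolev_minus : IsRadialSobolev ym
  memLp_plus : MemLp (LjPlus m μ w j yp ym) 2 radialMeasure
  memLp_minus : MemLp (LjMinus m μ w j yp ym) 2 radialMeasure

/-- The energy form `(L_j y, y)` in `L²((0, ∞), ℂ²; r dr)`. -/
def energy (m : ℕ) (μ : ℝ) (w : ℝ → ℝ) (j : ℤ) (yp ym : ℝ → ℂ) : ℂ :=
  ∫ r, (LjPlus m μ w j yp ym r * (starRingEnd ℂ) (yp r)
    + LjMinus m μ w j yp ym r * (starRingEnd ℂ) (ym r)) ∂radialMeasure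

/-- `(y₊, y₋)` is annihilated by `(-i R L_j - λ)ⁿ`, as an element of `D((-i R L_j)ⁿ)`. Note that
`-i R L_j y = λ y` is the same equation as `L_j y = i λ R y`. -/
def IsGenEigen (m : ℕ) (μ : ℝ) (w : ℝ → ℝ) (j : ℤ) (lam : ℂ) :
    ℕ → (ℝ → ℂ) → (ℝ → ℂ) → Prop
  | 0, yp, ym => ∀ r, 0 < r → yp r = 0 ∧ ym r = 0
  | n + 1, yp, ym => InDomainLj m μ w j yp ym ∧
      ∃ up um : ℝ → ℂ, IsGenEigen m μ w j lam n up um ∧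
        ∀ᵐ r ∂radialMeasure,
          -Complex.I * LjPlus m μ w j yp ym r - lam * yp r = up r ∧
          Complex.I * LjMinus m μ w j yp ym r - lam * ym r = um r

/-- Positive Krein signature: the energy form `(L_j y, y)` is positive definite on the generalized
eigenspace of `-i R L_j` for `λ`. -/
def PositiveKreinSignature (m : ℕ) (μ : ℝ) (w : ℝ → ℝ) (j : ℤ) (lam : ℂ) : Prop :=
  ∀ (n : ℕ) (yp ym : ℝ → ℂ), IsGenEigen m μ w j lam n yp ym → Nontriv yp ym →
    0 < (energy m μ w j yp ym).re ∧ (energy m μ w j yp ym).im = 0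

/-! ### From radial pairs to functions in the plane -/

/-- The `j`-th azimuthal mode
`e^{i(j+m)θ} y₊(r) (1/2, -i/2)ᵀ + e^{i(j-m)θ} y₋(r) (1/2, i/2)ᵀ`. -/
def modeFunction (m : ℕ) (j : ℤ) (yp ym : ℝ → ℂ) (z : ℂ) : C2 :=
  (Complex.exp (Complex.I * (j + m) * Complex.arg z) * yp ‖z‖) • !₂[1 / 2, -Complex.I / 2]
    + (Complex.exp (Complex.I * (j - m) * Complex.arg z) * ym ‖z‖) • !₂[1 / 2, Complex.I / 2]

/-- The indices `j` with `j ≠ 0` and `|j| < 2m`. -/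
def unstableIndices (m : ℕ) : Finset ℤ :=
  (Finset.Ioo (-(2 * (m : ℤ))) (2 * (m : ℤ))).erase 0

end

end GPVortex

namespace GPVortex

/-! ### Twice differentiable functions on the half-line -/

section HalfLine

variable {E : Type*} [NormedAddCommGroup E] [NormedSpace ℝ E] {f : ℝ → E}

/-! Write T_k = -½Δ_r + k²/(2r²) + ½r² - μ + w². Moving one copy of w² from the coupling matrix into
each diagonal entry gives L_j = diag(T_{j+m}, T_{j-m}) + w² [[1,1],[1,1]], and the remaining matrix
is non-negative (`InDomainLj.energy_eq`). The profile equation is T_m w = 0 with w > 0, so w is a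
ground state: with D = w (f/w)', formally (T_k f, f) = ∫ (½ D² + (k² - m²)/(2r²) f²) r dr.

If j = 0 or |j| ≥ 2m, both |j ± m| are at least m and the energy is non-negative. When it vanishes,
both components are multiples of w, and the coupling forces y = α(w, -w). If |j| ≥ 2m, one of |j ±
m| exceeds m, which leaves only α = 0. For a mode solution, (L_j y, y) = iλN with N real, so a
non-zero energy makes iλ real; a zero energy occurs only for j = 0 and y = α(w, -w), which L_0
annihilates, so that λ = 0.

Membership in D(L_j) gives no direct control of y' at 0 or ∞. Integrations by parts are therefore
localized by cutoffs in log r, whose error vanishes for functions bounded near 0 and square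
integrable for r dr. Half of the D² term absorbs this error (`localized_energy_bound`); the other
half bounds the boundary term of the Lagrange identity, so that T_k is symmetric and the energy real
(`InRealDomain.symm`).

For the eigenfunctions of A, the circular components u₀ ± i u₁ diagonalize J, and the phase in L_w
couples the frequency j + m of one to the frequency j - m of the other. Testing the weak equation
against |κ|-th powers of z or of its conjugate times η(|z|²) gives a twice integrated radial
equation for each Fourier coefficient (`LcGraph_angCoeff`). Because η need not vanish at 0, this
equation excludes the singular solutions; it yields a C² representative with a limit at 0. Decay at
infinity follows because |y₊|² + |y₋|² is a subsolution of Δs = s there. Each coefficient pair is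
thus a mode solution (`isModeSolution_modeRep`). Since Im(iλ) = Re λ > 0, the pairs with j = 0 or
|j| ≥ 2m vanish, and Parseval identifies the eigenfunction with the finite sum of the others. -/

lemma hasDerivAt_of_contDiffOn_Ioi (hf : ContDiffOn ℝ 2 f (Ioi 0)) {r : ℝ} (hr : 0 < r) :
    HasDerivAt f (deriv f r) r :=
  ((hf.contDiffAt (Ioi_mem_nhds hr)).differentiableAt (by norm_num)).hasDerivAt

lemma contDiffOn_deriv_Ioi (hf : ContDiffOn ℝ 2 f (Ioi 0)) :
    ContDiffOn ℝ 1 (deriv f) (Ioi 0) := by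
  have h : ContDiffOn ℝ (1 + 1) f (Ioi 0) := by rw [one_add_one_eq_two]; exact hf
  exact ((contDiffOn_succ_iff_deriv_of_isOpen isOpen_Ioi).1 h).2.2

lemma hasDerivAt_deriv_of_contDiffOn_Ioi (hf : ContDiffOn ℝ 2 f (Ioi 0)) {r : ℝ} (hr : 0 < r) :
    HasDerivAt (deriv f) (deriv (deriv f) r) r :=
  (((contDiffOn_deriv_Ioi hf).contDiffAt (Ioi_mem_nhds hr)).differentiableAt
    (by norm_num)).hasDerivAt

/-- A function with given continuous first and second derivatives is `C²` on the half-line. -/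
lemma contDiffOn_two_of_hasDerivAt {f' f'' : ℝ → E} (h : ∀ r, 0 < r → HasDerivAt f (f' r) r)
    (h' : ∀ r, 0 < r → HasDerivAt f' (f'' r) r) (hc : ContinuousOn f'' (Ioi 0)) :
    ContDiffOn ℝ 2 f (Ioi 0) := by
  have key : ContDiffOn ℝ (1 + 1) f (Ioi 0) := by
    rw [contDiffOn_succ_iff_deriv_of_isOpen isOpen_Ioi]
    refine ⟨fun r hr => (h r hr).differentiableAt.differentiableWithinAt, by simp, ?_⟩
    have h1 : ContDiffOn ℝ (0 + 1) f' (Ioi 0) := by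
      rw [contDiffOn_succ_iff_deriv_of_isOpen isOpen_Ioi]
      refine ⟨fun r hr => (h' r hr).differentiableAt.differentiableWithinAt, by simp, ?_⟩
      rw [contDiffOn_zero]
      exact hc.congr fun r hr => (h' r hr).deriv
    rw [zero_add] at h1
    exact h1.congr fun r hr => (h r hr).deriv
  simpa [one_add_one_eq_two] using key

end HalfLine

/-! ### Positivity and boundedness of the profile -/

section Profile

variable {m : ℕ} {μ : ℝ} {w : ℝ → ℝ}

lemma IsVortexProfile.continuousOn (hw : IsVortexProfile m μ w) : ContinuousOn w (Ioi 0) :=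
  hw.contDiffOn.continuousOn

lemma IsVortexProfile.hasDerivAt (hw : IsVortexProfile m μ w) {r : ℝ} (hr : 0 < r) :
    HasDerivAt w (deriv w r) r := hasDerivAt_of_contDiffOn_Ioi hw.contDiffOn hr

lemma IsVortexProfile.hasDerivAt_deriv (hw : IsVortexProfile m μ w) {r : ℝ} (hr : 0 < r) :
    HasDerivAt (deriv w)
      (-(deriv w r) / r + ((m : ℝ) ^ 2 / r ^ 2 + r ^ 2 + 2 * w r ^ 2 - 2 * μ) * w r) r := by
  have h := hasDerivAt_deriv_of_contDiffOn_Ioi hw.contDiffOn hr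
  have e := hw.equation r hr
  rw [sq_abs] at e
  exact h.congr_deriv (by linear_combination -e)

/-- A profile with a double zero vanishes identically. -/
lemma IsVortexProfile.eq_zero_of_double_zero (hw : IsVortexProfile m μ w) {r₀ : ℝ} (h₀ : 0 < r₀)
    (hz : w r₀ = 0) (hz' : deriv w r₀ = 0) {r : ℝ} (hr : 0 < r) : w r = 0 := by
  -- A compact interval of (0, ∞) with r₀ and r in its interior: the first order system for (w, w')
  -- is Lipschitz there, so uniqueness against the zero solution applies.
  set a := min r₀ r / 2 with ha
  set b := max r₀ r + 1 with hb
  have ha0 : 0 < a := by rw [ha]; have := lt_min h₀ hr; linarith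
  have har₀ : a < r₀ := by rw [ha]; have := min_le_left r₀ r; have := lt_min h₀ hr; linarith
  have har : a < r := by rw [ha]; have := min_le_right r₀ r; have := lt_min h₀ hr; linarith
  have hbr₀ : r₀ < b := by rw [hb]; have := le_max_left r₀ r; linarith
  have hbr : r < b := by rw [hb]; have := le_max_right r₀ r; linarith
  have hsub : Icc a b ⊆ Ioi 0 := fun x hx => ha0.trans_le hx.1
  obtain ⟨M, hM⟩ := isCompact_Icc.exists_bound_of_continuousOn
    (f := fun r => (m : ℝ) ^ 2 / r ^ 2 + r ^ 2 + 2 * w r ^ 2 - 2 * μ) (s := Icc a b) (by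
      have := hw.continuousOn.mono hsub
      have hne : ∀ x ∈ Icc a b, x ^ 2 ≠ 0 := fun x hx => (pow_pos (hsub hx) 2).ne'
      fun_prop (disch := assumption))
  have hM0 : 0 ≤ M := (norm_nonneg _).trans (hM r₀ ⟨har₀.le, hbr₀.le⟩)
  let c : ℝ → ℝ := fun r => (m : ℝ) ^ 2 / r ^ 2 + r ^ 2 + 2 * w r ^ 2 - 2 * μ
  let v : ℝ → ℝ × ℝ → ℝ × ℝ := fun t p => (p.2, -p.2 / t + c t * p.1)
  have hv : ∀ t ∈ Ioo a b, LipschitzOnWith (Real.toNNReal (1 + 1 / a + M)) (v t) univ := by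
    intro t ht
    have ht' : t ∈ Icc a b := Ioo_subset_Icc_self ht
    have ht0 : 0 < t := hsub ht'
    refine LipschitzOnWith.of_dist_le_mul fun p _ p' _ => ?_
    have hK : (0 : ℝ) ≤ 1 + 1 / a + M := by positivity
    rw [Real.coe_toNNReal _ hK, dist_eq_norm, dist_eq_norm]
    set d := p - p' with hd
    have h1 : |d.1| ≤ ‖d‖ := norm_fst_le d
    have h2 : |d.2| ≤ ‖d‖ := norm_snd_le d
    have e : v t p - v t p' = (d.2, -d.2 / t + c t * d.1) := by
      simp only [v, hd, Prod.mk_sub_mk, Prod.fst_sub, Prod.snd_sub]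
      congr 1; ring
    rw [e, Prod.norm_def]
    have hc : |c t| ≤ M := hM t ht'
    have ht1 : 1 / t ≤ 1 / a := one_div_le_one_div_of_le ha0 ht.1.le
    have hd0 := norm_nonneg d
    have hA : |-d.2 / t| ≤ 1 / a * ‖d‖ := by
      rw [abs_div, abs_neg, abs_of_pos ht0, div_eq_mul_one_div, mul_comm]
      exact mul_le_mul ht1 h2 (abs_nonneg _) (by positivity)
    have hB : |c t * d.1| ≤ M * ‖d‖ := by
      rw [abs_mul]; exact mul_le_mul hc h1 (abs_nonneg _) hM0
    have hC : 0 ≤ 1 / a * ‖d‖ := by positivity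
    have hD : 0 ≤ M * ‖d‖ := by positivity
    refine max_le ?_ ?_
    · change |d.2| ≤ _
      nlinarith
    · change |-d.2 / t + c t * d.1| ≤ _
      calc _ ≤ |-d.2 / t| + |c t * d.1| := abs_add_le _ _
        _ ≤ _ := by nlinarith
  have hcw : ContinuousOn w (Icc a b) := hw.continuousOn.mono hsub
  have hcw' : ContinuousOn (deriv w) (Icc a b) :=
    (contDiffOn_deriv_Ioi hw.contDiffOn).continuousOn.mono hsub
  have key := ODE_solution_unique_of_mem_Icc (s := fun _ => univ) hv (t₀ := r₀) ⟨har₀, hbr₀⟩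
    (f := fun t => (w t, deriv w t)) (g := fun _ => (0, 0)) (hcw.prodMk hcw')
    (fun t ht => (hw.hasDerivAt (ha0.trans ht.1)).prodMk (hw.hasDerivAt_deriv (ha0.trans ht.1)))
    (fun _ _ => mem_univ _) continuousOn_const
    (fun t _ => by
      have : v t ((fun _ => ((0 : ℝ), (0 : ℝ))) t) = (0, 0) := by simp [v]
      rw [this]; exact hasDerivAt_const _ _)
    (fun _ _ => mem_univ _) (by simp [hz, hz'])
  exact congrArg Prod.fst (key ⟨har.le, hbr.le⟩)

/-- A zero of a non-negative function is an interior minimum, hence a double zero, which would force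
w to vanish identically. -/
lemma IsVortexProfile.pos (hw : IsVortexProfile m μ w) {r : ℝ} (hr : 0 < r) : 0 < w r := by
  refine (hw.nonneg r hr).lt_of_ne' fun hz => ?_
  have hmin : IsLocalMin w r := by
    filter_upwards [Ioi_mem_nhds hr] with x hx
    rw [hz]; exact hw.nonneg x hx
  obtain ⟨x, hx, hne⟩ := hw.nontrivial
  exact hne (hw.eq_zero_of_double_zero hr hz hmin.deriv_eq_zero hx)

/-- A function continuous on `(0, ∞)`, bounded near `0` and near `∞`, is bounded. -/
lemma exists_bound_Ioi {E : Type*} [NormedAddCommGroup E] {f : ℝ → E} (hf : ContinuousOn f (Ioi 0))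
    (h0 : ∃ C : ℝ, ∀ᶠ r in 𝓝[>] (0 : ℝ), ‖f r‖ ≤ C) (h1 : ∃ C : ℝ, ∀ᶠ r in atTop, ‖f r‖ ≤ C) :
    ∃ C : ℝ, 0 ≤ C ∧ ∀ r, 0 < r → ‖f r‖ ≤ C := by
  obtain ⟨C₀, h0⟩ := h0
  obtain ⟨C₁, h1⟩ := h1
  obtain ⟨a, ha, h0⟩ := mem_nhdsGT_iff_exists_Ioo_subset.1 h0
  obtain ⟨b, h1⟩ := eventually_atTop.1 h1
  obtain ⟨C₂, h2⟩ := isCompact_Icc.exists_bound_of_continuousOn (s := Icc a b)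
    (hf.mono fun x hx => lt_of_lt_of_le ha hx.1)
  refine ⟨max 0 (max C₀ (max C₁ C₂)), le_max_left _ _, fun r hr => ?_⟩
  rcases lt_or_ge r a with h | h
  · have : ‖f r‖ ≤ C₀ := h0 ⟨hr, h⟩
    exact this.trans (by simp)
  · rcases le_total b r with h' | h'
    · exact (h1 r h').trans (by simp)
    · exact (h2 r ⟨h, h'⟩).trans (by simp)

lemma IsVortexProfile.exists_bound (hw : IsVortexProfile m μ w) :
    ∃ C : ℝ, 0 ≤ C ∧ ∀ r, 0 < r → |w r| ≤ C :=
  exists_bound_Ioi hw.continuousOn hw.bounded_zero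
    ⟨1, by
      have := hw.tendsto_atTop.norm
      rw [norm_zero] at this
      exact (this.eventually (gt_mem_nhds one_pos)).mono fun _ h => h.le⟩

/-- The logarithmic derivative of the profile. -/
noncomputable def logD (w : ℝ → ℝ) (r : ℝ) : ℝ := deriv w r / w r

/-- The Riccati form of the profile equation, through which w enters the ground state
representation. -/
lemma IsVortexProfile.hasDerivAt_logD (hw : IsVortexProfile m μ w) {r : ℝ} (hr : 0 < r) :
    HasDerivAt (logD w) (-(logD w r) / r + ((m : ℝ) ^ 2 / r ^ 2 + r ^ 2 + 2 * w r ^ 2 - 2 * μ)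
      - logD w r ^ 2) r := by
  have hp := (hw.pos hr).ne'
  have h := (hw.hasDerivAt_deriv hr).div (hw.hasDerivAt hr) hp
  refine h.congr_deriv ?_
  unfold logD
  field_simp

lemma IsVortexProfile.contDiffOn_logD (hw : IsVortexProfile m μ w) :
    ContDiffOn ℝ 1 (logD w) (Ioi 0) :=
  (contDiffOn_deriv_Ioi hw.contDiffOn).div (hw.contDiffOn.of_le (by norm_num))
    fun _ hr => (hw.pos hr).ne'

end Profile

end GPVortex

namespace GPVortex

/-! ### The measure `r dr` -/

section RadialMeasure

variable {E : Type*} [NormedAddCommGroup E]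

lemma integral_radialMeasure [NormedSpace ℝ E] (f : ℝ → E) :
    ∫ r, f r ∂radialMeasure = ∫ r in Ioi 0, r • f r := by
  rw [radialMeasure, integral_withDensity_eq_integral_toReal_smul
    (by fun_prop) (ae_of_all _ fun _ => ENNReal.ofReal_lt_top)]
  refine setIntegral_congr_fun measurableSet_Ioi fun r hr => ?_
  simp only [ENNReal.toReal_ofReal (le_of_lt hr)]

lemma integrable_radialMeasure_iff [NormedSpace ℝ E] {f : ℝ → E} :
    Integrable f radialMeasure ↔ IntegrableOn (fun r => r • f r) (Ioi 0) := by
  rw [radialMeasure, integrable_withDensity_iff_integrable_smul'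
    (by fun_prop) (ae_of_all _ fun _ => ENNReal.ofReal_lt_top), IntegrableOn]
  refine integrable_congr ((ae_restrict_mem measurableSet_Ioi).mono fun r hr => ?_)
  simp only [ENNReal.toReal_ofReal (le_of_lt hr)]

lemma ae_radialMeasure_iff {p : ℝ → Prop} :
    (∀ᵐ r ∂radialMeasure, p r) ↔ ∀ᵐ r, 0 < r → p r := by
  rw [radialMeasure, ae_withDensity_iff (by fun_prop), ae_restrict_iff' measurableSet_Ioi]
  refine ⟨fun h => h.mono fun r hr h0 => hr h0 ?_, fun h => h.mono fun r hr h0 _ => hr h0⟩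
  simpa using h0

lemma radialMeasure_absolutelyContinuous : radialMeasure ≪ volume.restrict (Ioi 0) :=
  withDensity_absolutelyContinuous _ _

lemma aestronglyMeasurable_radialMeasure {f : ℝ → E} (hf : ContinuousOn f (Ioi 0)) :
    AEStronglyMeasurable f radialMeasure :=
  (hf.aestronglyMeasurable measurableSet_Ioi).mono_ac radialMeasure_absolutelyContinuous

/-- A bounded function times a square integrable function. -/
lemma memLp_two_bdd_mul {𝕜 : Type*} [RCLike 𝕜] {φ f : ℝ → 𝕜}
    (hf : MemLp f 2 radialMeasure) (hφ : ContinuousOn φ (Ioi 0)) {C : ℝ}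
    (hC : ∀ r, 0 < r → ‖φ r‖ ≤ C) : MemLp (fun r => φ r * f r) 2 radialMeasure := by
  refine hf.of_le_mul (c := C) ((aestronglyMeasurable_radialMeasure hφ).mul hf.1) ?_
  rw [ae_radialMeasure_iff]
  refine ae_of_all _ fun r hr => ?_
  rw [norm_mul]
  exact mul_le_mul_of_nonneg_right (hC r hr) (norm_nonneg _)

end RadialMeasure

/-! ### Logarithmic cutoff functions -/

/-- A smooth bump, equal to `1` on `[-1, 1]` and supported in `[-2, 2]`. -/
noncomputable def logBump : ContDiffBump (0 : ℝ) := ⟨1, 2, one_pos, one_lt_two⟩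

/-- The cutoff function `χₙ(r) = ρ(log r / (n + 1))`. -/
noncomputable def cutoff (n : ℕ) (r : ℝ) : ℝ := logBump (Real.log r / (n + 1))

/-- The derivative of the cutoff function. -/
noncomputable def cutoffDeriv (n : ℕ) (r : ℝ) : ℝ :=
  deriv logBump (Real.log r / (n + 1)) * (1 / r / (n + 1))

lemma hasDerivAt_cutoff (n : ℕ) {r : ℝ} (hr : 0 < r) :
    HasDerivAt (cutoff n) (cutoffDeriv n r) r := by
  have h1 : HasDerivAt (fun r => Real.log r / ((n : ℝ) + 1)) (1 / r / (n + 1)) r := by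
    simpa using (Real.hasDerivAt_log hr.ne').div_const ((n : ℝ) + 1)
  have h2 := (logBump.contDiff (n := 1)).differentiable one_ne_zero (Real.log r / (n + 1))
  exact h2.hasDerivAt.comp r h1

lemma continuousOn_cutoffDeriv (n : ℕ) : ContinuousOn (cutoffDeriv n) (Ioi 0) := by
  have h : Continuous (deriv logBump) := (logBump.contDiff (n := 1)).continuous_deriv le_rfl
  have hl : ContinuousOn (fun r => Real.log r / ((n : ℝ) + 1)) (Ioi 0) :=
    (Real.continuousOn_log.mono fun r hr => (ne_of_gt hr : r ≠ 0)).div_const _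
  refine (h.comp_continuousOn hl).mul (ContinuousOn.div_const ?_ _)
  exact continuousOn_const.div continuousOn_id fun r hr => ne_of_gt hr

lemma continuousOn_cutoff (n : ℕ) : ContinuousOn (cutoff n) (Ioi 0) :=
  fun _ hr => (hasDerivAt_cutoff n hr).continuousAt.continuousWithinAt

lemma cutoff_nonneg (n : ℕ) (r : ℝ) : 0 ≤ cutoff n r := logBump.nonneg

lemma cutoff_le_one (n : ℕ) (r : ℝ) : cutoff n r ≤ 1 := logBump.le_one

lemma cutoff_sq_le_one (n : ℕ) (r : ℝ) : cutoff n r ^ 2 ≤ 1 :=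
  pow_le_one₀ (cutoff_nonneg n r) (cutoff_le_one n r)

lemma cutoff_eq_zero (n : ℕ) {r : ℝ} (hr : 0 < r)
    (h : r ≤ Real.exp (-(2 * (n + 1))) ∨ Real.exp (2 * (n + 1)) ≤ r) : cutoff n r = 0 := by
  refine logBump.zero_of_le_dist ?_
  have hn : (0 : ℝ) < n + 1 := by positivity
  rw [Real.dist_0_eq_abs, abs_div, abs_of_pos hn, le_div_iff₀ hn]
  change 2 * ((n : ℝ) + 1) ≤ _
  rcases h with h | h
  · have := (Real.log_le_iff_le_exp hr).2 h
    rw [abs_of_nonpos (by linarith)]; linarith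
  · exact ((Real.le_log_iff_exp_le hr).2 h).trans (le_abs_self _)

lemma cutoff_eq_one (n : ℕ) {r : ℝ} (hr : 0 < r)
    (h : Real.exp (-(n + 1)) ≤ r) (h' : r ≤ Real.exp (n + 1)) : cutoff n r = 1 := by
  refine logBump.one_of_mem_closedBall ?_
  have hn : (0 : ℝ) < n + 1 := by positivity
  rw [mem_closedBall_zero_iff, Real.norm_eq_abs, abs_div, abs_of_pos hn, div_le_iff₀ hn]
  change _ ≤ 1 * ((n : ℝ) + 1)
  rw [one_mul, abs_le]
  exact ⟨(Real.le_log_iff_exp_le hr).2 h, (Real.log_le_iff_le_exp hr).2 h'⟩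

/-- On the scale of log r the bound K/((n+1)² r) integrates to O(1/(n+1)) over the support of the
cutoff. A cutoff on a linear scale would leave an error of order one near 0 for functions that are
merely bounded there. -/
lemma exists_bound_cutoffDeriv : ∃ K : ℝ, ∀ (n : ℕ) (r : ℝ), 0 < r →
    r * cutoffDeriv n r ^ 2 ≤ K / (n + 1) ^ 2 * (1 / r) := by
  have h : Continuous (deriv logBump) := (logBump.contDiff (n := 1)).continuous_deriv le_rfl
  have hc : HasCompactSupport (deriv logBump) := logBump.hasCompactSupport.deriv
  obtain ⟨K, hK⟩ := hc.exists_bound_of_continuous h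
  refine ⟨K ^ 2, fun n r hr => ?_⟩
  have hn : (0 : ℝ) < n + 1 := by positivity
  have h1 : deriv logBump (Real.log r / (n + 1)) ^ 2 ≤ K ^ 2 := by
    rw [← sq_abs]
    exact pow_le_pow_left₀ (abs_nonneg _) (hK _) 2
  unfold cutoffDeriv
  rw [show r * (deriv logBump (Real.log r / (↑n + 1)) * (1 / r / (↑n + 1))) ^ 2
    = deriv logBump (Real.log r / (n + 1)) ^ 2 / (n + 1) ^ 2 * (1 / r) by field_simp]
  gcongr

lemma cutoff_Icc_pos (n : ℕ) {r : ℝ}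
    (hr : r ∈ Icc (Real.exp (-(2 * ((n : ℝ) + 1)))) (Real.exp (2 * ((n : ℝ) + 1)))) : 0 < r :=
  (Real.exp_pos _).trans_le hr.1

/-- The cutoff error of a function bounded near `0` and square integrable for `r dr` vanishes in
the limit. -/
lemma tendsto_cutoffDeriv_sq {f : ℝ → ℝ} (hf : ContinuousOn f (Ioi 0))
    (h0 : ∃ C : ℝ, ∀ᶠ r in 𝓝[>] (0 : ℝ), |f r| ≤ C) (hL : MemLp f 2 radialMeasure) :
    Tendsto (fun n : ℕ => ∫ r in (Real.exp (-(2 * ((n : ℝ) + 1))))..(Real.exp (2 * ((n : ℝ) + 1))),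
      r * cutoffDeriv n r ^ 2 * f r ^ 2) atTop (𝓝 0) := by
  obtain ⟨K, hK⟩ := exists_bound_cutoffDeriv
  have hK0 : 0 ≤ K := by
    have := (mul_nonneg zero_le_one (sq_nonneg _)).trans (hK 0 1 one_pos)
    simpa using this
  obtain ⟨B, hB0, hB⟩ : ∃ B : ℝ, 0 ≤ B ∧ ∀ r, 0 < r → r ≤ 1 → |f r| ≤ B := by
    -- Freezing f beyond r = 1 makes it bounded at infinity, so the global bound yields one on (0,
    -- 1].
    obtain ⟨B, hB0, hB⟩ := exists_bound_Ioi (f := fun r => f (min r 1))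
      (hf.comp (by fun_prop) fun r hr => mem_Ioi.2 (lt_min hr one_pos))
      (by
        obtain ⟨C, hC⟩ := h0
        refine ⟨C, ?_⟩
        filter_upwards [hC, Ioo_mem_nhdsGT one_pos] with r hr hr1
        rwa [min_eq_left hr1.2.le])
      ⟨|f 1|, by filter_upwards [eventually_ge_atTop 1] with r hr; rw [min_eq_right hr]; exact le_rfl⟩
    exact ⟨B, hB0, fun r hr hr1 => by simpa [min_eq_left hr1] using hB r hr⟩
  have hI : IntegrableOn (fun r => r * f r ^ 2) (Ioi 0) := by
    simpa using integrable_radialMeasure_iff.1 hL.integrable_sq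
  set I := ∫ r in Ioi 0, r * f r ^ 2 with hIdef
  have key : ∀ n : ℕ, (∫ r in (Real.exp (-(2 * ((n : ℝ) + 1))))..(Real.exp (2 * ((n : ℝ) + 1))),
      r * cutoffDeriv n r ^ 2 * f r ^ 2) ≤ K / (n + 1) ^ 2 * I + 2 * K * B ^ 2 * (1 / (n + 1)) := by
    intro n
    have hn : (0 : ℝ) < n + 1 := by positivity
    set a := Real.exp (-(2 * ((n : ℝ) + 1))) with ha
    set b := Real.exp (2 * ((n : ℝ) + 1)) with hb
    have ha0 : 0 < a := Real.exp_pos _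
    have ha1 : a ≤ 1 := Real.exp_le_one_iff.2 (by linarith)
    have hb1 : 1 ≤ b := Real.one_le_exp (by positivity)
    have hcont : ContinuousOn (fun r => r * cutoffDeriv n r ^ 2 * f r ^ 2) (Ioi 0) := by
      have := continuousOn_cutoffDeriv n
      fun_prop
    have i1 : IntervalIntegrable (fun r => r * cutoffDeriv n r ^ 2 * f r ^ 2) volume a 1 :=
      (hcont.mono fun r hr => by rw [uIcc_of_le ha1] at hr; exact ha0.trans_le hr.1).intervalIntegrable
    have i2 : IntervalIntegrable (fun r => r * cutoffDeriv n r ^ 2 * f r ^ 2) volume 1 b :=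
      (hcont.mono fun r hr => by
        rw [uIcc_of_le hb1] at hr; exact one_pos.trans_le hr.1).intervalIntegrable
    -- Beyond 1 use 1/r ≤ r and the integrability of r f². Below 1 use |f| ≤ B and ∫ dr/r = 2(n+1),
    -- which one factor n+1 in the denominator compensates.
    rw [← intervalIntegral.integral_add_adjacent_intervals i1 i2, add_comm]
    refine add_le_add ?_ ?_
    · calc ∫ r in (1 : ℝ)..b, r * cutoffDeriv n r ^ 2 * f r ^ 2
          ≤ ∫ r in (1 : ℝ)..b, K / (n + 1) ^ 2 * (r * f r ^ 2) := by
            refine intervalIntegral.integral_mono_on hb1 i2 ?_ fun r hr => ?_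
            · refine ContinuousOn.intervalIntegrable ?_
              rw [uIcc_of_le hb1]
              have := hf.mono (show Icc 1 b ⊆ Ioi 0 from fun r hr => one_pos.trans_le hr.1)
              fun_prop
            · have hr0 : 0 < r := one_pos.trans_le hr.1
              have h1 : 1 / r ≤ r := by
                rw [div_le_iff₀ hr0]; nlinarith [hr.1]
              calc _ ≤ K / (n + 1) ^ 2 * (1 / r) * f r ^ 2 :=
                    mul_le_mul_of_nonneg_right (hK n r hr0) (sq_nonneg _)
                _ ≤ K / (n + 1) ^ 2 * r * f r ^ 2 := by gcongr
                _ = _ := by ring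
        _ ≤ K / (n + 1) ^ 2 * I := by
            rw [intervalIntegral.integral_const_mul, intervalIntegral.integral_of_le hb1]
            refine mul_le_mul_of_nonneg_left ?_ (by positivity)
            refine setIntegral_mono_set hI ?_ ?_
            · exact (ae_restrict_mem measurableSet_Ioi).mono fun r hr =>
                mul_nonneg (le_of_lt hr) (sq_nonneg _)
            · exact LE.le.eventuallyLE (show Ioc 1 b ⊆ Ioi 0 from fun r hr => one_pos.trans hr.1)
    · calc ∫ r in a..1, r * cutoffDeriv n r ^ 2 * f r ^ 2
          ≤ ∫ r in a..1, K * B ^ 2 / (n + 1) ^ 2 * (1 / r) := by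
            refine intervalIntegral.integral_mono_on ha1 i1 ?_ fun r hr => ?_
            · refine ContinuousOn.intervalIntegrable ?_
              rw [uIcc_of_le ha1]
              exact continuousOn_const.mul (continuousOn_const.div continuousOn_id
                fun r hr => (ha0.trans_le hr.1).ne')
            · have hr0 : 0 < r := ha0.trans_le hr.1
              have hfB : f r ^ 2 ≤ B ^ 2 := by
                rw [← sq_abs]; exact pow_le_pow_left₀ (abs_nonneg _) (hB r hr0 hr.2) 2
              calc _ ≤ K / (n + 1) ^ 2 * (1 / r) * f r ^ 2 :=
                    mul_le_mul_of_nonneg_right (hK n r hr0) (sq_nonneg _)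
                _ ≤ K / (n + 1) ^ 2 * (1 / r) * B ^ 2 := by gcongr
                _ = _ := by ring
        _ = _ := by
            rw [intervalIntegral.integral_const_mul, integral_one_div_of_pos ha0 one_pos,
              one_div, Real.log_inv, ha, Real.log_exp]
            field_simp
  refine tendsto_of_tendsto_of_tendsto_of_le_of_le tendsto_const_nhds ?_ (fun n => ?_) key
  · have h1 : Tendsto (fun n : ℕ => 1 / ((n : ℝ) + 1)) atTop (𝓝 0) :=
      tendsto_one_div_add_atTop_nhds_zero_nat
    have h2 := ((h1.mul h1).mul_const (K * I)).add (h1.const_mul (2 * K * B ^ 2))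
    rw [zero_mul, zero_mul, mul_zero, add_zero] at h2
    refine h2.congr fun n => ?_
    field_simp
  · refine intervalIntegral.integral_nonneg (Real.exp_le_exp.2 ?_) fun r hr =>
      mul_nonneg (mul_nonneg (cutoff_Icc_pos n hr).le (sq_nonneg _)) (sq_nonneg _)
    have : (0 : ℝ) ≤ n := n.cast_nonneg
    linarith

/-- The truncated integrals `∫ χₙ² h` converge to the full integral. -/
lemma tendsto_integral_cutoff_sq {h : ℝ → ℝ} (hh : IntegrableOn h (Ioi 0)) :
    Tendsto (fun n : ℕ => ∫ r in (Real.exp (-(2 * ((n : ℝ) + 1))))..(Real.exp (2 * ((n : ℝ) + 1))),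
      cutoff n r ^ 2 * h r) atTop (𝓝 (∫ r in Ioi 0, h r)) := by
  have e : ∀ n : ℕ, (∫ r in (Real.exp (-(2 * ((n : ℝ) + 1))))..(Real.exp (2 * ((n : ℝ) + 1))),
      cutoff n r ^ 2 * h r) = ∫ r in Ioi 0, cutoff n r ^ 2 * h r := by
    intro n
    have : (0 : ℝ) ≤ n := n.cast_nonneg
    rw [intervalIntegral.integral_of_le (Real.exp_le_exp.2 (by linarith))]
    refine (setIntegral_eq_of_subset_of_forall_sdiff_eq_zero measurableSet_Ioi
      (fun r hr => (Real.exp_pos _).trans hr.1) fun r hr => ?_).symm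
    have hr0 : 0 < r := hr.1
    have : cutoff n r = 0 := by
      refine cutoff_eq_zero n hr0 ?_
      by_contra! hcon
      exact hr.2 ⟨hcon.1, hcon.2.le⟩
    rw [this]; ring
  simp_rw [e]
  refine tendsto_integral_of_dominated_convergence (fun r => |h r|) (fun n => ?_) hh.abs
    (fun n => ?_) ?_
  · exact (((continuousOn_cutoff n).pow 2).aestronglyMeasurable measurableSet_Ioi).mul hh.1
  · refine ae_of_all _ fun r => ?_
    rw [norm_mul, Real.norm_eq_abs, Real.norm_eq_abs, abs_of_nonneg (sq_nonneg _)]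
    exact mul_le_of_le_one_left (abs_nonneg _) (cutoff_sq_le_one n r)
  · refine (ae_restrict_mem measurableSet_Ioi).mono fun r hr => ?_
    have hr0 : (0 : ℝ) < r := hr
    refine tendsto_const_nhds.congr' ?_
    obtain ⟨N, hN⟩ := exists_nat_ge |Real.log r|
    filter_upwards [eventually_ge_atTop N] with n hn
    have hn' : (N : ℝ) ≤ n := Nat.cast_le.2 hn
    have h1 := abs_le.1 (hN.trans hn')
    rw [cutoff_eq_one n hr0 ((Real.le_log_iff_exp_le hr0).1 (by linarith))
      ((Real.log_le_iff_le_exp hr0).1 (by linarith))]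
    ring

/-- On a fixed compact interval the cutoff functions are eventually equal to `1`. -/
lemma eventually_cutoff_eq_one {a b : ℝ} (ha : 0 < a) (hab : a ≤ b) :
    ∀ᶠ n : ℕ in atTop, Icc a b ⊆
      Icc (Real.exp (-(2 * ((n : ℝ) + 1)))) (Real.exp (2 * ((n : ℝ) + 1))) ∧
      ∀ r ∈ Icc a b, cutoff n r = 1 := by
  have hb : 0 < b := ha.trans_le hab
  obtain ⟨N, hN⟩ := exists_nat_ge (max |Real.log a| |Real.log b|)
  filter_upwards [eventually_ge_atTop N] with n hn
  have hn' : (N : ℝ) ≤ n := Nat.cast_le.2 hn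
  have h1 := abs_le.1 (((le_max_left _ _).trans hN).trans hn')
  have h2 := abs_le.1 (((le_max_right _ _).trans hN).trans hn')
  have e1 : Real.exp (-(n + 1)) ≤ a := (Real.le_log_iff_exp_le ha).1 (by linarith)
  have e2 : b ≤ Real.exp (n + 1) := (Real.log_le_iff_le_exp hb).1 (by linarith)
  have h0 : (0 : ℝ) ≤ n := n.cast_nonneg
  refine ⟨Icc_subset_Icc (le_trans (Real.exp_le_exp.2 (by linarith)) e1)
    (e2.trans (Real.exp_le_exp.2 (by linarith))), fun r hr => ?_⟩
  exact cutoff_eq_one n (ha.trans_le hr.1) (e1.trans hr.1) (hr.2.trans e2)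

end GPVortex

namespace GPVortex

/-! ### Coercivity of the radial Schrödinger operators, real case -/

/-- The operator `-½ Δ_r + k²/(2r²) + ½ r² - μ + w²` on real functions. -/
noncomputable def realHam (μ : ℝ) (w : ℝ → ℝ) (k : ℤ) (f : ℝ → ℝ) (r : ℝ) : ℝ :=
  -(1 / 2) * (deriv (deriv f) r + (1 / r) * deriv f r)
    + ((k : ℝ) ^ 2 / (2 * r ^ 2) + r ^ 2 / 2 - μ + w r ^ 2) * f r

/-- The derivative relative to the ground state `w`, that is `w (f / w)'`. -/
noncomputable def groundDeriv (w f : ℝ → ℝ) (r : ℝ) : ℝ := deriv f r - logD w r * f r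

/-- The domain of `realHam`. -/
structure InRealDomain (μ : ℝ) (w : ℝ → ℝ) (k : ℤ) (f : ℝ → ℝ) : Prop where
  differentiableOn : DifferentiableOn ℝ f (Ioi 0)
  absolutelyContinuous : ∀ a b : ℝ, 0 < a → a ≤ b → AbsolutelyContinuousOnInterval (deriv f) a b
  bounded_zero : ∃ C : ℝ, ∀ᶠ r in 𝓝[>] (0 : ℝ), |f r| ≤ C
  memLp : MemLp f 2 radialMeasure
  memLp_ham : MemLp (realHam μ w k f) 2 radialMeasure

lemma Icc_subset_Ioi_zero {a b : ℝ} (ha : 0 < a) : Icc a b ⊆ Ioi 0 :=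
  fun _ hx => ha.trans_le hx.1

lemma continuousOn_Ioi_of_absolutelyContinuous {E : Type*} [SeminormedAddCommGroup E] {g : ℝ → E}
    (h : ∀ a b : ℝ, 0 < a → a ≤ b → AbsolutelyContinuousOnInterval g a b) :
    ContinuousOn g (Ioi 0) := by
  intro x hx
  have hx0 : 0 < x := hx
  have hc := (h (x / 2) (2 * x) (by linarith) (by linarith)).continuousOn
  rw [uIcc_of_le (by linarith)] at hc
  exact (hc.continuousAt (Icc_mem_nhds (by linarith) (by linarith))).continuousWithinAt

lemma absolutelyContinuous_of_hasDerivAt {f f' : ℝ → ℝ} (h : ∀ r, 0 < r → HasDerivAt f (f' r) r)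
    (hc : ContinuousOn f' (Ioi 0)) {a b : ℝ} (ha : 0 < a) (hab : a ≤ b) :
    AbsolutelyContinuousOnInterval f a b := by
  have key : ContDiffOn ℝ (0 + 1) f (Ioi 0) := by
    rw [contDiffOn_succ_iff_deriv_of_isOpen isOpen_Ioi]
    refine ⟨fun r hr => (h r hr).differentiableAt.differentiableWithinAt, by simp, ?_⟩
    rw [contDiffOn_zero]
    exact hc.congr fun r hr => (h r hr).deriv
  rw [zero_add] at key
  refine (key.mono ?_).absolutelyContinuousOnInterval
  rw [uIcc_of_le hab]; exact Icc_subset_Ioi_zero ha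

section RealCore

variable {m : ℕ} {μ : ℝ} {w : ℝ → ℝ} {k : ℤ} {f g : ℝ → ℝ}

lemma InRealDomain.hasDerivAt (hf : InRealDomain μ w k f) {r : ℝ} (hr : 0 < r) :
    HasDerivAt f (deriv f r) r :=
  (hf.differentiableOn.differentiableAt (Ioi_mem_nhds hr)).hasDerivAt

lemma InRealDomain.continuousOn_deriv (hf : InRealDomain μ w k f) :
    ContinuousOn (deriv f) (Ioi 0) :=
  continuousOn_Ioi_of_absolutelyContinuous hf.absolutelyContinuous

lemma InRealDomain.continuousOn (hf : InRealDomain μ w k f) : ContinuousOn f (Ioi 0) :=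
  hf.differentiableOn.continuousOn

lemma InRealDomain.continuousOn_groundDeriv (hw : IsVortexProfile m μ w)
    (hf : InRealDomain μ w k f) : ContinuousOn (groundDeriv w f) (Ioi 0) :=
  hf.continuousOn_deriv.sub (hw.contDiffOn_logD.continuousOn.mul hf.continuousOn)

lemma InRealDomain.integrableOn (hf : InRealDomain μ w k f) (hg : MemLp g 2 radialMeasure) :
    IntegrableOn (fun r => r * (realHam μ w k f r * g r)) (Ioi 0) :=
  integrable_radialMeasure_iff.1 (hf.memLp_ham.integrable_mul hg)

/-- Interval integrability of functions continuous on `(0, ∞)`. -/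
lemma intervalIntegrable_of_continuousOn_Ioi {E : Type*} [NormedAddCommGroup E] {h : ℝ → E}
    (hh : ContinuousOn h (Ioi 0)) {a b : ℝ} (ha : 0 < a) (hab : a ≤ b) :
    IntervalIntegrable h volume a b := by
  refine (hh.mono ?_).intervalIntegrable
  rw [uIcc_of_le hab]; exact Icc_subset_Ioi_zero ha

lemma intervalIntegrable_cutoff_mul {h : ℝ → ℝ} (hh : IntegrableOn h (Ioi 0)) (n : ℕ) {a b : ℝ}
    (ha : 0 < a) (hab : a ≤ b) :
    IntervalIntegrable (fun r => cutoff n r ^ 2 * h r) volume a b := by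
  have h1 : IntervalIntegrable h volume a b :=
    (intervalIntegrable_iff_integrableOn_Ioc_of_le hab).2
      (hh.mono_set fun r hr => ha.trans hr.1)
  refine h1.continuousOn_mul (((continuousOn_cutoff n).pow 2).mono ?_)
  rw [uIcc_of_le hab]; exact Icc_subset_Ioi_zero ha

lemma cutoff_exp_neg (n : ℕ) : cutoff n (Real.exp (-(2 * ((n : ℝ) + 1)))) = 0 :=
  cutoff_eq_zero n (Real.exp_pos _) (Or.inl le_rfl)

lemma cutoff_exp_pos (n : ℕ) : cutoff n (Real.exp (2 * ((n : ℝ) + 1))) = 0 :=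
  cutoff_eq_zero n (Real.exp_pos _) (Or.inr le_rfl)

lemma exp_neg_le_exp_pos (n : ℕ) :
    Real.exp (-(2 * ((n : ℝ) + 1))) ≤ Real.exp (2 * ((n : ℝ) + 1)) := by
  have : (0 : ℝ) ≤ n := n.cast_nonneg
  exact Real.exp_le_exp.2 (by linarith)

/-- The integral of a derivative of an absolutely continuous function carrying a factor `χₙ²`. -/
lemma integral_eq_zero_of_cutoff {Θ F : ℝ → ℝ} (n : ℕ)
    (hΘ : ∀ a b : ℝ, 0 < a → a ≤ b → AbsolutelyContinuousOnInterval Θ a b)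
    (h0 : ∀ r, cutoff n r = 0 → Θ r = 0)
    (hd : ∀ᵐ r, 0 < r → deriv Θ r = F r) :
    ∫ r in (Real.exp (-(2 * ((n : ℝ) + 1))))..(Real.exp (2 * ((n : ℝ) + 1))), F r = 0 := by
  have h := (hΘ _ _ (Real.exp_pos _) (exp_neg_le_exp_pos n)).integral_deriv_eq_sub
  rw [h0 _ (cutoff_exp_neg n), h0 _ (cutoff_exp_pos n), sub_zero] at h
  rw [← h]
  refine intervalIntegral.integral_congr_ae ?_
  filter_upwards [hd] with r hr hmem
  rw [uIoc_of_le (exp_neg_le_exp_pos n)] at hmem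
  exact (hr ((Real.exp_pos _).trans hmem.1)).symm

/-- An absolutely continuous function is differentiable almost everywhere, and the countably many
intervals [1/(n+1), n+1] exhaust (0, ∞). -/
lemma InRealDomain.ae_hasDerivAt_deriv (hf : InRealDomain μ w k f) :
    ∀ᵐ r, 0 < r → HasDerivAt (deriv f) (deriv (deriv f) r) r := by
  have h : ∀ n : ℕ, ∀ᵐ r, r ∈ uIcc (1 / ((n : ℝ) + 1)) ((n : ℝ) + 1) →
      DifferentiableAt ℝ (deriv f) r := by
    intro n
    have hn : (0 : ℝ) ≤ n := n.cast_nonneg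
    refine (hf.absolutelyContinuous _ _ (by positivity) ?_).ae_differentiableAt
    rw [div_le_iff₀ (by positivity)]; nlinarith
  filter_upwards [ae_all_iff.2 h] with r hr h0
  obtain ⟨n, hn⟩ := exists_nat_ge (max r (1 / r))
  have h1 : r ≤ n := (le_max_left _ _).trans hn
  have h2 : 1 / r ≤ n := (le_max_right _ _).trans hn
  have hn0 : (0 : ℝ) < n + 1 := by positivity
  refine (hr n (mem_uIcc_of_le ?_ (by linarith))).hasDerivAt
  rw [div_le_iff₀ hn0]
  rw [div_le_iff₀ h0] at h2
  nlinarith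

lemma absolutelyContinuous_cutoff (n : ℕ) {a b : ℝ} (ha : 0 < a) (hab : a ≤ b) :
    AbsolutelyContinuousOnInterval (cutoff n) a b :=
  absolutelyContinuous_of_hasDerivAt (fun _ hr => hasDerivAt_cutoff n hr)
    (continuousOn_cutoffDeriv n) ha hab

lemma absolutelyContinuous_fun_id (a b : ℝ) :
    AbsolutelyContinuousOnInterval (fun r : ℝ => r) a b :=
  contDiffOn_id.absolutelyContinuousOnInterval

lemma InRealDomain.absolutelyContinuous_self (hf : InRealDomain μ w k f) {a b : ℝ} (ha : 0 < a)
    (hab : a ≤ b) : AbsolutelyContinuousOnInterval f a b :=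
  absolutelyContinuous_of_hasDerivAt (fun _ hr => hf.hasDerivAt hr) hf.continuousOn_deriv ha hab

lemma IsVortexProfile.absolutelyContinuous_logD (hw : IsVortexProfile m μ w) {a b : ℝ}
    (ha : 0 < a) (hab : a ≤ b) : AbsolutelyContinuousOnInterval (logD w) a b := by
  refine (hw.contDiffOn_logD.mono ?_).absolutelyContinuousOnInterval
  rw [uIcc_of_le hab]; exact Icc_subset_Ioi_zero ha

/-- Jacobi's identity for the localized energy: with `D = w (f/w)'`,
`∫ 2 r χ χ' D f + r χ² (D² - 2 (T f) f + (k² - m²) f² / r²) = 0`. -/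
lemma localized_energy_identity (hw : IsVortexProfile m μ w) (hf : InRealDomain μ w k f) (n : ℕ) :
    ∫ r in (Real.exp (-(2 * ((n : ℝ) + 1))))..(Real.exp (2 * ((n : ℝ) + 1))),
      (2 * r * cutoff n r * cutoffDeriv n r * groundDeriv w f r * f r
        + r * cutoff n r ^ 2 * (groundDeriv w f r ^ 2 - 2 * (realHam μ w k f r * f r)
          + ((k : ℝ) ^ 2 - (m : ℝ) ^ 2) / r ^ 2 * f r ^ 2)) = 0 := by
  -- The function differentiated is r χₙ² D f. The Riccati equation replaces the derivative of
  -- `logD` by the potential of T_m, so that only the difference (k² - m²)/r² of the two potentials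
  -- survives.
  refine integral_eq_zero_of_cutoff
    (Θ := fun r => r * (cutoff n r * cutoff n r) * (deriv f r * f r - logD w r * (f r * f r)))
    n (fun a b ha hab => ?_) (fun r hr => by rw [hr]; ring) ?_
  · have h1 := absolutelyContinuous_cutoff n ha hab
    have h2 := hf.absolutelyContinuous_self ha hab
    exact ((absolutelyContinuous_fun_id a b).fun_mul (h1.fun_mul h1)).fun_mul
      (((hf.absolutelyContinuous a b ha hab).fun_mul h2).fun_sub
        ((hw.absolutelyContinuous_logD ha hab).fun_mul (h2.fun_mul h2)))
  · filter_upwards [hf.ae_hasDerivAt_deriv] with r hr h0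
    have hχ := hasDerivAt_cutoff n h0
    have hf1 := hf.hasDerivAt h0
    have h := (((hasDerivAt_id r).mul (hχ.mul hχ)).mul
      (((hr h0).mul hf1).sub ((hw.hasDerivAt_logD h0).mul (hf1.mul hf1)))).deriv
    refine Eq.trans h ?_
    simp only [id, groundDeriv, realHam, Pi.mul_apply, Pi.sub_apply]
    field_simp
    ring

/-- The localized Lagrange identity
`∫ 2 r χ χ' (D_f g - f D_g) - 2 r χ² ((T f) g - f (T g)) = 0`. -/
lemma localized_lagrange_identity (hf : InRealDomain μ w k f)
    (hg : InRealDomain μ w k g) (n : ℕ) :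
    ∫ r in (Real.exp (-(2 * ((n : ℝ) + 1))))..(Real.exp (2 * ((n : ℝ) + 1))),
      (2 * r * cutoff n r * cutoffDeriv n r * (groundDeriv w f r * g r - f r * groundDeriv w g r)
        - 2 * (cutoff n r ^ 2 * (r * (realHam μ w k f r * g r) - r * (realHam μ w k g r * f r))))
      = 0 := by
  -- Here it is r χₙ² times the Wronskian. The `logD` terms cancel in D_f g - f D_g, so the
  -- Wronskian can be written with D, the quantity that the energy controls.
  refine integral_eq_zero_of_cutoff
    (Θ := fun r => r * (cutoff n r * cutoff n r) * (deriv f r * g r - f r * deriv g r))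
    n (fun a b ha hab => ?_) (fun r hr => by rw [hr]; ring) ?_
  · have h1 := absolutelyContinuous_cutoff n ha hab
    have h2 := hf.absolutelyContinuous_self ha hab
    have h3 := hg.absolutelyContinuous_self ha hab
    exact ((absolutelyContinuous_fun_id a b).fun_mul (h1.fun_mul h1)).fun_mul
      (((hf.absolutelyContinuous a b ha hab).fun_mul h3).fun_sub
        (h2.fun_mul (hg.absolutelyContinuous a b ha hab)))
  · filter_upwards [hf.ae_hasDerivAt_deriv, hg.ae_hasDerivAt_deriv] with r hr hr' h0
    have hχ := hasDerivAt_cutoff n h0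
    have hf1 := hf.hasDerivAt h0
    have hg1 := hg.hasDerivAt h0
    have h := (((hasDerivAt_id r).mul (hχ.mul hχ)).mul
      (((hr h0).mul hg1).sub (hf1.mul (hr' h0)))).deriv
    refine Eq.trans h ?_
    simp only [id, groundDeriv, realHam, Pi.mul_apply, Pi.sub_apply]
    field_simp
    ring

/-- Abbreviation for the truncated integral over the support of `χₙ`. -/
noncomputable def truncInt (n : ℕ) (h : ℝ → ℝ) : ℝ :=
  ∫ r in (Real.exp (-(2 * ((n : ℝ) + 1))))..(Real.exp (2 * ((n : ℝ) + 1))), h r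

lemma truncInt_mono {n : ℕ} {h h' : ℝ → ℝ}
    (hh : IntervalIntegrable h volume (Real.exp (-(2 * ((n : ℝ) + 1))))
      (Real.exp (2 * ((n : ℝ) + 1))))
    (hh' : IntervalIntegrable h' volume (Real.exp (-(2 * ((n : ℝ) + 1))))
      (Real.exp (2 * ((n : ℝ) + 1))))
    (hle : ∀ r, 0 < r → h r ≤ h' r) : truncInt n h ≤ truncInt n h' :=
  intervalIntegral.integral_mono_on (exp_neg_le_exp_pos n) hh hh'
    fun _ hr => hle _ (cutoff_Icc_pos n hr)

/-- The ground state representation bounds the localized energy from below. -/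
lemma localized_energy_bound (hw : IsVortexProfile m μ w) (hf : InRealDomain μ w k f) (n : ℕ) :
    truncInt n (fun r => cutoff n r ^ 2 * (r * (1 / 4 * groundDeriv w f r ^ 2
        + ((k : ℝ) ^ 2 - (m : ℝ) ^ 2) / (2 * r ^ 2) * f r ^ 2)))
      ≤ truncInt n (fun r => cutoff n r ^ 2 * (r * (realHam μ w k f r * f r)))
        + truncInt n (fun r => r * cutoffDeriv n r ^ 2 * f r ^ 2) := by
  have hD := hf.continuousOn_groundDeriv hw
  have hfc := hf.continuousOn
  have hχ := continuousOn_cutoff n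
  have hχ' := continuousOn_cutoffDeriv n
  have hne : ∀ r ∈ Ioi (0 : ℝ), r ^ 2 ≠ 0 := fun r hr => (pow_pos hr 2).ne'
  have hne2 : ∀ r ∈ Ioi (0 : ℝ), 2 * r ^ 2 ≠ 0 := fun r hr => mul_ne_zero two_ne_zero (hne r hr)
  have hpos := Real.exp_pos (-(2 * ((n : ℝ) + 1)))
  have hle := exp_neg_le_exp_pos n
  have i1 := intervalIntegrable_of_continuousOn_Ioi (h := fun r => cutoff n r ^ 2 *
    (r * (1 / 4 * groundDeriv w f r ^ 2
        + ((k : ℝ) ^ 2 - (m : ℝ) ^ 2) / (2 * r ^ 2) * f r ^ 2)))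
    (by fun_prop (disch := assumption)) hpos hle
  have i2 := intervalIntegrable_cutoff_mul (hf.integrableOn hf.memLp) n hpos hle
  have i3 := intervalIntegrable_of_continuousOn_Ioi (h := fun r => r * cutoffDeriv n r ^ 2 * f r ^ 2)
    (by fun_prop) hpos hle
  have i4 := intervalIntegrable_of_continuousOn_Ioi (h := fun r =>
      2 * r * cutoff n r * cutoffDeriv n r * groundDeriv w f r * f r
        + r * cutoff n r ^ 2 * (groundDeriv w f r ^ 2
          + ((k : ℝ) ^ 2 - (m : ℝ) ^ 2) / r ^ 2 * f r ^ 2))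
    (by fun_prop (disch := assumption)) hpos hle
  have key := localized_energy_identity hw hf n
  have e : truncInt n (fun r => cutoff n r ^ 2 * (r * (realHam μ w k f r * f r)))
      + truncInt n (fun r => r * cutoffDeriv n r ^ 2 * f r ^ 2)
      = truncInt n (fun r => 1 / 2 * (2 * r * cutoff n r * cutoffDeriv n r * groundDeriv w f r * f r
        + r * cutoff n r ^ 2 * (groundDeriv w f r ^ 2
          + ((k : ℝ) ^ 2 - (m : ℝ) ^ 2) / r ^ 2 * f r ^ 2)) + r * cutoffDeriv n r ^ 2 * f r ^ 2) := by
    unfold truncInt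
    rw [intervalIntegral.integral_add (i4.const_mul _) i3, intervalIntegral.integral_const_mul]
    congr 1
    have h2 := intervalIntegral.integral_sub i4 (i2.const_mul 2)
    rw [intervalIntegral.integral_const_mul] at h2
    have h3 : (∫ r in (Real.exp (-(2 * ((n : ℝ) + 1))))..(Real.exp (2 * ((n : ℝ) + 1))),
      (2 * r * cutoff n r * cutoffDeriv n r * groundDeriv w f r * f r
        + r * cutoff n r ^ 2 * (groundDeriv w f r ^ 2
          + ((k : ℝ) ^ 2 - (m : ℝ) ^ 2) / r ^ 2 * f r ^ 2)
        - 2 * (cutoff n r ^ 2 * (r * (realHam μ w k f r * f r))))) = 0 := by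
      rw [← key]; congr 1; ext r; ring
    rw [h3] at h2
    linarith
  rw [e]
  refine truncInt_mono i1 ((i4.const_mul _).add i3) fun r hr => ?_
  -- Completing the square: the cross term r χ χ' D f is absorbed by ¼ r χ² D² and r χ'² f², which
  -- leaves ¼ of the original ½ r χ² D².
  have hsq := mul_nonneg hr.le (sq_nonneg
    (1 / 2 * cutoff n r * groundDeriv w f r + cutoffDeriv n r * f r))
  have e2 : ((k : ℝ) ^ 2 - (m : ℝ) ^ 2) / r ^ 2 = 2 * (((k : ℝ) ^ 2 - (m : ℝ) ^ 2) / (2 * r ^ 2)) := by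
    field_simp
  rw [e2]
  linear_combination hsq

/-- Once the cutoff equals 1 on [a, b], the rest of the truncated integral only adds a non-negative
amount. -/
lemma truncInt_cutoff_sq_mono {a b : ℝ} {h : ℝ → ℝ} (hh : ContinuousOn h (Ioi 0))
    (h0 : ∀ r, 0 < r → 0 ≤ h r) (ha : 0 < a) (hab : a ≤ b) :
    ∀ᶠ n : ℕ in atTop, ∫ r in a..b, h r ≤ truncInt n (fun r => cutoff n r ^ 2 * h r) := by
  filter_upwards [eventually_cutoff_eq_one ha hab] with n hn
  have e : ∫ r in a..b, h r = ∫ r in a..b, cutoff n r ^ 2 * h r := by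
    refine intervalIntegral.integral_congr fun r hr => ?_
    rw [uIcc_of_le hab] at hr
    rw [hn.2 r hr]; ring
  rw [e, truncInt]
  have h1 := hn.1 (left_mem_Icc.2 hab)
  have h2 := hn.1 (right_mem_Icc.2 hab)
  refine intervalIntegral.integral_mono_interval h1.1 hab h2.2 ?_ ?_
  · refine (ae_restrict_mem measurableSet_Ioc).mono fun r hr => ?_
    exact mul_nonneg (sq_nonneg _) (h0 r ((Real.exp_pos _).trans hr.1))
  · exact intervalIntegrable_of_continuousOn_Ioi (((continuousOn_cutoff n).pow 2).mul hh)
      (Real.exp_pos _) (exp_neg_le_exp_pos n)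

/-- Coercivity: `(T f, f)` controls `D = w (f/w)'` and the excess centrifugal energy. -/
lemma InRealDomain.energy_bound (hw : IsVortexProfile m μ w) (hf : InRealDomain μ w k f)
    (hk : (m : ℝ) ^ 2 ≤ (k : ℝ) ^ 2) {a b : ℝ} (ha : 0 < a) (hab : a ≤ b) :
    ∫ r in a..b, r * (1 / 4 * groundDeriv w f r ^ 2
        + ((k : ℝ) ^ 2 - (m : ℝ) ^ 2) / (2 * r ^ 2) * f r ^ 2)
      ≤ ∫ r in Ioi 0, r * (realHam μ w k f r * f r) := by
  have t := (tendsto_integral_cutoff_sq (hf.integrableOn hf.memLp)).add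
    (tendsto_cutoffDeriv_sq hf.continuousOn hf.bounded_zero hf.memLp)
  rw [add_zero] at t
  refine ge_of_tendsto t ?_
  have hD := hf.continuousOn_groundDeriv hw
  have hfc := hf.continuousOn
  have hne2 : ∀ r ∈ Ioi (0 : ℝ), 2 * r ^ 2 ≠ 0 :=
    fun r hr => mul_ne_zero two_ne_zero (pow_pos hr 2).ne'
  filter_upwards [truncInt_cutoff_sq_mono (h := fun r => r * (1 / 4 * groundDeriv w f r ^ 2
        + ((k : ℝ) ^ 2 - (m : ℝ) ^ 2) / (2 * r ^ 2) * f r ^ 2))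
        (by fun_prop (disch := assumption)) (fun r hr => by
          have := sub_nonneg.2 hk
          positivity) ha hab] with n hn
  exact hn.trans (localized_energy_bound hw hf n)

/-- The operator is symmetric on its domain. -/
lemma InRealDomain.symm (hw : IsVortexProfile m μ w) (hf : InRealDomain μ w k f)
    (hg : InRealDomain μ w k g) (hk : (m : ℝ) ^ 2 ≤ (k : ℝ) ^ 2) :
    ∫ r in Ioi 0, (r * (realHam μ w k f r * g r) - r * (realHam μ w k g r * f r)) = 0 := by
  set S := ∫ r in Ioi 0, (r * (realHam μ w k f r * g r) - r * (realHam μ w k g r * f r)) with hS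
  set E := (∫ r in Ioi 0, r * (realHam μ w k f r * f r))
    + ∫ r in Ioi 0, r * (realHam μ w k g r * g r) with hE
  have iS : IntegrableOn (fun r => r * (realHam μ w k f r * g r) - r * (realHam μ w k g r * f r))
      (Ioi 0) := (hf.integrableOn hg.memLp).sub (hg.integrableOn hf.memLp)
  -- In the Lagrange identity χ D of one function meets χ' times the other. Young's inequality with
  -- weight δ bounds this by δ times the localized energies plus 1/δ times the cutoff errors. The
  -- errors vanish as n → ∞, and then δ → 0.
  have key : ∀ δ : ℝ, 0 < δ → |S| ≤ δ * E := by
    intro δ hδ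
    have tS := (tendsto_integral_cutoff_sq iS).abs
    have tf := (tendsto_integral_cutoff_sq (hf.integrableOn hf.memLp)).add
      (tendsto_cutoffDeriv_sq hf.continuousOn hf.bounded_zero hf.memLp)
    have tg := (tendsto_integral_cutoff_sq (hg.integrableOn hg.memLp)).add
      (tendsto_cutoffDeriv_sq hg.continuousOn hg.bounded_zero hg.memLp)
    have tf' := tendsto_cutoffDeriv_sq hf.continuousOn hf.bounded_zero hf.memLp
    have tg' := tendsto_cutoffDeriv_sq hg.continuousOn hg.bounded_zero hg.memLp
    have t := ((tf.add tg).const_mul δ).add ((tf'.add tg').const_mul (1 / δ))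
    simp only [add_zero, mul_zero] at t
    refine le_of_tendsto_of_tendsto' tS t fun n => ?_
    have hDf := hf.continuousOn_groundDeriv hw
    have hDg := hg.continuousOn_groundDeriv hw
    have hfc := hf.continuousOn
    have hgc := hg.continuousOn
    have hχ := continuousOn_cutoff n
    have hχ' := continuousOn_cutoffDeriv n
    have hpos := Real.exp_pos (-(2 * ((n : ℝ) + 1)))
    have hle := exp_neg_le_exp_pos n
    have hne2 : ∀ r ∈ Ioi (0 : ℝ), 2 * r ^ 2 ≠ 0 :=
      fun r hr => mul_ne_zero two_ne_zero (pow_pos hr 2).ne'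
    have i1 := intervalIntegrable_of_continuousOn_Ioi (h := fun r =>
      2 * r * cutoff n r * cutoffDeriv n r * (groundDeriv w f r * g r - f r * groundDeriv w g r))
      (by fun_prop) hpos hle
    have i2 := intervalIntegrable_cutoff_mul iS n hpos hle
    have hl := localized_lagrange_identity hf hg n
    rw [intervalIntegral.integral_sub i1 (i2.const_mul 2),
      intervalIntegral.integral_const_mul] at hl
    have bf := localized_energy_bound hw hf n
    have bg := localized_energy_bound hw hg n
    have j1 := intervalIntegrable_of_continuousOn_Ioi (h := fun r => cutoff n r ^ 2 *
      (r * (1 / 4 * groundDeriv w f r ^ 2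
        + ((k : ℝ) ^ 2 - (m : ℝ) ^ 2) / (2 * r ^ 2) * f r ^ 2)))
      (by fun_prop (disch := assumption)) hpos hle
    have j2 := intervalIntegrable_of_continuousOn_Ioi (h := fun r => cutoff n r ^ 2 *
      (r * (1 / 4 * groundDeriv w g r ^ 2
        + ((k : ℝ) ^ 2 - (m : ℝ) ^ 2) / (2 * r ^ 2) * g r ^ 2)))
      (by fun_prop (disch := assumption)) hpos hle
    have j3 := intervalIntegrable_of_continuousOn_Ioi
      (h := fun r => r * cutoffDeriv n r ^ 2 * f r ^ 2) (by fun_prop) hpos hle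
    have j4 := intervalIntegrable_of_continuousOn_Ioi
      (h := fun r => r * cutoffDeriv n r ^ 2 * g r ^ 2) (by fun_prop) hpos hle
    have habs : |truncInt n (fun r => 1 / 2 * (2 * r * cutoff n r * cutoffDeriv n r
          * (groundDeriv w f r * g r - f r * groundDeriv w g r)))| ≤
        truncInt n (fun r => δ * (cutoff n r ^ 2 * (r * (1 / 4 * groundDeriv w f r ^ 2
        + ((k : ℝ) ^ 2 - (m : ℝ) ^ 2) / (2 * r ^ 2) * f r ^ 2))
          + cutoff n r ^ 2 * (r * (1 / 4 * groundDeriv w g r ^ 2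
        + ((k : ℝ) ^ 2 - (m : ℝ) ^ 2) / (2 * r ^ 2) * g r ^ 2)))
        + 1 / δ * (r * cutoffDeriv n r ^ 2 * f r ^ 2 + r * cutoffDeriv n r ^ 2 * g r ^ 2)) := by
      refine (intervalIntegral.abs_integral_le_integral_abs hle).trans ?_
      refine truncInt_mono (i1.const_mul _).abs (((j1.add j2).const_mul δ).add
        ((j3.add j4).const_mul (1 / δ))) fun r hr => ?_
      have hκ : 0 ≤ ((k : ℝ) ^ 2 - (m : ℝ) ^ 2) / (2 * r ^ 2) := by
        have := sub_nonneg.2 hk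
        positivity
      set κ := ((k : ℝ) ^ 2 - (m : ℝ) ^ 2) / (2 * r ^ 2) with hκd
      set c := cutoff n r
      set c' := cutoffDeriv n r
      set Df := groundDeriv w f r
      set Dg := groundDeriv w g r
      set x := f r
      set y := g r
      have hδ1 : 1 / δ * δ = 1 := by field_simp
      have hδ0 : 0 < 1 / δ := by positivity
      -- Young's inequality, read off from the square (δp/2 - s q)²/δ ≥ 0 with s = ±1. The weight ¼
      -- matches the coefficient of D² in the localized energy bound.
      have A : ∀ p q : ℝ, |p * q| ≤ δ * (1 / 4 * p ^ 2) + 1 / δ * q ^ 2 := by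
        intro p q
        have e1 : ∀ s : ℝ, s ^ 2 = 1 → s * (p * q) ≤ δ * (1 / 4 * p ^ 2) + 1 / δ * q ^ 2 := by
          intro s hs
          have h0 : 0 ≤ 1 / δ * (δ * p / 2 - s * q) ^ 2 := by positivity
          have h1 : 1 / δ * (δ * p / 2 - s * q) ^ 2
              = δ * (1 / 4 * p ^ 2) - s * (p * q) + 1 / δ * q ^ 2 := by
            rw [show (1 / δ) * (δ * p / 2 - s * q) ^ 2 = (1 / δ * δ) * δ * (1 / 4 * p ^ 2)
              - (1 / δ * δ) * s * (p * q) + 1 / δ * (s ^ 2 * q ^ 2) by ring, hδ1, hs]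
            ring
          linarith
        refine abs_le.2 ⟨?_, ?_⟩
        · have := e1 (-1) (by norm_num); linarith
        · have := e1 1 (by norm_num); linarith
      have h1 := A (c * Df) (c' * y)
      have h2 := A (c * Dg) (c' * x)
      have h3 : |1 / 2 * (2 * r * c * c' * (Df * y - x * Dg))|
          ≤ r * (|c * Df * (c' * y)| + |c * Dg * (c' * x)|) := by
        rw [show 1 / 2 * (2 * r * c * c' * (Df * y - x * Dg))
          = r * (c * Df * (c' * y) - c * Dg * (c' * x)) by ring, abs_mul, abs_of_pos hr]
        exact mul_le_mul_of_nonneg_left (abs_sub _ _) hr.le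
      refine h3.trans ?_
      have h4 := mul_le_mul_of_nonneg_left (add_le_add h1 h2) hr.le
      have h5 : 0 ≤ δ * (c ^ 2 * (r * (κ * x ^ 2))) := by positivity
      have h6 : 0 ≤ δ * (c ^ 2 * (r * (κ * y ^ 2))) := by positivity
      linarith
    unfold truncInt at habs bf bg
    rw [intervalIntegral.integral_add ((j1.add j2).const_mul δ) ((j3.add j4).const_mul (1 / δ)),
      intervalIntegral.integral_const_mul, intervalIntegral.integral_const_mul,
      intervalIntegral.integral_const_mul, intervalIntegral.integral_add j1 j2,
      intervalIntegral.integral_add j3 j4] at habs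
    rw [show (∫ r in (Real.exp (-(2 * ((n : ℝ) + 1))))..(Real.exp (2 * ((n : ℝ) + 1))),
      cutoff n r ^ 2 * (r * (realHam μ w k f r * g r) - r * (realHam μ w k g r * f r)))
      = 1 / 2 * ∫ r in (Real.exp (-(2 * ((n : ℝ) + 1))))..(Real.exp (2 * ((n : ℝ) + 1))),
        2 * r * cutoff n r * cutoffDeriv n r * (groundDeriv w f r * g r - f r * groundDeriv w g r)
      by linarith]
    refine habs.trans ?_
    gcongr
  have hlim : Tendsto (fun δ : ℝ => δ * E) (𝓝[>] 0) (𝓝 0) := by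
    have : Tendsto (fun δ : ℝ => δ * E) (𝓝 0) (𝓝 (0 * E)) := (continuous_mul_const E).tendsto 0
    rw [zero_mul] at this
    exact this.mono_left nhdsWithin_le_nhds
  have := ge_of_tendsto hlim (by
    filter_upwards [self_mem_nhdsWithin] with δ hδ using key δ hδ)
  exact abs_eq_zero.1 (le_antisymm this (abs_nonneg _))

end RealCore

end GPVortex

namespace GPVortex

/-! ### Non-negativity of the scalar energy and its null functions -/

section RealKernel

variable {m : ℕ} {μ : ℝ} {w : ℝ → ℝ} {k : ℤ} {f : ℝ → ℝ}

lemma InRealDomain.energy_nonneg (hw : IsVortexProfile m μ w) (hf : InRealDomain μ w k f)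
    (hk : (m : ℝ) ^ 2 ≤ (k : ℝ) ^ 2) : 0 ≤ ∫ r in Ioi 0, r * (realHam μ w k f r * f r) := by
  -- On the degenerate interval [1, 1] the lower bound is 0.
  simpa using hf.energy_bound hw hk one_pos le_rfl

/-- The energy dominates the integral of a continuous non-negative density over every compact
interval; if the density were positive at one point, the energy would be positive. -/
lemma InRealDomain.density_eq_zero (hw : IsVortexProfile m μ w) (hf : InRealDomain μ w k f)
    (hk : (m : ℝ) ^ 2 ≤ (k : ℝ) ^ 2) (hE : ∫ r in Ioi 0, r * (realHam μ w k f r * f r) ≤ 0)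
    {r : ℝ} (hr : 0 < r) :
    groundDeriv w f r = 0 ∧ (((k : ℝ) ^ 2 - (m : ℝ) ^ 2) * f r ^ 2 = 0) := by
  have hD := hf.continuousOn_groundDeriv hw
  have hfc := hf.continuousOn
  have hne2 : ∀ r ∈ Ioi (0 : ℝ), 2 * r ^ 2 ≠ 0 :=
    fun r hr => mul_ne_zero two_ne_zero (pow_pos hr 2).ne'
  have hk' := sub_nonneg.2 hk
  have hcont : ContinuousOn (fun r => r * (1 / 4 * groundDeriv w f r ^ 2
        + ((k : ℝ) ^ 2 - (m : ℝ) ^ 2) / (2 * r ^ 2) * f r ^ 2)) (Ioi 0) := by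
    fun_prop (disch := assumption)
  have key : r * (1 / 4 * groundDeriv w f r ^ 2
        + ((k : ℝ) ^ 2 - (m : ℝ) ^ 2) / (2 * r ^ 2) * f r ^ 2) ≤ 0 := by
    by_contra! hpos
    have hI := hf.energy_bound hw hk hr (show r ≤ r + 1 by linarith)
    refine absurd (hI.trans hE) (not_le.2 ?_)
    refine intervalIntegral.integral_pos (by linarith)
      (hcont.mono (Icc_subset_Ioi_zero hr)) (fun x hx => ?_) ⟨r, ⟨le_rfl, by linarith⟩, hpos⟩
    have : 0 < x := hr.trans hx.1
    positivity
  have h1 : 0 ≤ 1 / 4 * groundDeriv w f r ^ 2 := by positivity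
  have h2 : 0 ≤ ((k : ℝ) ^ 2 - (m : ℝ) ^ 2) / (2 * r ^ 2) * f r ^ 2 := by positivity
  have h3 := (mul_nonpos_iff_pos_imp_nonpos.1 key).1 hr
  have h4 : 1 / 4 * groundDeriv w f r ^ 2 = 0 := by linarith
  have h5 : ((k : ℝ) ^ 2 - (m : ℝ) ^ 2) / (2 * r ^ 2) * f r ^ 2 = 0 := by linarith
  refine ⟨by simpa using h4, ?_⟩
  rw [div_mul_eq_mul_div, div_eq_zero_iff] at h5
  exact h5.resolve_right (hne2 r hr)

/-- Functions of vanishing energy are multiples of the profile. -/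
lemma InRealDomain.exists_eq_mul (hw : IsVortexProfile m μ w) (hf : InRealDomain μ w k f)
    (hk : (m : ℝ) ^ 2 ≤ (k : ℝ) ^ 2) (hE : ∫ r in Ioi 0, r * (realHam μ w k f r * f r) ≤ 0) :
    ∃ α : ℝ, ∀ r, 0 < r → f r = α * w r := by
  -- The derivative of f / w is D / w, and D vanishes identically.
  have hd : ∀ r, 0 < r → HasDerivAt (fun r => f r / w r) 0 r := by
    intro r hr
    have hp := (hw.pos hr).ne'
    refine ((hf.hasDerivAt hr).div (hw.hasDerivAt hr) hp).congr_deriv ?_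
    have h := (hf.density_eq_zero hw hk hE hr).1
    unfold groundDeriv logD at h
    field_simp at h ⊢
    linear_combination h
  obtain ⟨α, hα⟩ := isOpen_Ioi.exists_is_const_of_deriv_eq_zero (isPreconnected_Ioi (a := (0 : ℝ)))
    (fun r hr => (hd r hr).differentiableAt.differentiableWithinAt) fun r hr => (hd r hr).deriv
  exact ⟨α, fun r hr => (div_eq_iff (hw.pos hr).ne').1 (hα r hr)⟩

lemma InRealDomain.eq_zero (hw : IsVortexProfile m μ w) (hf : InRealDomain μ w k f)
    (hk : (m : ℝ) ^ 2 < (k : ℝ) ^ 2) (hE : ∫ r in Ioi 0, r * (realHam μ w k f r * f r) ≤ 0)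
    {r : ℝ} (hr : 0 < r) : f r = 0 := by
  have h := (hf.density_eq_zero hw hk.le hE hr).2
  have := (mul_eq_zero.1 h).resolve_left (sub_pos.2 hk).ne'
  exact pow_eq_zero_iff two_ne_zero |>.1 this

end RealKernel

/-! ### Coercivity, complex case -/

/-- Serves to pass absolute continuity from a complex function to its real and imaginary parts. -/
lemma _root_.AbsolutelyContinuousOnInterval.of_dist_le {X Y : Type*} [PseudoMetricSpace X]
    [PseudoMetricSpace Y] {f : ℝ → X} {g : ℝ → Y} {a b : ℝ}
    (hf : AbsolutelyContinuousOnInterval f a b)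
    (h : ∀ x ∈ uIcc a b, ∀ y ∈ uIcc a b, dist (g x) (g y) ≤ dist (f x) (f y)) :
    AbsolutelyContinuousOnInterval g a b := by
  rw [absolutelyContinuousOnInterval_iff] at hf ⊢
  intro ε hε
  obtain ⟨δ, hδ, H⟩ := hf ε hε
  refine ⟨δ, hδ, fun E hE hs => (Finset.sum_le_sum fun i hi => ?_).trans_lt (H E hE hs)⟩
  exact h _ (hE.1 i hi).1 _ (hE.1 i hi).2

/-- The operator `-½ Δ_r + k²/(2r²) + ½ r² - μ + w²` on complex functions. -/
noncomputable def radialHam (μ : ℝ) (w : ℝ → ℝ) (k : ℤ) (f : ℝ → ℂ) (r : ℝ) : ℂ :=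
  radialExpr μ k f r + ((w r ^ 2 : ℝ) : ℂ) * f r

section Complex

variable {m : ℕ} {μ : ℝ} {w : ℝ → ℝ} {k : ℤ} {f : ℝ → ℂ}

lemma IsRadialSobolev.hasDerivAt (hf : IsRadialSobolev f) {r : ℝ} (hr : 0 < r) :
    HasDerivAt f (deriv f r) r :=
  (hf.differentiableOn.differentiableAt (Ioi_mem_nhds hr)).hasDerivAt

lemma IsRadialSobolev.deriv_clm (hf : IsRadialSobolev f) (l : ℂ →L[ℝ] ℝ) {r : ℝ} (hr : 0 < r) :
    deriv (fun r => l (f r)) r = l (deriv f r) :=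
  (l.hasFDerivAt.comp_hasDerivAt r (hf.hasDerivAt hr)).deriv

lemma IsRadialSobolev.absolutelyContinuous_clm (hf : IsRadialSobolev f) (l : ℂ →L[ℝ] ℝ)
    (hl : ∀ z, |l z| ≤ ‖z‖) (a b : ℝ) (ha : 0 < a) (hab : a ≤ b) :
    AbsolutelyContinuousOnInterval (deriv fun r => l (f r)) a b := by
  refine (hf.absolutelyContinuous a b ha hab).of_dist_le fun x hx y hy => ?_
  rw [uIcc_of_le hab] at hx hy
  rw [hf.deriv_clm l (ha.trans_le hx.1), hf.deriv_clm l (ha.trans_le hy.1), dist_eq_norm,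
    dist_eq_norm, ← map_sub]
  exact hl _

lemma clm_ofReal_mul (l : ℂ →L[ℝ] ℝ) (a : ℝ) (z : ℂ) : l ((a : ℂ) * z) = a * l z := by
  rw [← Complex.real_smul, map_smul, smul_eq_mul]

lemma realHam_clm (l : ℂ →L[ℝ] ℝ) {r : ℝ} (h1 : deriv (fun r => l (f r)) r = l (deriv f r))
    (h2 : deriv (deriv fun r => l (f r)) r = l (deriv (deriv f) r)) :
    realHam μ w k (fun r => l (f r)) r = l (radialHam μ w k f r) := by
  have e : radialHam μ w k f r = ((-(1 / 2) : ℝ) : ℂ) * (deriv (deriv f) r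
      + ((1 / r : ℝ) : ℂ) * deriv f r)
    + (((k : ℝ) ^ 2 / (2 * r ^ 2) + r ^ 2 / 2 - μ + w r ^ 2 : ℝ) : ℂ) * f r := by
    unfold radialHam radialExpr
    push_cast
    ring
  rw [e, map_add, clm_ofReal_mul, clm_ofReal_mul, map_add, clm_ofReal_mul, realHam, h1, h2]

/-- The real and imaginary parts of f' are absolutely continuous real functions, hence
differentiable almost everywhere on each interval of an exhaustion. -/
lemma ae_differentiableAt_deriv (hf : IsRadialSobolev f) :
    ∀ᵐ r, 0 < r → HasDerivAt (deriv f) (deriv (deriv f) r) r := by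
  have h : ∀ n : ℕ, ∀ᵐ r, r ∈ uIcc (1 / ((n : ℝ) + 1)) ((n : ℝ) + 1) →
      DifferentiableAt ℝ (deriv f) r := by
    intro n
    have hn : (0 : ℝ) ≤ n := n.cast_nonneg
    have hac := hf.absolutelyContinuous (1 / ((n : ℝ) + 1)) ((n : ℝ) + 1) (by positivity)
      (by rw [div_le_iff₀ (by positivity)]; nlinarith)
    have hre : AbsolutelyContinuousOnInterval (fun r => (deriv f r).re) (1 / ((n : ℝ) + 1))
        ((n : ℝ) + 1) := hac.of_dist_le fun x _ y _ => by
      rw [Real.dist_eq, dist_eq_norm, ← Complex.sub_re]; exact Complex.abs_re_le_norm _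
    have him : AbsolutelyContinuousOnInterval (fun r => (deriv f r).im) (1 / ((n : ℝ) + 1))
        ((n : ℝ) + 1) := hac.of_dist_le fun x _ y _ => by
      rw [Real.dist_eq, dist_eq_norm, ← Complex.sub_im]; exact Complex.abs_im_le_norm _
    filter_upwards [hre.ae_differentiableAt, him.ae_differentiableAt] with r h1 h2 hr
    have e : deriv f = fun r => ((deriv f r).re : ℂ) + ((deriv f r).im : ℂ) * Complex.I := by
      ext r; simp
    rw [e]
    exact (h1 hr).hasDerivAt.ofReal_comp.differentiableAt.add
      ((h2 hr).hasDerivAt.ofReal_comp.differentiableAt.mul_const _)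
  filter_upwards [ae_all_iff.2 h] with r hr h0
  obtain ⟨n, hn⟩ := exists_nat_ge (max r (1 / r))
  have h1 : r ≤ n := (le_max_left _ _).trans hn
  have h2 : 1 / r ≤ n := (le_max_right _ _).trans hn
  have hn0 : (0 : ℝ) < n + 1 := by positivity
  refine (hr n (mem_uIcc_of_le ?_ (by linarith))).hasDerivAt
  rw [div_le_iff₀ hn0]
  rw [div_le_iff₀ h0] at h2
  nlinarith

lemma IsRadialSobolev.ae_realHam_clm (hf : IsRadialSobolev f) (l : ℂ →L[ℝ] ℝ) :
    ∀ᵐ r ∂radialMeasure, realHam μ w k (fun r => l (f r)) r = l (radialHam μ w k f r) := by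
  rw [ae_radialMeasure_iff]
  filter_upwards [ae_differentiableAt_deriv hf] with r hr h0
  refine realHam_clm l (hf.deriv_clm l h0) ?_
  have e : (deriv fun r => l (f r)) =ᶠ[𝓝 r] fun r => l (deriv f r) := by
    filter_upwards [Ioi_mem_nhds h0] with x hx using hf.deriv_clm l hx
  rw [e.deriv_eq]
  exact (l.hasFDerivAt.comp_hasDerivAt r (hr h0)).deriv

/-- T_k has real coefficients and so commutes almost everywhere with real-linear functionals.
Applied to the real and imaginary parts, this reduces the complex case to the real one. -/
lemma IsRadialSobolev.inRealDomain (hf : IsRadialSobolev f)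
    (hH : MemLp (radialHam μ w k f) 2 radialMeasure) (l : ℂ →L[ℝ] ℝ) (hl : ∀ z, |l z| ≤ ‖z‖) :
    InRealDomain μ w k fun r => l (f r) where
  differentiableOn := l.differentiable.comp_differentiableOn hf.differentiableOn
  absolutelyContinuous := hf.absolutelyContinuous_clm l hl
  bounded_zero := by
    obtain ⟨a, ha⟩ := hf.limit_zero
    refine ⟨‖a‖ + 1, ?_⟩
    filter_upwards [ha.norm.eventually (gt_mem_nhds (lt_add_one ‖a‖))] with r hr
    exact (hl _).trans hr.le
  memLp := l.comp_memLp' hf.memLp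
  memLp_ham := (l.comp_memLp' hH).ae_eq ((hf.ae_realHam_clm l).mono fun _ h => h.symm)

/-- The energy `(T f, f)` of a complex function. -/
noncomputable def scalarEnergy (μ : ℝ) (w : ℝ → ℝ) (k : ℤ) (f : ℝ → ℂ) : ℂ :=
  ∫ r, radialHam μ w k f r * (starRingEnd ℂ) (f r) ∂radialMeasure

lemma integrable_mul_conj {f g : ℝ → ℂ} (hf : MemLp f 2 radialMeasure)
    (hg : MemLp g 2 radialMeasure) :
    Integrable (fun r => f r * (starRingEnd ℂ) (g r)) radialMeasure :=
  hf.integrable_mul hg.star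

/-- As T_k is real, the products of real with imaginary parts contribute only to the imaginary part
of (T_k f) f̄. -/
lemma scalarEnergy_re (hf : IsRadialSobolev f) (hH : MemLp (radialHam μ w k f) 2 radialMeasure) :
    (scalarEnergy μ w k f).re =
      (∫ r in Ioi 0, r * (realHam μ w k (fun r => (f r).re) r * (f r).re))
      + ∫ r in Ioi 0, r * (realHam μ w k (fun r => (f r).im) r * (f r).im) := by
  have h1 := hf.inRealDomain hH Complex.reCLM Complex.abs_re_le_norm
  have h2 := hf.inRealDomain hH Complex.imCLM Complex.abs_im_le_norm
  have i1 := h1.memLp_ham.integrable_mul h1.memLp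
  have i2 := h2.memLp_ham.integrable_mul h2.memLp
  have e1 := integral_radialMeasure fun r => realHam μ w k (fun r => (f r).re) r * (f r).re
  have e2 := integral_radialMeasure fun r => realHam μ w k (fun r => (f r).im) r * (f r).im
  simp only [smul_eq_mul] at e1 e2
  rw [← e1, ← e2]
  have e3 := integral_add i1 i2
  simp only [Pi.mul_apply, Complex.reCLM_apply, Complex.imCLM_apply] at e3
  rw [← e3, scalarEnergy]
  have e4 := integral_re (integrable_mul_conj hH hf.memLp)
  refine e4.symm.trans (integral_congr_ae ?_)
  filter_upwards [hf.ae_realHam_clm (μ := μ) (w := w) (k := k) Complex.reCLM,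
    hf.ae_realHam_clm (μ := μ) (w := w) (k := k) Complex.imCLM] with r a1 a2
  simp only [Complex.reCLM_apply, Complex.imCLM_apply] at a1 a2
  rw [a1, a2]
  simp

/-- The imaginary part of the density is (T Im f) Re f - (T Re f) Im f, whose integral vanishes by
the symmetry of T_k. -/
lemma scalarEnergy_im (hw : IsVortexProfile m μ w) (hf : IsRadialSobolev f)
    (hH : MemLp (radialHam μ w k f) 2 radialMeasure) (hk : (m : ℝ) ^ 2 ≤ (k : ℝ) ^ 2) :
    (scalarEnergy μ w k f).im = 0 := by
  have h1 := hf.inRealDomain hH Complex.reCLM Complex.abs_re_le_norm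
  have h2 := hf.inRealDomain hH Complex.imCLM Complex.abs_im_le_norm
  rw [← h2.symm hw h1 hk, scalarEnergy]
  have e4 := integral_im (integrable_mul_conj hH hf.memLp)
  refine e4.symm.trans ?_
  rw [integral_radialMeasure]
  have ae1 := ae_radialMeasure_iff.1 (hf.ae_realHam_clm (μ := μ) (w := w) (k := k) Complex.reCLM)
  have ae2 := ae_radialMeasure_iff.1 (hf.ae_realHam_clm (μ := μ) (w := w) (k := k) Complex.imCLM)
  refine setIntegral_congr_ae measurableSet_Ioi ?_
  filter_upwards [ae1, ae2] with r a1 a2 hr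
  have a1 := a1 hr
  have a2 := a2 hr
  simp only [Complex.reCLM_apply, Complex.imCLM_apply] at a1 a2 ⊢
  rw [a1, a2]
  simp only [RCLike.im_to_complex, Complex.mul_im, Complex.conj_re, Complex.conj_im, smul_eq_mul]
  ring

lemma scalarEnergy_re_nonneg (hw : IsVortexProfile m μ w) (hf : IsRadialSobolev f)
    (hH : MemLp (radialHam μ w k f) 2 radialMeasure) (hk : (m : ℝ) ^ 2 ≤ (k : ℝ) ^ 2) :
    0 ≤ (scalarEnergy μ w k f).re := by
  rw [scalarEnergy_re hf hH]
  exact add_nonneg ((hf.inRealDomain hH Complex.reCLM Complex.abs_re_le_norm).energy_nonneg hw hk)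
    ((hf.inRealDomain hH Complex.imCLM Complex.abs_im_le_norm).energy_nonneg hw hk)

lemma exists_eq_mul_of_scalarEnergy_le (hw : IsVortexProfile m μ w) (hf : IsRadialSobolev f)
    (hH : MemLp (radialHam μ w k f) 2 radialMeasure) (hk : (m : ℝ) ^ 2 ≤ (k : ℝ) ^ 2)
    (hE : (scalarEnergy μ w k f).re ≤ 0) : ∃ α : ℂ, ∀ r, 0 < r → f r = α * (w r : ℂ) := by
  rw [scalarEnergy_re hf hH] at hE
  have h1 := hf.inRealDomain hH Complex.reCLM Complex.abs_re_le_norm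
  have h2 := hf.inRealDomain hH Complex.imCLM Complex.abs_im_le_norm
  have n1 := h1.energy_nonneg hw hk
  have n2 := h2.energy_nonneg hw hk
  simp only [Complex.reCLM_apply, Complex.imCLM_apply] at n1 n2
  obtain ⟨a, ha⟩ := h1.exists_eq_mul hw hk (by simp only [Complex.reCLM_apply]; linarith)
  obtain ⟨b, hb⟩ := h2.exists_eq_mul hw hk (by simp only [Complex.imCLM_apply]; linarith)
  refine ⟨⟨a, b⟩, fun r hr => ?_⟩
  have := ha r hr
  have := hb r hr
  apply Complex.ext <;> simpa

lemma eq_zero_of_scalarEnergy_le (hw : IsVortexProfile m μ w) (hf : IsRadialSobolev f)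
    (hH : MemLp (radialHam μ w k f) 2 radialMeasure) (hk : (m : ℝ) ^ 2 < (k : ℝ) ^ 2)
    (hE : (scalarEnergy μ w k f).re ≤ 0) {r : ℝ} (hr : 0 < r) : f r = 0 := by
  rw [scalarEnergy_re hf hH] at hE
  have h1 := hf.inRealDomain hH Complex.reCLM Complex.abs_re_le_norm
  have h2 := hf.inRealDomain hH Complex.imCLM Complex.abs_im_le_norm
  have n1 := h1.energy_nonneg hw hk.le
  have n2 := h2.energy_nonneg hw hk.le
  simp only [Complex.reCLM_apply, Complex.imCLM_apply] at n1 n2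
  have ha := h1.eq_zero hw hk (by simp only [Complex.reCLM_apply]; linarith) hr
  have hb := h2.eq_zero hw hk (by simp only [Complex.imCLM_apply]; linarith) hr
  apply Complex.ext <;> simpa

end Complex

/-! ### The energy form of `L_j` -/

section EnergyForm

variable {m : ℕ} {μ : ℝ} {w : ℝ → ℝ} {j : ℤ} {yp ym : ℝ → ℂ}

/-- Of the diagonal term 2w², one copy completes T_{j+m}, for which w plays the role of ground
state; the other joins the off-diagonal term in a non-negative coupling that depends only on y₊ +
y₋. -/
lemma LjPlus_eq (r : ℝ) : LjPlus m μ w j yp ym r =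
    radialHam μ w (j + m) yp r + ((w r ^ 2 : ℝ) : ℂ) * (yp r + ym r) := by
  unfold LjPlus radialHam
  rw [sq_abs]; ring

lemma LjMinus_eq (r : ℝ) : LjMinus m μ w j yp ym r =
    radialHam μ w (j - m) ym r + ((w r ^ 2 : ℝ) : ℂ) * (yp r + ym r) := by
  unfold LjMinus radialHam
  rw [sq_abs]; ring

lemma IsVortexProfile.memLp_sq_mul (hw : IsVortexProfile m μ w) {f : ℝ → ℂ}
    (hf : MemLp f 2 radialMeasure) :
    MemLp (fun r => ((w r ^ 2 : ℝ) : ℂ) * f r) 2 radialMeasure := by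
  obtain ⟨C, _, hC⟩ := hw.exists_bound
  refine memLp_two_bdd_mul hf (C := C ^ 2)
    (Complex.continuous_ofReal.comp_continuousOn (hw.continuousOn.pow 2)) fun r hr => ?_
  rw [Complex.norm_real, Real.norm_eq_abs, abs_pow]
  exact pow_le_pow_left₀ (abs_nonneg _) (hC r hr) 2

/-- Since w is bounded, the coupling term is square integrable and can be removed: the two
components decouple at the level of domains. -/
lemma InDomainLj.memLp_ham_plus (hw : IsVortexProfile m μ w) (h : InDomainLj m μ w j yp ym) :
    MemLp (radialHam μ w (j + m) yp) 2 radialMeasure := by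
  have := h.memLp_plus.sub (hw.memLp_sq_mul (h.sobolev_plus.memLp.add h.sobolev_minus.memLp))
  refine this.ae_eq (ae_of_all _ fun r => ?_)
  rw [Pi.sub_apply, Pi.add_apply, LjPlus_eq]; ring

lemma InDomainLj.memLp_ham_minus (hw : IsVortexProfile m μ w) (h : InDomainLj m μ w j yp ym) :
    MemLp (radialHam μ w (j - m) ym) 2 radialMeasure := by
  have := h.memLp_minus.sub (hw.memLp_sq_mul (h.sobolev_plus.memLp.add h.sobolev_minus.memLp))
  refine this.ae_eq (ae_of_all _ fun r => ?_)
  rw [Pi.sub_apply, Pi.add_apply, LjMinus_eq]; ring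

lemma InDomainLj.integrable_coupling (hw : IsVortexProfile m μ w)
    (h : InDomainLj m μ w j yp ym) :
    Integrable (fun r => w r ^ 2 * ‖yp r + ym r‖ ^ 2) radialMeasure := by
  have hs := h.sobolev_plus.memLp.add h.sobolev_minus.memLp
  refine (integrable_mul_conj (hw.memLp_sq_mul hs) hs).re.congr (ae_of_all _ fun r => ?_)
  simp only [Pi.add_apply, RCLike.re_to_complex]
  rw [mul_assoc, Complex.mul_conj, ← Complex.ofReal_mul, Complex.ofReal_re,
    Complex.normSq_eq_norm_sq]

/-- `(L_j y, y) = (T₊ y₊, y₊) + (T₋ y₋, y₋) + ∫ w² |y₊ + y₋|² r dr`. -/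
lemma InDomainLj.energy_eq (hw : IsVortexProfile m μ w) (h : InDomainLj m μ w j yp ym) :
    energy m μ w j yp ym = scalarEnergy μ w (j + m) yp + scalarEnergy μ w (j - m) ym
      + ((∫ r, w r ^ 2 * ‖yp r + ym r‖ ^ 2 ∂radialMeasure : ℝ) : ℂ) := by
  have i1 := integrable_mul_conj (h.memLp_ham_plus hw) h.sobolev_plus.memLp
  have i2 := integrable_mul_conj (h.memLp_ham_minus hw) h.sobolev_minus.memLp
  have i3 := (h.integrable_coupling hw).ofReal (𝕜 := ℂ)
  have e1 : ((∫ r, w r ^ 2 * ‖yp r + ym r‖ ^ 2 ∂radialMeasure : ℝ) : ℂ)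
      = ∫ r, ((w r ^ 2 * ‖yp r + ym r‖ ^ 2 : ℝ) : ℂ) ∂radialMeasure := integral_ofReal.symm
  rw [e1, scalarEnergy, scalarEnergy, ← integral_add i1 i2]
  refine Eq.trans (integral_congr_ae (ae_of_all _ fun r => ?_)) (integral_add (i1.add i2) i3)
  beta_reduce
  rw [LjPlus_eq, LjMinus_eq]
  have e2 : ((w r ^ 2 * ‖yp r + ym r‖ ^ 2 : ℝ) : ℂ)
      = ((w r ^ 2 : ℝ) : ℂ) * ((yp r + ym r) * (starRingEnd ℂ) (yp r + ym r)) := by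
    rw [Complex.mul_conj, Complex.normSq_eq_norm_sq]; push_cast; ring
  refine Eq.trans ?_ (congrArg _ e2.symm)
  rw [map_add]; ring

/-- The origin of the threshold 2m: it is where |j ± m| ≥ m holds for both signs, with j = 0 as the
borderline case of equality. -/
lemma sq_le_sq_of_abs_two_mul_le (hj : j = 0 ∨ 2 * (m : ℤ) ≤ |j|) :
    (m : ℝ) ^ 2 ≤ ((j + m : ℤ) : ℝ) ^ 2 ∧ (m : ℝ) ^ 2 ≤ ((j - m : ℤ) : ℝ) ^ 2 := by
  have h0 : (0 : ℤ) ≤ m := by positivity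
  have key : (m : ℤ) ^ 2 ≤ (j + m) ^ 2 ∧ (m : ℤ) ^ 2 ≤ (j - m) ^ 2 := by
    rcases hj with rfl | hj
    · constructor <;> apply le_of_eq <;> ring
    · rcases le_abs'.1 hj with h | h <;> constructor <;> nlinarith
  exact ⟨by exact_mod_cast key.1, by exact_mod_cast key.2⟩

/-- The sign that increases the modulus gives |j ± m| ≥ 3m, which exceeds m because m ≥ 1. -/
lemma sq_lt_sq_of_two_mul_le_abs (hm : 1 ≤ m) (hj : 2 * (m : ℤ) ≤ |j|) :
    (m : ℝ) ^ 2 < ((j + m : ℤ) : ℝ) ^ 2 ∨ (m : ℝ) ^ 2 < ((j - m : ℤ) : ℝ) ^ 2 := by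
  have h0 : (1 : ℤ) ≤ m := by exact_mod_cast hm
  rcases le_abs'.1 hj with h | h
  · right
    have : (m : ℤ) ^ 2 < (j - m) ^ 2 := by nlinarith
    exact_mod_cast this
  · left
    have : (m : ℤ) ^ 2 < (j + m) ^ 2 := by nlinarith
    exact_mod_cast this

lemma InDomainLj.energy_im (hw : IsVortexProfile m μ w) (h : InDomainLj m μ w j yp ym)
    (hj : j = 0 ∨ 2 * (m : ℤ) ≤ |j|) : (energy m μ w j yp ym).im = 0 := by
  have hk := sq_le_sq_of_abs_two_mul_le hj
  rw [h.energy_eq hw, Complex.add_im, Complex.add_im, Complex.ofReal_im,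
    scalarEnergy_im hw h.sobolev_plus (h.memLp_ham_plus hw) hk.1,
    scalarEnergy_im hw h.sobolev_minus (h.memLp_ham_minus hw) hk.2]
  ring

lemma coupling_nonneg : 0 ≤ ∫ r, w r ^ 2 * ‖yp r + ym r‖ ^ 2 ∂radialMeasure :=
  integral_nonneg fun r => by positivity

lemma InDomainLj.energy_nonneg (hw : IsVortexProfile m μ w) (h : InDomainLj m μ w j yp ym)
    (hj : j = 0 ∨ 2 * (m : ℤ) ≤ |j|) : 0 ≤ (energy m μ w j yp ym).re := by
  have hk := sq_le_sq_of_abs_two_mul_le hj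
  rw [h.energy_eq hw, Complex.add_re, Complex.add_re, Complex.ofReal_re]
  exact add_nonneg (add_nonneg
    (scalarEnergy_re_nonneg hw h.sobolev_plus (h.memLp_ham_plus hw) hk.1)
    (scalarEnergy_re_nonneg hw h.sobolev_minus (h.memLp_ham_minus hw) hk.2)) coupling_nonneg

/-- Null vectors of the energy form are `α (w, -w)`. -/
lemma InDomainLj.exists_eq_mul (hw : IsVortexProfile m μ w) (h : InDomainLj m μ w j yp ym)
    (hj : j = 0 ∨ 2 * (m : ℤ) ≤ |j|) (hE : (energy m μ w j yp ym).re ≤ 0) :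
    (scalarEnergy μ w (j + m) yp).re ≤ 0 ∧ (scalarEnergy μ w (j - m) ym).re ≤ 0 ∧
      ∃ α : ℂ, ∀ r, 0 < r → yp r = α * (w r : ℂ) ∧ ym r = -(α * (w r : ℂ)) := by
  have hk := sq_le_sq_of_abs_two_mul_le hj
  have n1 := scalarEnergy_re_nonneg hw h.sobolev_plus (h.memLp_ham_plus hw) hk.1
  have n2 := scalarEnergy_re_nonneg hw h.sobolev_minus (h.memLp_ham_minus hw) hk.2
  have n3 := coupling_nonneg (w := w) (yp := yp) (ym := ym)
  rw [h.energy_eq hw, Complex.add_re, Complex.add_re, Complex.ofReal_re] at hE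
  have h1 : (scalarEnergy μ w (j + m) yp).re ≤ 0 := by linarith
  have h2 : (scalarEnergy μ w (j - m) ym).re ≤ 0 := by linarith
  obtain ⟨α, hα⟩ := exists_eq_mul_of_scalarEnergy_le hw h.sobolev_plus (h.memLp_ham_plus hw) hk.1 h1
  obtain ⟨β, hβ⟩ := exists_eq_mul_of_scalarEnergy_le hw h.sobolev_minus (h.memLp_ham_minus hw)
    hk.2 h2
  refine ⟨h1, h2, α, fun r hr => ⟨hα r hr, ?_⟩⟩
  have hz : (fun r => w r ^ 2 * ‖yp r + ym r‖ ^ 2) =ᵐ[radialMeasure] 0 :=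
    (integral_eq_zero_iff_of_nonneg (fun r => by positivity) (h.integrable_coupling hw)).1
      (le_antisymm (by linarith) n3)
  have hz' : ∀ᵐ r, 0 < r → w r ^ 2 * ‖yp r + ym r‖ ^ 2 = 0 := ae_radialMeasure_iff.1 hz
  -- Both components are already known to be multiples of w, so a single point where the coupling
  -- density vanishes determines β = -α.
  obtain ⟨x, hx, hx0⟩ : ∃ x, w x ^ 2 * ‖yp x + ym x‖ ^ 2 = 0 ∧ 0 < x := by
    have hne : (ae (volume.restrict (Ioi (0 : ℝ)))).NeBot := by
      rw [ae_neBot]; simp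
    exact (((ae_restrict_iff' measurableSet_Ioi).2 hz').and (ae_restrict_mem measurableSet_Ioi)).exists
  have hwx := (hw.pos hx0).ne'
  have hs : yp x + ym x = 0 := by simpa [hwx] using hx
  rw [hα x hx0, hβ x hx0, ← add_mul] at hs
  have hab : α + β = 0 := (mul_eq_zero.1 hs).resolve_right (by exact_mod_cast hwx)
  rw [hβ r hr, eq_neg_of_add_eq_zero_right hab]; ring

/-- For `|j| ≥ 2m` the operator `L_j` is positive. -/
lemma InDomainLj.energy_pos (hm : 1 ≤ m) (hw : IsVortexProfile m μ w) (h : InDomainLj m μ w j yp ym)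
    (hj : 2 * (m : ℤ) ≤ |j|) (hn : Nontriv yp ym) : 0 < (energy m μ w j yp ym).re := by
  by_contra! hE
  obtain ⟨h1, h2, α, hα⟩ := h.exists_eq_mul hw (Or.inr hj) hE
  obtain ⟨x, hx, hne⟩ := hn
  have hwx : (w x : ℂ) ≠ 0 := by exact_mod_cast (hw.pos hx).ne'
  -- The component whose angular momentum exceeds m in modulus must vanish, and it shares the
  -- constant α with the other.
  have hα0 : α = 0 := by
    rcases sq_lt_sq_of_two_mul_le_abs hm hj with hk | hk
    · have := eq_zero_of_scalarEnergy_le hw h.sobolev_plus (h.memLp_ham_plus hw) hk h1 hx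
      rw [(hα x hx).1] at this
      exact (mul_eq_zero.1 this).resolve_right hwx
    · have := eq_zero_of_scalarEnergy_le hw h.sobolev_minus (h.memLp_ham_minus hw) hk h2 hx
      rw [(hα x hx).2, neg_eq_zero] at this
      exact (mul_eq_zero.1 this).resolve_right hwx
  rw [(hα x hx).1, (hα x hx).2, hα0] at hne
  simp at hne

/-- Non-zero generalized eigenvectors lie in D(L_j) by definition, where the form is already
positive; the eigenvalue plays no part. -/
lemma positiveKreinSignature_of_two_mul_le_abs (hm : 1 ≤ m) (hw : IsVortexProfile m μ w)
    (hj : 2 * (m : ℤ) ≤ |j|) (lam : ℂ) : PositiveKreinSignature m μ w j lam := by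
  intro n yp ym hg hn
  cases n with
  | zero =>
    obtain ⟨r, hr, hne⟩ := hn
    have := hg r hr
    simp [this.1, this.2] at hne
  | succ n => exact ⟨hg.1.energy_pos hm hw hj hn, hg.1.energy_im hw (Or.inr hj)⟩

/-- `L_0 (w, -w) = 0`. -/
lemma radialHam_mul_profile (hw : IsVortexProfile m μ w) {k : ℤ} (hk : (k : ℝ) ^ 2 = (m : ℝ) ^ 2)
    (c : ℂ) {f : ℝ → ℂ} (hf : ∀ r, 0 < r → f r = c * (w r : ℂ)) {r : ℝ} (hr : 0 < r) :
    radialHam μ w k f r = 0 := by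
  have d1 : ∀ r, 0 < r → deriv f r = c * ((deriv w r : ℝ) : ℂ) := by
    intro r hr
    have e : f =ᶠ[𝓝 r] fun r => c * (w r : ℂ) := by
      filter_upwards [Ioi_mem_nhds hr] with x hx using hf x hx
    rw [e.deriv_eq]
    exact ((hw.hasDerivAt hr).ofReal_comp.const_mul c).deriv
  have d2 : deriv (deriv f) r = c * ((-(deriv w r) / r + ((m : ℝ) ^ 2 / r ^ 2 + r ^ 2
      + 2 * w r ^ 2 - 2 * μ) * w r : ℝ) : ℂ) := by
    have e : deriv f =ᶠ[𝓝 r] fun r => c * ((deriv w r : ℝ) : ℂ) := by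
      filter_upwards [Ioi_mem_nhds hr] with x hx using d1 x hx
    rw [e.deriv_eq]
    exact ((hw.hasDerivAt_deriv hr).ofReal_comp.const_mul c).deriv
  unfold radialHam radialExpr
  rw [d2, d1 r hr, hf r hr, hk]
  have hrc : (r : ℂ) ≠ 0 := by exact_mod_cast hr.ne'
  push_cast
  field_simp
  ring

lemma energy_zero_of_eq_mul (hw : IsVortexProfile m μ w) {α : ℂ}
    (h : ∀ r, 0 < r → yp r = α * (w r : ℂ) ∧ ym r = -(α * (w r : ℂ))) :
    energy m μ w 0 yp ym = 0 := by
  unfold energy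
  rw [integral_radialMeasure]
  refine setIntegral_eq_zero_of_forall_eq_zero fun r hr => ?_
  have e1 := radialHam_mul_profile hw (k := 0 + m) (by push_cast; ring) α (fun r hr => (h r hr).1) hr
  have e2 := radialHam_mul_profile hw (k := 0 - m) (by push_cast; ring) (-α) (f := ym)
    (fun r hr => by rw [(h r hr).2]; ring) hr
  rw [LjPlus_eq, LjMinus_eq, e1, e2, (h r hr).1, (h r hr).2]
  simp

end EnergyForm

end GPVortex

namespace GPVortex

/-! ### Decay at infinity of subsolutions -/

lemma not_integrableOn_Ioi_of_le {h : ℝ → ℝ} {a δ : ℝ} (hδ : 0 < δ) (hle : ∀ r, a < r → δ ≤ h r) :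
    ¬ IntegrableOn h (Ioi a) := by
  intro hI
  have h1 : IntegrableOn (fun _ : ℝ => δ) (Ioi a) := by
    refine Integrable.mono' hI aestronglyMeasurable_const ?_
    refine (ae_restrict_mem measurableSet_Ioi).mono fun r hr => ?_
    rw [Real.norm_of_nonneg hδ.le]; exact hle r hr
  rw [integrableOn_const_iff] at h1
  rcases h1 with h1 | h1
  · exact hδ.ne' (by simpa using h1)
  · simp at h1

/-- A non-negative solution of `s'' + s'/r ≥ s` near infinity which is not bounded below by a
positive constant is decreasing, integrable for `r dr`, and tends to `0`. -/
lemma decay_of_subsolution {s s' s'' : ℝ → ℝ} {R₀ : ℝ} (hR : 1 ≤ R₀)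
    (h1 : ∀ r, R₀ ≤ r → HasDerivAt s (s' r) r) (h2 : ∀ r, R₀ ≤ r → HasDerivAt s' (s'' r) r)
    (h0 : ∀ r, R₀ ≤ r → 0 ≤ s r) (hsub : ∀ r, R₀ ≤ r → s r ≤ s'' r + s' r / r)
    (hnb : ∀ δ a : ℝ, 0 < δ → R₀ ≤ a → ¬ ∀ r, a < r → δ ≤ s r) :
    IntegrableOn (fun r => r * s r) (Ioi R₀) ∧ Tendsto s atTop (𝓝 0) := by
  -- In divergence form the hypothesis reads (r s')' ≥ r s ≥ 0, so r s' is monotone.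
  have hd : ∀ r, R₀ ≤ r → HasDerivAt (fun r => r * s' r) (s' r + r * s'' r) r := by
    intro r hr
    exact ((hasDerivAt_id r).mul (h2 r hr)).congr_deriv (by simp)
  have hd0 : ∀ r, R₀ ≤ r → r * s r ≤ s' r + r * s'' r := by
    intro r hr
    have hr0 : 0 < r := by linarith
    have := mul_le_mul_of_nonneg_left (hsub r hr) hr0.le
    calc _ ≤ _ := this
      _ = _ := by field_simp; ring
  have hmono : MonotoneOn (fun r => r * s' r) (Ici R₀) := by
    refine monotoneOn_of_deriv_nonneg (convex_Ici R₀)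
      (fun r hr => (hd r hr).continuousAt.continuousWithinAt)
      (fun r hr => ?_) fun r hr => ?_
    · rw [interior_Ici] at hr
      exact (hd r (le_of_lt hr)).differentiableAt.differentiableWithinAt
    · rw [interior_Ici] at hr
      have hr' : R₀ ≤ r := le_of_lt hr
      rw [(hd r hr').deriv]
      exact (mul_nonneg (by linarith) (h0 r hr')).trans (hd0 r hr')
  -- If s' were positive at r₁, it would stay positive by monotonicity of r s', and s would be
  -- bounded below by s(r₁ + 1) > s(r₁) ≥ 0 from there on, contrary to `hnb`.
  have hneg : ∀ r, R₀ ≤ r → s' r ≤ 0 := by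
    intro r₁ hr₁
    by_contra! hc
    have hpos : ∀ r, r₁ ≤ r → 0 < s' r := by
      intro r hr
      have hm : r₁ * s' r₁ ≤ r * s' r := hmono hr₁ (hr₁.trans hr) hr
      have : 0 < r * s' r := (mul_pos (by linarith) hc).trans_le hm
      exact (mul_pos_iff_of_pos_left (by linarith)).1 this
    have hsm : StrictMonoOn s (Ici r₁) := by
      refine strictMonoOn_of_deriv_pos (convex_Ici r₁)
        (fun r hr => (h1 r (hr₁.trans hr)).continuousAt.continuousWithinAt) fun r hr => ?_
      rw [interior_Ici] at hr
      rw [(h1 r (hr₁.trans (le_of_lt hr))).deriv]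
      exact hpos r (le_of_lt hr)
    have hlt : s r₁ < s (r₁ + 1) :=
      hsm (mem_Ici.2 le_rfl) (mem_Ici.2 (by linarith)) (by linarith)
    refine hnb (s (r₁ + 1)) (r₁ + 1) ((h0 r₁ hr₁).trans_lt hlt) (by linarith) fun r hr => ?_
    exact (hsm (mem_Ici.2 (by linarith)) (mem_Ici.2 (by linarith)) hr).le
  have hanti : AntitoneOn s (Ici R₀) := by
    refine antitoneOn_of_deriv_nonpos (convex_Ici R₀)
      (fun r hr => (h1 r hr).continuousAt.continuousWithinAt) (fun r hr => ?_) fun r hr => ?_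
    · rw [interior_Ici] at hr
      exact (h1 r (le_of_lt hr)).differentiableAt.differentiableWithinAt
    · rw [interior_Ici] at hr
      rw [(h1 r (le_of_lt hr)).deriv]; exact hneg r (le_of_lt hr)
  have hcont : ContinuousOn (fun r => r * s r) (Ici R₀) := fun r hr =>
    (continuousAt_id.mul (h1 r hr).continuousAt).continuousWithinAt
  -- Integrating r s ≤ (r s')' and dropping b s'(b) ≤ 0 gives a bound independent of b.
  have hbound : ∀ b, R₀ ≤ b → ∫ r in R₀..b, r * s r ≤ -(R₀ * s' R₀) := by
    intro b hb
    have hi := hcont.mono (show Icc R₀ b ⊆ Ici R₀ from fun r hr => hr.1)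
    have key : ∫ r in R₀..b, r * s r ≤ b * s' b - R₀ * s' R₀ := by
      refine intervalIntegral.integral_le_sub_of_hasDeriv_right_of_le
        (φ := fun r => r * s r) (g' := fun r => s' r + r * s'' r) hb
        (fun r hr => (hd r hr.1).continuousAt.continuousWithinAt)
        (fun r hr => (hd r hr.1.le).hasDerivWithinAt)
        (hi.integrableOn_Icc) fun r hr => hd0 r hr.1.le
    have := mul_nonpos_of_nonneg_of_nonpos (show (0 : ℝ) ≤ b by linarith) (hneg b hb)
    linarith
  refine ⟨?_, ?_⟩
  · refine integrableOn_Ioi_of_intervalIntegral_norm_bounded (-(R₀ * s' R₀)) R₀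
      (b := fun r : ℝ => r) (l := atTop) (fun b => ?_) tendsto_id ?_
    · exact (hcont.mono (show Icc R₀ b ⊆ Ici R₀ from fun r hr => hr.1)).integrableOn_Icc.mono_set
        Ioc_subset_Icc_self
    · filter_upwards [eventually_ge_atTop R₀] with b hb
      refine le_trans (le_of_eq ?_) (hbound b hb)
      refine intervalIntegral.integral_congr fun r hr => ?_
      rw [uIcc_of_le hb] at hr
      exact Real.norm_of_nonneg (mul_nonneg (by linarith [hr.1]) (h0 r hr.1))
  · rw [Metric.tendsto_atTop]
    intro ε hε
    have := hnb ε R₀ hε le_rfl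
    push Not at this
    obtain ⟨N, hN, hs⟩ := this
    refine ⟨N, fun r hr => ?_⟩
    rw [Real.dist_0_eq_abs, abs_of_nonneg (h0 r (hN.le.trans hr))]
    exact (hanti (mem_Ici.2 hN.le) (mem_Ici.2 (hN.le.trans hr)) hr).trans_lt hs

/-! ### Decay of solutions of the mode equations -/

/-- The mode equations `L_j y = i λ R y` on `(0, ∞)`, without boundary conditions. -/
structure SolvesMode (m : ℕ) (μ : ℝ) (w : ℝ → ℝ) (j : ℤ) (lam : ℂ) (yp ym : ℝ → ℂ) : Prop where
  contDiffOn_plus : ContDiffOn ℝ 2 yp (Ioi 0)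
  contDiffOn_minus : ContDiffOn ℝ 2 ym (Ioi 0)
  equation_plus : ∀ r, 0 < r → LjPlus m μ w j yp ym r = Complex.I * lam * yp r
  equation_minus : ∀ r, 0 < r → LjMinus m μ w j yp ym r = -(Complex.I * lam * ym r)

section Modes

variable {m : ℕ} {μ : ℝ} {w : ℝ → ℝ} {j : ℤ} {lam : ℂ} {yp ym : ℝ → ℂ}

lemma IsModeSolution.solvesMode (h : IsModeSolution m μ w j lam yp ym) :
    SolvesMode m μ w j lam yp ym :=
  ⟨h.contDiffOn_plus, h.contDiffOn_minus, h.equation_plus, h.equation_minus⟩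

lemma hasDerivAt_norm_sq {y : ℝ → ℂ} (hy : ContDiffOn ℝ 2 y (Ioi 0)) {r : ℝ} (hr : 0 < r) :
    HasDerivAt (fun r => ‖y r‖ ^ 2) (2 * inner ℝ (y r) (deriv y r)) r :=
  (hasDerivAt_of_contDiffOn_Ioi hy hr).norm_sq

lemma hasDerivAt_two_inner {y : ℝ → ℂ} (hy : ContDiffOn ℝ 2 y (Ioi 0)) {r : ℝ} (hr : 0 < r) :
    HasDerivAt (fun r => 2 * inner ℝ (y r) (deriv y r))
      (2 * (inner ℝ (y r) (deriv (deriv y) r) + ‖deriv y r‖ ^ 2)) r := by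
  have h := ((hasDerivAt_of_contDiffOn_Ioi hy hr).inner ℝ
    (hasDerivAt_deriv_of_contDiffOn_Ioi hy hr)).const_mul 2
  rwa [real_inner_self_eq_norm_sq] at h

/-- If `radialExpr μ k y = g` then `Δ_r |y|² ≥ 2 r² |y|² - 4 μ |y|² - 4 ⟪y, g⟫`. -/
lemma laplacian_norm_sq_ge {y : ℝ → ℂ} {k : ℤ} {g : ℂ} {r : ℝ} (hr : 0 < r)
    (h : radialExpr μ k y r = g) :
    (2 * r ^ 2 - 4 * μ) * ‖y r‖ ^ 2 - 4 * inner ℝ (y r) g ≤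
      2 * (inner ℝ (y r) (deriv (deriv y) r) + ‖deriv y r‖ ^ 2)
        + 2 * inner ℝ (y r) (deriv y r) / r := by
  have e : deriv (deriv y) r = (2 * ((k : ℝ) ^ 2 / (2 * r ^ 2) + r ^ 2 / 2 - μ)) • y r
      - (2 : ℝ) • g - (1 / r) • deriv y r := by
    rw [← h]
    simp only [radialExpr, Complex.real_smul]
    push_cast
    ring
  rw [e, inner_sub_right, inner_sub_right, inner_smul_right, inner_smul_right, inner_smul_right,
    real_inner_self_eq_norm_sq]
  have h1 : 0 ≤ (k : ℝ) ^ 2 / (2 * r ^ 2) * ‖y r‖ ^ 2 := by positivity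
  have h2 : 0 ≤ ‖deriv y r‖ ^ 2 := by positivity
  have h3 : 2 * inner ℝ (y r) (deriv y r) / r = 2 * (1 / r * inner ℝ (y r) (deriv y r)) := by ring
  rw [h3]
  linarith

lemma inner_I_mul_le (a y : ℂ) : |inner ℝ y (a * y)| ≤ ‖a‖ * ‖y‖ ^ 2 := by
  refine (abs_real_inner_le_norm _ _).trans ?_
  rw [norm_mul]; exact le_of_eq (by ring)

/-- A solution of the mode equations which is small in a weak sense at infinity decays there. -/
lemma SolvesMode.decay (h : SolvesMode m μ w j lam yp ym)
    (hnb : ∀ δ a : ℝ, 0 < δ → 1 ≤ a → ¬ ∀ r, a < r → δ ≤ ‖yp r‖ ^ 2 + ‖ym r‖ ^ 2) :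
    (∃ R₀ : ℝ, 1 ≤ R₀ ∧ IntegrableOn (fun r => r * (‖yp r‖ ^ 2 + ‖ym r‖ ^ 2)) (Ioi R₀)) ∧
      Tendsto (fun r => ‖yp r‖ ^ 2 + ‖ym r‖ ^ 2) atTop (𝓝 0) := by
  -- With s = |y₊|² + |y₋|² the equations give Δ_r s ≥ (2r² - 4μ - 4|λ|) s; this choice, with r² ≥
  -- R₀, makes the factor at least 1.
  set R₀ : ℝ := 2 * |μ| + 2 * ‖lam‖ + 1 with hR₀
  have hR : 1 ≤ R₀ := by
    have := abs_nonneg μ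
    have := norm_nonneg lam
    linarith
  have key := decay_of_subsolution hR
    (fun r hr => (hasDerivAt_norm_sq h.contDiffOn_plus (by linarith)).add
      (hasDerivAt_norm_sq h.contDiffOn_minus (by linarith)))
    (fun r hr => (hasDerivAt_two_inner h.contDiffOn_plus (by linarith)).add
      (hasDerivAt_two_inner h.contDiffOn_minus (by linarith)))
    (fun r _ => add_nonneg (sq_nonneg ‖yp r‖) (sq_nonneg ‖ym r‖))
    (fun r hr => ?_) (fun δ a hδ ha => hnb δ a hδ (hR.trans ha))
  · exact ⟨⟨R₀, hR, key.1⟩, key.2⟩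
  have hr0 : 0 < r := by linarith
  have ep : radialExpr μ (j + m) yp r
      = Complex.I * lam * yp r - (|w r| ^ 2) • ((2 : ℝ) • yp r + ym r) := by
    rw [← h.equation_plus r hr0, LjPlus]
    simp only [Complex.real_smul]
    push_cast; ring
  have em : radialExpr μ (j - m) ym r
      = -(Complex.I * lam) * ym r - (|w r| ^ 2) • (yp r + (2 : ℝ) • ym r) := by
    rw [neg_mul, ← h.equation_minus r hr0, LjMinus]
    simp only [Complex.real_smul]
    push_cast; ring
  have bp := laplacian_norm_sq_ge hr0 ep
  have bm := laplacian_norm_sq_ge hr0 em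
  rw [inner_sub_right, inner_smul_right, inner_add_right, inner_smul_right,
    real_inner_self_eq_norm_sq] at bp
  rw [inner_sub_right, inner_smul_right, inner_add_right, inner_smul_right,
    real_inner_self_eq_norm_sq, real_inner_comm (yp r) (ym r)] at bm
  have cp := (abs_le.1 (inner_I_mul_le (Complex.I * lam) (yp r))).2
  have cm := (abs_le.1 (inner_I_mul_le (-(Complex.I * lam)) (ym r))).2
  rw [norm_neg] at cm
  rw [norm_mul, Complex.norm_I, one_mul] at cp cm
  -- This is |y₊ + y₋|². The coupling form is its sum with |y₊|² + |y₋|², so the w² terms have the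
  -- favourable sign and no bound on w is used.
  have hin : 0 ≤ ‖yp r‖ ^ 2 + 2 * inner ℝ (yp r) (ym r) + ‖ym r‖ ^ 2 := by
    rw [← norm_add_sq_real]; positivity
  change ‖yp r‖ ^ 2 + ‖ym r‖ ^ 2 ≤ _
  set P := ‖yp r‖ ^ 2
  set M := ‖ym r‖ ^ 2
  set X := inner ℝ (yp r) (ym r)
  have hP : 0 ≤ P := by positivity
  have hM : 0 ≤ M := by positivity
  have hW : 0 ≤ |w r| ^ 2 := by positivity
  have hWX : 0 ≤ |w r| ^ 2 * (2 * P + X + (X + 2 * M)) :=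
    mul_nonneg hW (by linarith)
  have hr2 : R₀ ≤ r ^ 2 := by nlinarith
  have hμ := le_abs_self μ
  have hlast : 0 ≤ (2 * r ^ 2 - 4 * μ - 4 * ‖lam‖ - 1) * (P + M) :=
    mul_nonneg (by linarith) (by linarith)
  rw [add_div]
  linarith

lemma memLp_two_of_bounded_of_integrableOn {y : ℝ → ℂ} (hy : ContinuousOn y (Ioi 0))
    (h0 : ∃ a : ℂ, Tendsto y (𝓝[>] 0) (𝓝 a)) (h1 : Tendsto y atTop (𝓝 0)) {R₀ : ℝ} (hR : 1 ≤ R₀)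
    (hI : IntegrableOn (fun r => r * ‖y r‖ ^ 2) (Ioi R₀)) : MemLp y 2 radialMeasure := by
  have hm := aestronglyMeasurable_radialMeasure hy
  rw [memLp_two_iff_integrable_sq_norm hm, integrable_radialMeasure_iff]
  obtain ⟨C, hC0, hC⟩ := exists_bound_Ioi hy
    (by
      obtain ⟨a, ha⟩ := h0
      exact ⟨‖a‖ + 1, (ha.norm.eventually (gt_mem_nhds (lt_add_one ‖a‖))).mono fun _ h => h.le⟩)
    (by
      have := h1.norm
      rw [norm_zero] at this
      exact ⟨1, (this.eventually (gt_mem_nhds one_pos)).mono fun _ h => h.le⟩)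
  rw [← Ioc_union_Ioi_eq_Ioi (show (0 : ℝ) ≤ R₀ by linarith)]
  refine IntegrableOn.union ?_ hI
  refine Integrable.of_bound (C := R₀ * C ^ 2) ?_ ?_
  · have : ContinuousOn (fun r => r • ‖y r‖ ^ 2) (Ioc 0 R₀) := by
      have := hy.mono (show Ioc 0 R₀ ⊆ Ioi 0 from fun r hr => hr.1)
      fun_prop
    exact this.aestronglyMeasurable measurableSet_Ioc
  · refine (ae_restrict_mem measurableSet_Ioc).mono fun r hr => ?_
    rw [norm_smul, Real.norm_of_nonneg hr.1.le, Real.norm_of_nonneg (by positivity)]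
    exact mul_le_mul hr.2 (pow_le_pow_left₀ (norm_nonneg _) (hC r hr.1) 2) (by positivity)
      (by linarith)

lemma isRadialSobolev_of_contDiffOn {y : ℝ → ℂ} (hy : ContDiffOn ℝ 2 y (Ioi 0))
    (h0 : ∃ a : ℂ, Tendsto y (𝓝[>] 0) (𝓝 a)) (hL : MemLp y 2 radialMeasure) :
    IsRadialSobolev y where
  differentiableOn := hy.differentiableOn two_ne_zero
  absolutelyContinuous a b ha hab := by
    refine ((contDiffOn_deriv_Ioi hy).mono ?_).absolutelyContinuousOnInterval
    rw [uIcc_of_le hab]; exact Icc_subset_Ioi_zero ha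
  limit_zero := h0
  memLp := hL

/-- Mode solutions lie in the domain of `L_j`. -/
lemma IsModeSolution.inDomainLj (h : IsModeSolution m μ w j lam yp ym) :
    InDomainLj m μ w j yp ym := by
  have hs : Tendsto (fun r => ‖yp r‖ ^ 2 + ‖ym r‖ ^ 2) atTop (𝓝 0) := by
    simpa using (h.tendsto_plus.norm.pow 2).add (h.tendsto_minus.norm.pow 2)
  -- Convergence to 0 rules out a positive lower bound, and the subsolution estimate upgrades it to
  -- square integrability at infinity.
  obtain ⟨⟨R₀, hR, hI⟩, -⟩ := h.solvesMode.decay fun δ a hδ _ hle => by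
    obtain ⟨r, hr, hr'⟩ := ((hs.eventually (gt_mem_nhds hδ)).and (eventually_gt_atTop a)).exists
    exact absurd (hle r hr') (not_le.2 hr)
  have hpos : ∀ r ∈ Ioi R₀, (0 : ℝ) < r := fun r hr => by
    have : R₀ < r := hr
    linarith
  have cp := h.contDiffOn_plus.continuousOn
  have cm := h.contDiffOn_minus.continuousOn
  have hp : IntegrableOn (fun r => r * ‖yp r‖ ^ 2) (Ioi R₀) := by
    refine Integrable.mono' hI ?_ ((ae_restrict_mem measurableSet_Ioi).mono fun r hr => ?_)
    · have := cp.mono hpos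
      exact ContinuousOn.aestronglyMeasurable (by fun_prop) measurableSet_Ioi
    · have := hpos r hr
      rw [Real.norm_of_nonneg (by positivity)]
      exact mul_le_mul_of_nonneg_left (le_add_of_nonneg_right (by positivity)) this.le
  have hm : IntegrableOn (fun r => r * ‖ym r‖ ^ 2) (Ioi R₀) := by
    refine Integrable.mono' hI ?_ ((ae_restrict_mem measurableSet_Ioi).mono fun r hr => ?_)
    · have := cm.mono hpos
      exact ContinuousOn.aestronglyMeasurable (by fun_prop) measurableSet_Ioi
    · have := hpos r hr
      rw [Real.norm_of_nonneg (by positivity)]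
      exact mul_le_mul_of_nonneg_left (le_add_of_nonneg_left (by positivity)) this.le
  have Lp := memLp_two_of_bounded_of_integrableOn cp h.limit_zero_plus h.tendsto_plus hR hp
  have Lm := memLp_two_of_bounded_of_integrableOn cm h.limit_zero_minus h.tendsto_minus hR hm
  refine ⟨isRadialSobolev_of_contDiffOn h.contDiffOn_plus h.limit_zero_plus Lp,
    isRadialSobolev_of_contDiffOn h.contDiffOn_minus h.limit_zero_minus Lm, ?_, ?_⟩
  · refine (Lp.const_mul (Complex.I * lam)).ae_eq ?_
    refine ae_radialMeasure_iff.2 (ae_of_all _ fun r hr => (h.equation_plus r hr).symm)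
  · refine (Lm.const_mul (-(Complex.I * lam))).ae_eq ?_
    refine ae_radialMeasure_iff.2 (ae_of_all _ fun r hr => ?_)
    rw [h.equation_minus r hr]; ring

/-- `(L_j y, y) = i λ (R y, y)` for mode solutions. -/
lemma IsModeSolution.energy_eq (h : IsModeSolution m μ w j lam yp ym) :
    ∃ N : ℝ, energy m μ w j yp ym = Complex.I * lam * N := by
  refine ⟨∫ r in Ioi 0, r • (‖yp r‖ ^ 2 - ‖ym r‖ ^ 2), ?_⟩
  rw [energy, integral_radialMeasure, ← integral_complex_ofReal, ← integral_const_mul]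
  refine setIntegral_congr_fun measurableSet_Ioi fun r hr => ?_
  rw [h.equation_plus r hr, h.equation_minus r hr]
  have e1 := Complex.mul_conj (yp r)
  have e2 := Complex.mul_conj (ym r)
  rw [Complex.normSq_eq_norm_sq] at e1 e2
  rw [Complex.real_smul, smul_eq_mul]
  push_cast at e1 e2 ⊢
  linear_combination (r : ℂ) * (Complex.I * lam) * (e1 - e2)

/-- Mode solutions of non-zero real energy have `i λ` real. -/
lemma IsModeSolution.I_mul_real_of_energy_pos (h : IsModeSolution m μ w j lam yp ym)
    (hre : 0 < (energy m μ w j yp ym).re) (him : (energy m μ w j yp ym).im = 0) :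
    (Complex.I * lam).im = 0 := by
  obtain ⟨N, hN⟩ := h.energy_eq
  rw [hN] at hre him
  rw [Complex.re_mul_ofReal] at hre
  rw [Complex.im_mul_ofReal] at him
  refine (mul_eq_zero.1 him).resolve_right fun h0 => ?_
  rw [h0, mul_zero] at hre
  exact lt_irrefl _ hre

/-- Zero energy forces y = α(w, -w), which L_0 annihilates; the mode equation at a point where y
does not vanish then reads iλ = 0. -/
lemma IsModeSolution.eq_zero_of_energy_eq_zero (hw : IsVortexProfile m μ w)
    (h : IsModeSolution m μ w 0 lam yp ym) (hn : Nontriv yp ym)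
    (hE : energy m μ w 0 yp ym = 0) : lam = 0 := by
  obtain ⟨-, -, α, hα⟩ := h.inDomainLj.exists_eq_mul hw (Or.inl rfl) (by rw [hE]; simp)
  obtain ⟨x, hx, hne⟩ := hn
  have e := radialHam_mul_profile hw (k := 0 + m) (by push_cast; ring) α (fun r hr => (hα r hr).1) hx
  have hp := h.equation_plus x hx
  rw [LjPlus_eq, e, (hα x hx).1, (hα x hx).2, add_neg_cancel, mul_zero, zero_add] at hp
  rw [(hα x hx).1, (hα x hx).2] at hne
  have hne' : α * (w x : ℂ) ≠ 0 := by
    rcases hne with h | h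
    · exact h
    · exact neg_ne_zero.1 h
  have := (mul_eq_zero.1 hp.symm).resolve_right hne'
  exact (mul_eq_zero.1 this).resolve_left Complex.I_ne_zero

/-- The energy is real and equals iλ times a real number, which settles the case of positive energy.
Zero energy is possible only for j = 0, and then λ = 0. -/
lemma IsModeSolution.I_mul_real (hm : 1 ≤ m) (hw : IsVortexProfile m μ w)
    (hj : j = 0 ∨ 2 * (m : ℤ) ≤ |j|) (h : IsModeSolution m μ w j lam yp ym)
    (hn : Nontriv yp ym) : (Complex.I * lam).im = 0 := by
  have hD := h.inDomainLj
  have him := hD.energy_im hw hj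
  by_cases hE : (energy m μ w j yp ym).re = 0
  · rcases hj with rfl | hj
    · rw [h.eq_zero_of_energy_eq_zero hw hn (Complex.ext hE him)]; simp
    · exact absurd hE (hD.energy_pos hm hw hj hn).ne'
  · exact h.I_mul_real_of_energy_pos ((hD.energy_nonneg hw hj).lt_of_ne' hE) him

end Modes

end GPVortex

namespace GPVortex

/-! ### Weak second order equations on the half-line -/

/-- Every test function is, on `(0, ∞)`, the derivative of a test function. -/
lemma exists_test_primitive {ψ : ℝ → ℝ} (hψ : ContDiff ℝ ∞ ψ) (hc : HasCompactSupport ψ) :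
    ∃ ζ : ℝ → ℝ, ContDiff ℝ ∞ ζ ∧ HasCompactSupport ζ ∧ ∀ t, 0 ≤ t → HasDerivAt ζ (ψ t) t := by
  obtain ⟨M, hM⟩ : ∃ M : ℝ, ∀ t, M ≤ t → ψ t = 0 := by
    obtain ⟨M, hM⟩ := hc.isCompact.bddAbove
    refine ⟨M + 1, fun t ht => image_eq_zero_of_notMem_tsupport fun h => ?_⟩
    have := hM h
    linarith
  -- Integrating from M makes the primitive vanish beyond M. To the left it is cut off between -2
  -- and -1, outside the half-line, so that ψ need not have mean zero.
  set Ψ : ℝ → ℝ := fun t => ∫ s in M..t, ψ s with hΨ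
  have hd : ∀ t, HasDerivAt Ψ (ψ t) t := fun t =>
    (hψ.continuous.integral_hasStrictDerivAt M t).hasDerivAt
  have hΨs : ContDiff ℝ ∞ Ψ := by
    rw [contDiff_infty_iff_deriv]
    refine ⟨fun t => (hd t).differentiableAt, ?_⟩
    rwa [show deriv Ψ = ψ from funext fun t => (hd t).deriv]
  have hΨ0 : ∀ t, M ≤ t → Ψ t = 0 := by
    intro t ht
    simp only [hΨ]
    rw [intervalIntegral.integral_congr (g := fun _ => 0), intervalIntegral.integral_zero]
    intro s hs
    rw [uIcc_of_le ht] at hs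
    exact hM s hs.1
  refine ⟨fun t => Real.smoothTransition (t + 2) * Ψ t, ?_, ?_, fun t ht => ?_⟩
  · exact (Real.smoothTransition.contDiff.comp (contDiff_id.add contDiff_const)).mul hΨs
  · refine HasCompactSupport.intro (isCompact_Icc (a := -2) (b := M)) fun t ht => ?_
    rw [mem_Icc, not_and_or, not_le, not_le] at ht
    rcases ht with h | h
    · rw [Real.smoothTransition.zero_of_nonpos (by linarith), zero_mul]
    · rw [hΨ0 t h.le, mul_zero]
  · refine (hd t).congr_of_eventuallyEq ?_
    filter_upwards [Ioi_mem_nhds (show (-1 : ℝ) < t by linarith)] with s hs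
    have : -1 < s := hs
    rw [Real.smoothTransition.one_of_one_le (by linarith), one_mul]

lemma exists_forall_ge_eq_zero {ψ : ℝ → ℝ} (hc : HasCompactSupport ψ) :
    ∃ M : ℝ, ∀ t, M ≤ t → ψ t = 0 := by
  obtain ⟨M, hM⟩ := hc.isCompact.bddAbove
  refine ⟨M + 1, fun t ht => image_eq_zero_of_notMem_tsupport fun h => ?_⟩
  have := hM h
  linarith

/-- Integration by parts against the primitive of an integrable function. -/
lemma integral_mul_eq_neg_integral_primitive {η ζ G : ℝ → ℝ} {T : ℝ} (hT : 0 ≤ T)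
    (hη : ContDiff ℝ ∞ η) (hζ : ∀ t, 0 ≤ t → HasDerivAt η (ζ t) t) (hηT : η T = 0)
    (hG : IntervalIntegrable G volume 0 T) :
    ∫ t in (0 : ℝ)..T, η t * G t = -∫ t in (0 : ℝ)..T, ζ t * ∫ s in (0 : ℝ)..t, G s := by
  have hηac : AbsolutelyContinuousOnInterval η 0 T :=
    (hη.of_le (by exact_mod_cast le_top)).contDiffOn.absolutelyContinuousOnInterval
  have hP := hG.absolutelyContinuousOnInterval_intervalIntegral (c := 0) (by simp)
  have key := hηac.integral_mul_deriv_eq_deriv_mul hP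
  rw [hηT, intervalIntegral.integral_same] at key
  have e1 : ∫ t in (0 : ℝ)..T, η t * G t
      = ∫ t in (0 : ℝ)..T, η t * deriv (fun t => ∫ s in (0 : ℝ)..t, G s) t := by
    refine intervalIntegral.integral_congr_ae ?_
    filter_upwards [hG.ae_hasDerivAt_integral] with t ht hmem
    rw [(ht (uIoc_subset_uIcc hmem) 0 (by simp)).deriv]
  have e2 : ∫ t in (0 : ℝ)..T, ζ t * ∫ s in (0 : ℝ)..t, G s
      = ∫ t in (0 : ℝ)..T, deriv η t * ∫ s in (0 : ℝ)..t, G s := by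
    refine intervalIntegral.integral_congr fun t ht => ?_
    rw [uIcc_of_le hT] at ht
    rw [(hζ t ht.1).deriv]
  rw [e1, e2, key]
  ring

lemma intervalIntegrable_primitive {G : ℝ → ℝ} {T : ℝ} (hG : IntervalIntegrable G volume 0 T) :
    IntervalIntegrable (fun t => ∫ s in (0 : ℝ)..t, G s) volume 0 T :=
  (hG.absolutelyContinuousOnInterval_intervalIntegral (c := 0) (by simp)).continuousOn
    |>.intervalIntegrable

/-- A weak solution of `(t U)'' - (κ U)' = G` on `[0, ∞)`, tested against functions which need not
vanish near `0`, satisfies the twice integrated equation. -/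
lemma ae_eq_of_weak_halfLine {κ : ℝ} {U G : ℝ → ℝ}
    (hU : ∀ T, 0 ≤ T → IntervalIntegrable U volume 0 T)
    (hG : ∀ T, 0 ≤ T → IntervalIntegrable G volume 0 T)
    (h : ∀ η : ℝ → ℝ, ContDiff ℝ ∞ η → HasCompactSupport η →
      ∫ t in Ioi 0, (t * U t * deriv (deriv η) t + κ * U t * deriv η t - G t * η t) = 0) :
    ∀ᵐ t, 0 < t → t * U t = ∫ s in (0 : ℝ)..t, (κ * U s + ∫ τ in (0 : ℝ)..s, G τ) := by
  set P : ℝ → ℝ := fun t => ∫ s in (0 : ℝ)..t, G s with hP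
  set F : ℝ → ℝ := fun t => κ * U t + P t with hF
  have hFi : ∀ T, 0 ≤ T → IntervalIntegrable F volume 0 T := fun T hT =>
    ((hU T hT).const_mul κ).add (intervalIntegrable_primitive (hG T hT))
  set Q : ℝ → ℝ := fun t => ∫ s in (0 : ℝ)..t, F s with hQ
  have htU : ∀ T, 0 ≤ T → IntervalIntegrable (fun t => t * U t) volume 0 T := fun T hT =>
    (hU T hT).continuousOn_mul continuousOn_id
  have hHi : ∀ T, 0 ≤ T → IntervalIntegrable (fun t => t * U t - Q t) volume 0 T := fun T hT =>
    (htU T hT).sub (intervalIntegrable_primitive (hFi T hT))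
  -- Extended by zero, the defect is locally integrable on ℝ, and it suffices to annihilate every
  -- test function on ℝ.
  set H : ℝ → ℝ := (Ioi 0).indicator fun t => t * U t - Q t with hH
  have hHloc : LocallyIntegrable H := by
    rw [locallyIntegrable_iff]
    intro K hK
    obtain ⟨M, hM⟩ := hK.bddAbove
    rw [hH, IntegrableOn, integrable_indicator_iff measurableSet_Ioi, IntegrableOn,
      Measure.restrict_restrict measurableSet_Ioi]
    refine IntegrableOn.mono_set (t := Ioc 0 (max M 0)) ?_ fun t ht =>
      ⟨ht.1, (hM ht.2).trans (le_max_left _ _)⟩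
    exact (intervalIntegrable_iff_integrableOn_Ioc_of_le (le_max_right _ _)).1
      (hHi _ (le_max_right _ _))
  have key : ∀ ψ : ℝ → ℝ, ContDiff ℝ ∞ ψ → HasCompactSupport ψ → ∫ t, ψ t • H t = 0 := by
    intro ψ hψ hψc
    -- On the half-line ψ = ζ' = η''. Inserting η and integrating by parts produces no boundary
    -- terms: the test functions vanish at T, and the primitives of G and F vanish at 0.
    obtain ⟨ζ, hζ, hζc, hζd⟩ := exists_test_primitive hψ hψc
    obtain ⟨η, hη, hηc, hηd⟩ := exists_test_primitive hζ hζc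
    obtain ⟨M₁, h1⟩ := exists_forall_ge_eq_zero hψc
    obtain ⟨M₂, h2⟩ := exists_forall_ge_eq_zero hζc
    obtain ⟨M₃, h3⟩ := exists_forall_ge_eq_zero hηc
    set T := max 0 (max M₁ (max M₂ M₃)) with hTdef
    have hT : 0 ≤ T := le_max_left _ _
    have z1 : ∀ t, T ≤ t → ψ t = 0 := fun t ht => h1 t (le_trans (by simp [hTdef]) ht)
    have z2 : ∀ t, T ≤ t → ζ t = 0 := fun t ht => h2 t (le_trans (by simp [hTdef]) ht)
    have z3 : ∀ t, T ≤ t → η t = 0 := fun t ht => h3 t (le_trans (by simp [hTdef]) ht)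
    have d1 : ∀ t, 0 < t → deriv η t = ζ t := fun t ht => (hηd t ht.le).deriv
    have d2 : ∀ t, 0 < t → deriv (deriv η) t = ψ t := fun t ht => by
      have e : deriv η =ᶠ[𝓝 t] ζ := by
        filter_upwards [Ioi_mem_nhds ht] with s hs using d1 s hs
      rw [e.deriv_eq, (hζd t ht.le).deriv]
    have h0 := h η hη hηc
    have e0 : ∫ t in Ioi 0, (t * U t * deriv (deriv η) t + κ * U t * deriv η t - G t * η t)
        = ∫ t in (0 : ℝ)..T, (ψ t * (t * U t) + ζ t * (κ * U t) - η t * G t) := by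
      rw [intervalIntegral.integral_of_le hT]
      refine (setIntegral_eq_of_subset_of_forall_sdiff_eq_zero measurableSet_Ioi
        Ioc_subset_Ioi_self fun t ht => ?_).trans (setIntegral_congr_fun measurableSet_Ioc
          fun t ht => ?_)
      · have ht0 : 0 < t := ht.1
        have htT : T ≤ t := by
          by_contra! hcon
          exact ht.2 ⟨ht0, hcon.le⟩
        rw [d1 t ht0, d2 t ht0, z1 t htT, z2 t htT, z3 t htT]
        ring
      · have ht0 : 0 < t := ht.1
        rw [d1 t ht0, d2 t ht0]
        ring
    have i1 : IntervalIntegrable (fun t => ψ t * (t * U t)) volume 0 T :=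
      (htU T hT).continuousOn_mul hψ.continuous.continuousOn
    have i2 : IntervalIntegrable (fun t => ζ t * (κ * U t)) volume 0 T :=
      ((hU T hT).const_mul κ).continuousOn_mul hζ.continuous.continuousOn
    have i3 : IntervalIntegrable (fun t => η t * G t) volume 0 T :=
      (hG T hT).continuousOn_mul hη.continuous.continuousOn
    have i4 : IntervalIntegrable (fun t => ζ t * P t) volume 0 T :=
      (intervalIntegrable_primitive (hG T hT)).continuousOn_mul hζ.continuous.continuousOn
    have i5 : IntervalIntegrable (fun t => ψ t * Q t) volume 0 T :=
      (intervalIntegrable_primitive (hFi T hT)).continuousOn_mul hψ.continuous.continuousOn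
    have p1 := integral_mul_eq_neg_integral_primitive hT hη hηd (z3 T le_rfl) (hG T hT)
    have p2 := integral_mul_eq_neg_integral_primitive hT hζ hζd (z2 T le_rfl) (hFi T hT)
    have p3 : ∫ t in (0 : ℝ)..T, ζ t * F t = (∫ t in (0 : ℝ)..T, ζ t * (κ * U t))
        + ∫ t in (0 : ℝ)..T, ζ t * P t := by
      rw [← intervalIntegral.integral_add i2 i4]
      congr 1; ext t; simp only [hF]; ring
    rw [e0, intervalIntegral.integral_sub (i1.add i2) i3, intervalIntegral.integral_add i1 i2,
      p1] at h0
    have e1 : ∫ t, ψ t • H t = ∫ t in (0 : ℝ)..T, (ψ t * (t * U t) - ψ t * Q t) := by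
      rw [intervalIntegral.integral_of_le hT]
      have e2 : (fun t => ψ t • H t) = (Ioi 0).indicator fun t => ψ t * (t * U t) - ψ t * Q t := by
        ext t
        by_cases ht : t ∈ Ioi (0 : ℝ)
        · simp only [hH, indicator_of_mem ht, smul_eq_mul]; ring
        · simp only [hH, indicator_of_notMem ht, smul_zero]
      rw [e2, integral_indicator measurableSet_Ioi]
      refine setIntegral_eq_of_subset_of_forall_sdiff_eq_zero measurableSet_Ioi
        Ioc_subset_Ioi_self fun t ht => ?_
      have ht0 : 0 < t := ht.1
      have htT : T ≤ t := by
        by_contra! hcon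
        exact ht.2 ⟨ht0, hcon.le⟩
      rw [z1 t htT]; ring
    rw [e1, intervalIntegral.integral_sub i1 i5]
    linarith
  have hz := ae_eq_zero_of_integral_contDiff_smul_eq_zero hHloc key
  filter_upwards [hz] with t ht ht0
  rw [hH, indicator_of_mem (mem_Ioi.2 ht0)] at ht
  exact sub_eq_zero.1 ht

/-! ### The substitution `t = r²` -/

lemma sq_image_Ioc {R : ℝ} (hR : 0 ≤ R) : (fun r : ℝ => r ^ 2) '' Ioc 0 R = Ioc 0 (R ^ 2) := by
  ext t
  constructor
  · rintro ⟨r, hr, rfl⟩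
    exact ⟨pow_pos hr.1 2, pow_le_pow_left₀ hr.1.le hr.2 2⟩
  · intro ht
    exact ⟨√t, ⟨Real.sqrt_pos.2 ht.1, (Real.sqrt_le_left hR).2 ht.2⟩, Real.sq_sqrt ht.1.le⟩

lemma sq_image_Ioi : (fun r : ℝ => r ^ 2) '' Ioi 0 = Ioi 0 := by
  ext t
  constructor
  · rintro ⟨r, hr, rfl⟩
    exact pow_pos (mem_Ioi.1 hr) 2
  · intro ht
    exact ⟨√t, Real.sqrt_pos.2 ht, Real.sq_sqrt (le_of_lt ht)⟩

section Substitution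

variable {E : Type*} [NormedAddCommGroup E] [NormedSpace ℝ E]

lemma hasDerivWithinAt_sq (s : Set ℝ) (r : ℝ) : HasDerivWithinAt (fun r : ℝ => r ^ 2) (2 * r) s r := by
  simpa using (hasDerivAt_pow 2 r).hasDerivWithinAt (s := s)

lemma injOn_sq_Ioi : InjOn (fun r : ℝ => r ^ 2) (Ioi 0) := fun _ ha _ hb h =>
  (pow_left_inj₀ (le_of_lt ha) (le_of_lt hb) two_ne_zero).1 h

lemma integral_Ioi_sq (h : ℝ → E) :
    ∫ t in Ioi 0, h t = ∫ r in Ioi 0, (2 * r) • h (r ^ 2) := by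
  have := integral_image_eq_integral_abs_deriv_smul measurableSet_Ioi
    (fun r _ => hasDerivWithinAt_sq (Ioi 0) r) injOn_sq_Ioi h
  rw [sq_image_Ioi] at this
  rw [this]
  refine setIntegral_congr_fun measurableSet_Ioi fun r hr => ?_
  have hr0 : (0 : ℝ) < r := hr
  rw [abs_of_pos (by positivity)]

lemma integral_sq (h : ℝ → E) {R : ℝ} (hR : 0 ≤ R) :
    ∫ t in (0 : ℝ)..R ^ 2, h t = ∫ r in (0 : ℝ)..R, (2 * r) • h (r ^ 2) := by
  rw [intervalIntegral.integral_of_le hR, intervalIntegral.integral_of_le (sq_nonneg R)]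
  have := integral_image_eq_integral_abs_deriv_smul measurableSet_Ioc
    (fun r _ => hasDerivWithinAt_sq (Ioc 0 R) r) (injOn_sq_Ioi.mono Ioc_subset_Ioi_self) h
  rw [sq_image_Ioc hR] at this
  rw [this]
  refine setIntegral_congr_fun measurableSet_Ioc fun r hr => ?_
  have hr0 : (0 : ℝ) < r := hr.1
  rw [abs_of_pos (by positivity)]

lemma intervalIntegrable_sq_iff (h : ℝ → E) {R : ℝ} (hR : 0 ≤ R) :
    IntervalIntegrable h volume 0 (R ^ 2) ↔
      IntervalIntegrable (fun r => (2 * r) • h (r ^ 2)) volume 0 R := by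
  rw [intervalIntegrable_iff_integrableOn_Ioc_of_le hR,
    intervalIntegrable_iff_integrableOn_Ioc_of_le (sq_nonneg R)]
  have := integrableOn_image_iff_integrableOn_abs_deriv_smul measurableSet_Ioc
    (fun r _ => hasDerivWithinAt_sq (Ioc 0 R) r) (injOn_sq_Ioi.mono Ioc_subset_Ioi_self) h
  rw [sq_image_Ioc hR] at this
  rw [this]
  refine integrableOn_congr_fun (fun r hr => ?_) measurableSet_Ioc
  have hr0 : (0 : ℝ) < r := hr.1
  rw [abs_of_pos (by positivity)]

/-- The exceptional set in r is the image under √ of the one in t, and √ is differentiable on (0,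
∞), so it preserves null sets there. -/
lemma ae_sq {p : ℝ → Prop} (h : ∀ᵐ t, 0 < t → p t) : ∀ᵐ r, 0 < r → p (r ^ 2) := by
  rw [ae_iff] at h ⊢
  have hd : DifferentiableOn ℝ Real.sqrt {t | ¬(0 < t → p t)} := fun t ht => by
    rw [mem_ofPred_eq, Classical.not_imp] at ht
    exact (Real.hasDerivAt_sqrt ht.1.ne').differentiableAt.differentiableWithinAt
  refine measure_mono_null (fun r hr => ?_)
    (addHaar_image_eq_zero_of_differentiableOn_of_addHaar_eq_zero volume hd h)
  rw [mem_ofPred_eq, Classical.not_imp] at hr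
  refine ⟨r ^ 2, ?_, Real.sqrt_sq hr.1.le⟩
  rw [mem_ofPred_eq, Classical.not_imp]
  exact ⟨pow_pos hr.1 2, hr.2⟩

end Substitution

end GPVortex

namespace GPVortex

/-! ### The integrated form of the weak radial equation -/

section WeakRadial

variable {k : ℕ} {Y g : ℝ → ℂ}

/-- The primitive `½ ∫₀^r ρ^{k+1} g(ρ) dρ`. -/
noncomputable def momentPrimitive (k : ℕ) (g : ℝ → ℂ) (r : ℝ) : ℂ :=
  (1 / 2 : ℝ) • ∫ ρ in (0 : ℝ)..r, (ρ ^ (k + 1) : ℝ) • g ρ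

lemma intervalIntegrable_pow_smul {h : ℝ → ℂ}
    (hh : ∀ R, 0 ≤ R → IntervalIntegrable (fun r => r • h r) volume 0 R) (k : ℕ) {R : ℝ}
    (hR : 0 ≤ R) : IntervalIntegrable (fun r => (r ^ (k + 1) : ℝ) • h r) volume 0 R := by
  have e : (fun r => (r ^ (k + 1) : ℝ) • h r) = fun r => (r ^ k : ℝ) • (r • h r) := by
    ext1 r; rw [smul_smul, pow_succ]
  rw [e]
  exact IntervalIntegrable.continuousOn_smul (g := fun r => r • h r) (f := fun r : ℝ => r ^ k)
    (hh R hR) (continuous_pow k).continuousOn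

lemma intervalIntegrable_clm {h : ℝ → ℂ} {a b : ℝ} (hh : IntervalIntegrable h volume a b)
    (l : ℂ →L[ℝ] ℝ) : IntervalIntegrable (fun r => l (h r)) volume a b :=
  ⟨l.integrable_comp hh.1, l.integrable_comp hh.2⟩

lemma continuousOn_momentPrimitive
    (hg : ∀ R, 0 ≤ R → IntervalIntegrable (fun r => r • g r) volume 0 R) {R : ℝ} (hR : 0 ≤ R) :
    ContinuousOn (momentPrimitive k g) (Icc 0 R) := by
  have h0 : IntegrableOn (fun r => (r ^ (k + 1) : ℝ) • g r) (uIcc 0 R) := by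
    rw [uIcc_of_le hR]
    exact (intervalIntegrable_iff_integrableOn_Icc_of_le hR).1 (intervalIntegrable_pow_smul hg k hR)
  have h := intervalIntegral.continuousOn_primitive_interval h0
  rw [uIcc_of_le hR] at h
  exact h.const_smul (1 / 2 : ℝ)

/-- The double integral appearing in the integrated radial equation. -/
noncomputable def momentIterated (k : ℕ) (Y g : ℝ → ℂ) (r : ℝ) : ℂ :=
  ∫ ρ in (0 : ℝ)..r, (2 * ρ) • (((k + 1) * ρ ^ k : ℝ) • Y ρ + momentPrimitive k g ρ)

lemma intervalIntegrable_momentIntegrand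
    (hY : ∀ R, 0 ≤ R → IntervalIntegrable (fun r => r • Y r) volume 0 R)
    (hg : ∀ R, 0 ≤ R → IntervalIntegrable (fun r => r • g r) volume 0 R) {R : ℝ} (hR : 0 ≤ R) :
    IntervalIntegrable (fun ρ => (2 * ρ) • (((k + 1) * ρ ^ k : ℝ) • Y ρ
      + momentPrimitive k g ρ)) volume 0 R := by
  have h1 := (intervalIntegrable_pow_smul hY k hR).smul (2 * (k + 1) : ℝ)
  have h2 : IntervalIntegrable (fun ρ : ℝ => (2 * ρ) • momentPrimitive k g ρ) volume 0 R := by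
    refine ContinuousOn.intervalIntegrable ?_
    rw [uIcc_of_le hR]
    have := continuousOn_momentPrimitive (k := k) hg hR
    fun_prop
  refine (h1.add h2).congr fun ρ _ => ?_
  simp only [Pi.smul_apply, Complex.real_smul]
  push_cast
  ring

/-- A weak solution of the radial equation `Y'' + Y'/r - k² Y / r² = g` in the plane, tested
against `r^k η(r²)`, satisfies the twice integrated equation. -/
lemma ae_eq_of_weak_radial
    (hY : ∀ R, 0 ≤ R → IntervalIntegrable (fun r => r • Y r) volume 0 R)
    (hg : ∀ R, 0 ≤ R → IntervalIntegrable (fun r => r • g r) volume 0 R)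
    (h : ∀ η : ℝ → ℝ, ContDiff ℝ ∞ η → HasCompactSupport η →
      ∫ r in Ioi 0, ((r ^ (k + 1) * (4 * ((k + 1) * deriv η (r ^ 2)
        + r ^ 2 * deriv (deriv η) (r ^ 2))) : ℝ) • Y r - (r ^ (k + 1) * η (r ^ 2) : ℝ) • g r) = 0) :
    ∀ᵐ r, 0 < r → (r ^ (k + 2) : ℝ) • Y r = momentIterated k Y g r := by
  have key : ∀ l : ℂ →L[ℝ] ℝ,
      ∀ᵐ r, 0 < r → (r ^ (k + 2) : ℝ) * l (Y r) = l (momentIterated k Y g r) := by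
    intro l
    -- With t = r² the test function r^k η(r²) becomes t^{k/2} η(t), and its Laplacian 4 t^{k/2} (t
    -- η'' + (k+1) η'). The weight t^{k/2} goes into U and G and the factor 4 into G, which leaves
    -- the half-line equation with κ = k + 1.
    set U : ℝ → ℝ := fun t => √t ^ k * l (Y √t) with hU
    set G : ℝ → ℝ := fun t => 1 / 4 * (√t ^ k * l (g √t)) with hG
    have hUi : ∀ T, 0 ≤ T → IntervalIntegrable U volume 0 T := by
      intro T hT
      rw [← Real.sq_sqrt hT, intervalIntegrable_sq_iff _ (Real.sqrt_nonneg T)]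
      have := (intervalIntegrable_clm (intervalIntegrable_pow_smul hY k (Real.sqrt_nonneg T))
        l).const_mul 2
      refine this.congr fun r hr => ?_
      rw [uIoc_of_le (Real.sqrt_nonneg T)] at hr
      simp only [hU, Real.sqrt_sq hr.1.le, map_smul, smul_eq_mul]
      ring
    have hGi : ∀ T, 0 ≤ T → IntervalIntegrable G volume 0 T := by
      intro T hT
      rw [← Real.sq_sqrt hT, intervalIntegrable_sq_iff _ (Real.sqrt_nonneg T)]
      have := (intervalIntegrable_clm (intervalIntegrable_pow_smul hg k (Real.sqrt_nonneg T))
        l).const_mul (1 / 2)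
      refine this.congr fun r hr => ?_
      rw [uIoc_of_le (Real.sqrt_nonneg T)] at hr
      simp only [hG, Real.sqrt_sq hr.1.le, map_smul, smul_eq_mul]
      ring
    have hweak : ∀ η : ℝ → ℝ, ContDiff ℝ ∞ η → HasCompactSupport η →
        ∫ t in Ioi 0, (t * U t * deriv (deriv η) t + (k + 1 : ℝ) * U t * deriv η t - G t * η t)
          = 0 := by
      intro η hη hηc
      rw [integral_Ioi_sq]
      have h0 := h η hη hηc
      obtain ⟨M, hM⟩ := exists_forall_ge_eq_zero hηc
      obtain ⟨M', hM'⟩ := exists_forall_ge_eq_zero hηc.deriv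
      obtain ⟨M'', hM''⟩ := exists_forall_ge_eq_zero hηc.deriv.deriv
      set R : ℝ := max 1 (max M (max M' M'')) with hR
      have hR1 : 1 ≤ R := le_max_left _ _
      have hη1 : ContDiff ℝ ∞ (deriv η) := (contDiff_infty_iff_deriv.1 hη).2
      have hη2 : ContDiff ℝ ∞ (deriv (deriv η)) := (contDiff_infty_iff_deriv.1 hη1).2
      have hzero : ∀ r, R ≤ r → η (r ^ 2) = 0 ∧ deriv η (r ^ 2) = 0 ∧ deriv (deriv η) (r ^ 2) = 0 := by
        intro r hr
        have hr2 : R ≤ r ^ 2 := by nlinarith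
        exact ⟨hM _ (le_trans (by simp [hR]) hr2), hM' _ (le_trans (by simp [hR]) hr2),
          hM'' _ (le_trans (by simp [hR]) hr2)⟩
      have hint : IntegrableOn (fun r => (r ^ (k + 1) * (4 * ((k + 1) * deriv η (r ^ 2)
        + r ^ 2 * deriv (deriv η) (r ^ 2))) : ℝ) • Y r - (r ^ (k + 1) * η (r ^ 2) : ℝ) • g r)
          (Ioi 0) := by
        have hc1 : Continuous fun r : ℝ => 4 * ((k + 1) * deriv η (r ^ 2)
            + r ^ 2 * deriv (deriv η) (r ^ 2)) := by
          have := hη1.continuous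
          have := hη2.continuous
          fun_prop
        have hc2 : Continuous fun r : ℝ => η (r ^ 2) := by
          have := hη.continuous
          fun_prop
        have i1 := (intervalIntegrable_pow_smul hY k (show 0 ≤ R by linarith)).continuousOn_smul
          hc1.continuousOn
        have i2 := (intervalIntegrable_pow_smul hg k (show 0 ≤ R by linarith)).continuousOn_smul
          hc2.continuousOn
        have i3 := (intervalIntegrable_iff_integrableOn_Ioc_of_le (show 0 ≤ R by linarith)).1
          (i1.sub i2)
        refine (i3.of_forall_sdiff_eq_zero measurableSet_Ioi fun r hr => ?_).congr_fun
          (fun r _ => ?_) measurableSet_Ioi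
        · have hRr : R ≤ r := by
            by_contra! hcon
            exact hr.2 ⟨hr.1, hcon.le⟩
          obtain ⟨z1, z2, z3⟩ := hzero r hRr
          simp [z1, z2, z3]
        · simp only [smul_smul]
          congr 2 <;> ring
      have h1 := l.integral_comp_comm hint
      rw [h0, map_zero] at h1
      have h2 : ∫ r in Ioi 0, 1 / 2 * l ((r ^ (k + 1) * (4 * ((k + 1) * deriv η (r ^ 2)
        + r ^ 2 * deriv (deriv η) (r ^ 2))) : ℝ) • Y r - (r ^ (k + 1) * η (r ^ 2) : ℝ) • g r)
          = 0 := by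
        rw [integral_const_mul, h1, mul_zero]
      refine Eq.trans ?_ h2
      refine setIntegral_congr_fun measurableSet_Ioi fun r hr => ?_
      simp only [hU, hG, Real.sqrt_sq (le_of_lt hr), map_sub, map_smul, smul_eq_mul]
      ring
    have hae := ae_sq (ae_eq_of_weak_halfLine hUi hGi hweak)
    filter_upwards [hae] with r hr hr0
    have h1 := hr hr0
    rw [integral_sq _ hr0.le] at h1
    have hP : ∀ ρ, 0 ≤ ρ → ∫ τ in (0 : ℝ)..ρ ^ 2, G τ = l (momentPrimitive k g ρ) := by
      intro ρ hρ
      rw [integral_sq _ hρ, momentPrimitive, map_smul,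
        ← l.intervalIntegral_comp_comm (intervalIntegrable_pow_smul hg k hρ), smul_eq_mul,
        ← intervalIntegral.integral_const_mul]
      refine intervalIntegral.integral_congr_ae (ae_of_all _ fun s hs => ?_)
      rw [uIoc_of_le hρ] at hs
      simp only [hG, Real.sqrt_sq hs.1.le, map_smul, smul_eq_mul]
      ring
    have hQ : l (momentIterated k Y g r) = ∫ ρ in (0 : ℝ)..r, (2 * ρ) • ((k + 1 : ℝ) * U (ρ ^ 2)
        + ∫ τ in (0 : ℝ)..ρ ^ 2, G τ) := by
      rw [momentIterated,
        ← l.intervalIntegral_comp_comm (intervalIntegrable_momentIntegrand hY hg hr0.le)]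
      refine intervalIntegral.integral_congr_ae (ae_of_all _ fun s hs => ?_)
      rw [uIoc_of_le hr0.le] at hs
      rw [hP s hs.1.le]
      simp only [hU, Real.sqrt_sq hs.1.le, map_smul, map_add, smul_eq_mul]
      ring
    rw [hQ, ← h1]
    simp only [hU, Real.sqrt_sq hr0.le]
    ring
  filter_upwards [key Complex.reCLM, key Complex.imCLM] with r h1 h2 hr
  apply Complex.ext
  · rw [Complex.smul_re]; exact h1 hr
  · rw [Complex.smul_im]; exact h2 hr

end WeakRadial

end GPVortex

namespace GPVortex

/-! ### Classical regularity of weak radial solutions -/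

section Regularity

variable {k : ℕ} {Y g : ℝ → ℂ}

/-- The continuous representative of a weak solution of the radial equation. -/
noncomputable def radialRep (k : ℕ) (Y g : ℝ → ℂ) (r : ℝ) : ℂ :=
  (1 / r ^ (k + 2) : ℝ) • momentIterated k Y g r

lemma radialRep_ae_eq (h : ∀ᵐ r, 0 < r → (r ^ (k + 2) : ℝ) • Y r = momentIterated k Y g r) :
    ∀ᵐ r, 0 < r → Y r = radialRep k Y g r := by
  filter_upwards [h] with r hr h0
  rw [radialRep, ← hr h0, smul_smul, one_div_mul_cancel (pow_pos h0 _).ne', one_smul]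

lemma momentPrimitive_congr {g₁ g₂ : ℝ → ℂ} (h : ∀ᵐ r, 0 < r → g₁ r = g₂ r) {r : ℝ} (hr : 0 ≤ r) :
    momentPrimitive k g₁ r = momentPrimitive k g₂ r := by
  unfold momentPrimitive
  congr 1
  refine intervalIntegral.integral_congr_ae ?_
  filter_upwards [h] with s hs hmem
  rw [uIoc_of_le hr] at hmem
  rw [hs hmem.1]

lemma momentIterated_congr {Y₁ Y₂ : ℝ → ℂ} (h : ∀ᵐ r, 0 < r → Y₁ r = Y₂ r) {r : ℝ} (hr : 0 ≤ r) :
    momentIterated k Y₁ g r = momentIterated k Y₂ g r := by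
  unfold momentIterated
  refine intervalIntegral.integral_congr_ae ?_
  filter_upwards [h] with s hs hmem
  rw [uIoc_of_le hr] at hmem
  rw [hs hmem.1]

lemma intervalIntegrable_congr_pos {Y₁ Y₂ : ℝ → ℂ} (h : ∀ᵐ r, 0 < r → Y₁ r = Y₂ r)
    (h1 : ∀ R, 0 ≤ R → IntervalIntegrable (fun r => r • Y₁ r) volume 0 R) (R : ℝ) (hR : 0 ≤ R) :
    IntervalIntegrable (fun r => r • Y₂ r) volume 0 R := by
  refine (h1 R hR).congr_ae ?_
  rw [EventuallyEq, ae_restrict_iff' measurableSet_uIoc]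
  filter_upwards [h] with s hs hmem
  rw [uIoc_of_le hR] at hmem
  rw [hs hmem.1]

/-- Derivative of a primitive at an interior point of `(0, ∞)` where the integrand is continuous. -/
lemma hasDerivAt_primitive_of_continuousOn {F : ℝ → ℂ}
    (hF : ∀ R, 0 ≤ R → IntervalIntegrable F volume 0 R) (hc : ContinuousOn F (Ioi 0)) {r : ℝ}
    (hr : 0 < r) : HasDerivAt (fun r => ∫ s in (0 : ℝ)..r, F s) (F r) r :=
  intervalIntegral.integral_hasDerivAt_right (hF r hr.le)
    (hc.stronglyMeasurableAtFilter isOpen_Ioi r hr) (hc.continuousAt (Ioi_mem_nhds hr))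

lemma continuousOn_momentIterated
    (hY : ∀ R, 0 ≤ R → IntervalIntegrable (fun r => r • Y r) volume 0 R)
    (hg : ∀ R, 0 ≤ R → IntervalIntegrable (fun r => r • g r) volume 0 R) :
    ContinuousOn (momentIterated k Y g) (Ioi 0) := by
  intro r hr
  have hr0 : (0 : ℝ) < r := hr
  have h := intervalIntegrable_momentIntegrand (k := k) hY hg (show 0 ≤ r + 1 by linarith)
  have h0 : IntegrableOn (fun ρ => (2 * ρ) • (((k + 1) * ρ ^ k : ℝ) • Y ρ
      + momentPrimitive k g ρ)) (uIcc 0 (r + 1)) := by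
    rw [uIcc_of_le (by linarith)]
    exact (intervalIntegrable_iff_integrableOn_Icc_of_le (by linarith)).1 h
  have h1 := intervalIntegral.continuousOn_primitive_interval h0
  rw [uIcc_of_le (by linarith)] at h1
  exact (h1.continuousAt (Icc_mem_nhds hr0 (by linarith))).continuousWithinAt

lemma continuousOn_radialRep
    (hY : ∀ R, 0 ≤ R → IntervalIntegrable (fun r => r • Y r) volume 0 R)
    (hg : ∀ R, 0 ≤ R → IntervalIntegrable (fun r => r • g r) volume 0 R) :
    ContinuousOn (radialRep k Y g) (Ioi 0) := by
  have h := continuousOn_momentIterated (k := k) hY hg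
  have hne : ∀ r ∈ Ioi (0 : ℝ), r ^ (k + 2) ≠ 0 := fun r hr => (pow_pos hr _).ne'
  unfold radialRep
  exact (continuousOn_const.div (continuousOn_pow _) hne).smul h

lemma continuousOn_momentPrimitive_Ioi
    (hg : ∀ R, 0 ≤ R → IntervalIntegrable (fun r => r • g r) volume 0 R) :
    ContinuousOn (momentPrimitive k g) (Ioi 0) := by
  intro r hr
  have hr0 : (0 : ℝ) < r := hr
  have h1 := continuousOn_momentPrimitive (k := k) hg (show 0 ≤ r + 1 by linarith)
  exact (h1.continuousAt (Icc_mem_nhds hr0 (by linarith))).continuousWithinAt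

/-- First order form of the radial equation: `y' = (k/r) y + (2/r^{k+1}) p`. -/
lemma hasDerivAt_radialRep
    (hY : ∀ R, 0 ≤ R → IntervalIntegrable (fun r => r • Y r) volume 0 R)
    (hg : ∀ R, 0 ≤ R → IntervalIntegrable (fun r => r • g r) volume 0 R)
    (h : ∀ᵐ r, 0 < r → (r ^ (k + 2) : ℝ) • Y r = momentIterated k Y g r) {r : ℝ} (hr : 0 < r) :
    HasDerivAt (radialRep k Y g) ((k / r : ℝ) • radialRep k Y g r
      + (2 / r ^ (k + 1) : ℝ) • momentPrimitive k g r) r := by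
  -- Bootstrap: Y may be replaced by its continuous representative under the integral, which makes
  -- the integrand continuous and the integral differentiable.
  have hae := radialRep_ae_eq h
  have hy := intervalIntegrable_congr_pos hae hY
  have hc := continuousOn_radialRep (k := k) hY hg
  have hp := continuousOn_momentPrimitive_Ioi (k := k) hg
  have hd := hasDerivAt_primitive_of_continuousOn (F := fun ρ => (2 * ρ) • (((k + 1) * ρ ^ k : ℝ) •
    radialRep k Y g ρ + momentPrimitive k g ρ))
    (fun R hR => intervalIntegrable_momentIntegrand hy hg hR) (by fun_prop) hr
  have hd' : HasDerivAt (momentIterated k Y g) ((2 * r) • (((k + 1) * r ^ k : ℝ) •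
      radialRep k Y g r + momentPrimitive k g r)) r := by
    refine hd.congr_of_eventuallyEq ?_
    filter_upwards [Ioi_mem_nhds hr] with s hs
    exact momentIterated_congr hae (le_of_lt hs)
  have hne : r ^ (k + 2) ≠ 0 := (pow_pos hr _).ne'
  have hinv : HasDerivAt (fun r : ℝ => 1 / r ^ (k + 2)) (-(k + 2 : ℝ) / r ^ (k + 3)) r := by
    have := (hasDerivAt_pow (k + 2) r).inv hne
    simp only [one_div]
    refine this.congr_deriv ?_
    push_cast
    field_simp
    rw [← pow_add, ← pow_mul]
    congr 2; ring
  have hm := hinv.smul hd'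
  refine hm.congr_deriv ?_
  have hq : momentIterated k Y g r = (r ^ (k + 2) : ℝ) • radialRep k Y g r := by
    rw [radialRep, smul_smul, mul_one_div_cancel hne, one_smul]
  rw [hq]
  simp only [Complex.real_smul]
  have hrc : (r : ℂ) ≠ 0 := by exact_mod_cast hr.ne'
  push_cast
  field_simp
  ring

lemma hasDerivAt_momentPrimitive {g' : ℝ → ℂ}
    (hg : ∀ R, 0 ≤ R → IntervalIntegrable (fun r => r • g r) volume 0 R)
    (hgg : ∀ᵐ r, 0 < r → g r = g' r) (hc : ContinuousOn g' (Ioi 0)) {r : ℝ} (hr : 0 < r) :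
    HasDerivAt (momentPrimitive k g) ((1 / 2 : ℝ) • (r ^ (k + 1) : ℝ) • g' r) r := by
  have hd := (hasDerivAt_primitive_of_continuousOn (F := fun ρ => (ρ ^ (k + 1) : ℝ) • g' ρ)
    (fun R hR => intervalIntegrable_pow_smul (intervalIntegrable_congr_pos hgg hg) k hR)
    (by fun_prop) hr).const_smul (1 / 2 : ℝ)
  refine hd.congr_of_eventuallyEq ?_
  filter_upwards [Ioi_mem_nhds hr] with s hs
  exact momentPrimitive_congr hgg (le_of_lt hs)

/-- The second derivative of the continuous representative. -/
lemma hasDerivAt_deriv_radialRep {g' : ℝ → ℂ}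
    (hY : ∀ R, 0 ≤ R → IntervalIntegrable (fun r => r • Y r) volume 0 R)
    (hg : ∀ R, 0 ≤ R → IntervalIntegrable (fun r => r • g r) volume 0 R)
    (h : ∀ᵐ r, 0 < r → (r ^ (k + 2) : ℝ) • Y r = momentIterated k Y g r)
    (hgg : ∀ᵐ r, 0 < r → g r = g' r) (hc : ContinuousOn g' (Ioi 0)) {r : ℝ} (hr : 0 < r) :
    HasDerivAt (fun r => (k / r : ℝ) • radialRep k Y g r
      + (2 / r ^ (k + 1) : ℝ) • momentPrimitive k g r)
      (g' r + ((k : ℝ) ^ 2 / r ^ 2) • radialRep k Y g r - (1 / r) •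
        ((k / r : ℝ) • radialRep k Y g r + (2 / r ^ (k + 1) : ℝ) • momentPrimitive k g r)) r := by
  have h1 : HasDerivAt (fun r : ℝ => (k : ℝ) / r) (-(k : ℝ) / r ^ 2) r := by
    have := (hasDerivAt_inv hr.ne').const_mul (k : ℝ)
    simp only [div_eq_mul_inv]
    refine this.congr_deriv ?_
    ring
  have hne : r ^ (k + 1) ≠ 0 := (pow_pos hr _).ne'
  have h2 : HasDerivAt (fun r : ℝ => 2 / r ^ (k + 1)) (-(2 * (k + 1 : ℝ)) / r ^ (k + 2)) r := by
    have := ((hasDerivAt_pow (k + 1) r).inv hne).const_mul 2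
    simp only [div_eq_mul_inv]
    refine this.congr_deriv ?_
    push_cast
    field_simp
    rw [← pow_add, ← pow_mul]
    congr 2; ring
  have h3 := (h1.smul (hasDerivAt_radialRep hY hg h hr)).add
    (h2.smul (hasDerivAt_momentPrimitive (k := k) hg hgg hc hr))
  refine h3.congr_deriv ?_
  simp only [Complex.real_smul]
  have hrc : (r : ℂ) ≠ 0 := by exact_mod_cast hr.ne'
  push_cast
  field_simp
  ring

/-- The continuous representative is a classical solution. -/
lemma contDiffOn_radialRep {g' : ℝ → ℂ}
    (hY : ∀ R, 0 ≤ R → IntervalIntegrable (fun r => r • Y r) volume 0 R)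
    (hg : ∀ R, 0 ≤ R → IntervalIntegrable (fun r => r • g r) volume 0 R)
    (h : ∀ᵐ r, 0 < r → (r ^ (k + 2) : ℝ) • Y r = momentIterated k Y g r)
    (hgg : ∀ᵐ r, 0 < r → g r = g' r) (hc : ContinuousOn g' (Ioi 0)) :
    ContDiffOn ℝ 2 (radialRep k Y g) (Ioi 0) := by
  refine contDiffOn_two_of_hasDerivAt (fun r hr => hasDerivAt_radialRep hY hg h hr)
    (fun r hr => hasDerivAt_deriv_radialRep hY hg h hgg hc hr) ?_
  have h1 := continuousOn_radialRep (k := k) hY hg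
  have h2 := continuousOn_momentPrimitive_Ioi (k := k) hg
  have hne : ∀ r ∈ Ioi (0 : ℝ), r ≠ 0 := fun r hr => ne_of_gt hr
  have hne1 : ∀ r ∈ Ioi (0 : ℝ), r ^ (k + 1) ≠ 0 := fun r hr => (pow_pos hr _).ne'
  have hne2 : ∀ r ∈ Ioi (0 : ℝ), r ^ 2 ≠ 0 := fun r hr => (pow_pos hr _).ne'
  fun_prop (disch := assumption)

lemma radialRep_equation {g' : ℝ → ℂ}
    (hY : ∀ R, 0 ≤ R → IntervalIntegrable (fun r => r • Y r) volume 0 R)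
    (hg : ∀ R, 0 ≤ R → IntervalIntegrable (fun r => r • g r) volume 0 R)
    (h : ∀ᵐ r, 0 < r → (r ^ (k + 2) : ℝ) • Y r = momentIterated k Y g r)
    (hgg : ∀ᵐ r, 0 < r → g r = g' r) (hc : ContinuousOn g' (Ioi 0)) {r : ℝ} (hr : 0 < r) :
    deriv (deriv (radialRep k Y g)) r + (1 / r) • deriv (radialRep k Y g) r
      = g' r + ((k : ℝ) ^ 2 / r ^ 2) • radialRep k Y g r := by
  have e : deriv (radialRep k Y g) =ᶠ[𝓝 r] fun r => (k / r : ℝ) • radialRep k Y g r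
      + (2 / r ^ (k + 1) : ℝ) • momentPrimitive k g r := by
    filter_upwards [Ioi_mem_nhds hr] with s hs using (hasDerivAt_radialRep hY hg h hs).deriv
  rw [e.deriv_eq, (hasDerivAt_deriv_radialRep hY hg h hgg hc hr).deriv, e.eq_of_nhds]
  abel

/-! ### The limit at the origin -/

/-- A solution of `y' = (k/r) y + O(1)` has a limit at the origin. -/
lemma exists_limit_of_deriv_bound {y y' : ℝ → ℂ} {C : ℝ}
    (hd : ∀ r, 0 < r → HasDerivAt y (y' r) r)
    (hb : ∀ r, 0 < r → r ≤ 1 → ‖y' r - (k / r : ℝ) • y r‖ ≤ C) :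
    ∃ a : ℂ, Tendsto y (𝓝[>] 0) (𝓝 a) := by
  have hC : 0 ≤ C := (norm_nonneg _).trans (hb 1 one_pos le_rfl)
  rcases Nat.eq_zero_or_pos k with rfl | hk
  -- For k = 0 the derivative is bounded on (0, 1]; a Lipschitz extension to ℝ supplies the limit.
  · have hL : LipschitzOnWith (Real.toNNReal C) y (Ioc 0 1) := by
      refine (convex_Ioc (0 : ℝ) 1).lipschitzOnWith_of_nnnorm_hasDerivWithin_le
        (fun r hr => (hd r hr.1).hasDerivWithinAt) fun r hr => ?_
      rw [← NNReal.coe_le_coe, coe_nnnorm, Real.coe_toNNReal _ hC]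
      simpa using hb r hr.1 hr.2
    obtain ⟨f, hf, he⟩ := hL.extend_finite_dimension
    refine ⟨f 0, (hf.continuous.continuousAt.mono_left nhdsWithin_le_nhds).congr' ?_⟩
    filter_upwards [Ioc_mem_nhdsGT one_pos] with r hr using (he hr).symm
  · refine ⟨0, ?_⟩
    -- For k ≥ 1, r² S' ≥ (|y| - C r)² ≥ 0. Hence S ≤ S(1) on (0, 1], which gives |y|² ≤ S(1) r and
    -- the limit 0.
    set S : ℝ → ℝ := fun r => ‖y r‖ ^ 2 / r + C ^ 2 * r with hS
    have hSd : ∀ r, 0 < r → HasDerivAt S ((2 * inner ℝ (y r) (y' r) * r - ‖y r‖ ^ 2 * 1) / r ^ 2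
        + C ^ 2 * 1) r := fun r hr =>
      ((hd r hr).norm_sq.div (hasDerivAt_id r) hr.ne').add ((hasDerivAt_id r).const_mul _)
    have hmono : MonotoneOn S (Ioc 0 1) := by
      refine monotoneOn_of_deriv_nonneg (convex_Ioc 0 1)
        (fun r hr => (hSd r hr.1).continuousAt.continuousWithinAt) (fun r hr => ?_) fun r hr => ?_
      · rw [interior_Ioc] at hr
        exact (hSd r hr.1).differentiableAt.differentiableWithinAt
      · rw [interior_Ioc] at hr
        have hr0 : 0 < r := hr.1
        rw [(hSd r hr0).deriv]
        have e : inner ℝ (y r) (y' r) = k / r * ‖y r‖ ^ 2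
            + inner ℝ (y r) (y' r - (k / r : ℝ) • y r) := by
          rw [inner_sub_right, inner_smul_right, real_inner_self_eq_norm_sq]; ring
        have h1 := (abs_le.1 ((abs_real_inner_le_norm (y r) (y' r - (k / r : ℝ) • y r)).trans
          (mul_le_mul_of_nonneg_left (hb r hr0 hr.2.le) (norm_nonneg _)))).1
        have hk1 : (1 : ℝ) ≤ k := by exact_mod_cast hk
        have h2 : inner ℝ (y r) (y' r) * r ≥ ‖y r‖ ^ 2 - ‖y r‖ * C * r := by
          have h3 : k / r * ‖y r‖ ^ 2 * r = k * ‖y r‖ ^ 2 := by field_simp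
          rw [e, add_mul, h3]
          have h4 : ‖y r‖ ^ 2 ≤ k * ‖y r‖ ^ 2 := le_mul_of_one_le_left (by positivity) hk1
          have h5 := mul_le_mul_of_nonneg_right h1 hr0.le
          linarith
        have h6 : 0 ≤ (2 * inner ℝ (y r) (y' r) * r - ‖y r‖ ^ 2 * 1) + C ^ 2 * r ^ 2 := by
          nlinarith [sq_nonneg (‖y r‖ - C * r)]
        have h7 : (2 * inner ℝ (y r) (y' r) * r - ‖y r‖ ^ 2 * 1) / r ^ 2 + C ^ 2 * 1
            = ((2 * inner ℝ (y r) (y' r) * r - ‖y r‖ ^ 2 * 1) + C ^ 2 * r ^ 2) / r ^ 2 := by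
          field_simp
        rw [h7]
        positivity
    have hbound : ∀ r, 0 < r → r ≤ 1 → ‖y r‖ ^ 2 ≤ S 1 * r := by
      intro r hr hr1
      have h1 : S r ≤ S 1 := hmono ⟨hr, hr1⟩ ⟨one_pos, le_rfl⟩ hr1
      have h2 : ‖y r‖ ^ 2 / r ≤ S 1 := by
        have : 0 ≤ C ^ 2 * r := by positivity
        simp only [hS] at h1 ⊢
        linarith
      rwa [div_le_iff₀ hr] at h2
    have hsq : Tendsto (fun r => ‖y r‖ ^ 2) (𝓝[>] 0) (𝓝 0) := by
      have hlim : Tendsto (fun r : ℝ => S 1 * r) (𝓝[>] 0) (𝓝 0) := by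
        have : Tendsto (fun r : ℝ => S 1 * r) (𝓝 0) (𝓝 (S 1 * 0)) :=
          (continuous_const_mul (S 1)).tendsto 0
        rw [mul_zero] at this
        exact this.mono_left nhdsWithin_le_nhds
      refine squeeze_zero' (Eventually.of_forall fun r => by positivity) ?_ hlim
      filter_upwards [Ioc_mem_nhdsGT one_pos] with r hr using hbound r hr.1 hr.2
    rw [tendsto_zero_iff_norm_tendsto_zero]
    have := hsq.sqrt
    simpa using this

/-- A square integrable source has moments of the natural size. -/
lemma norm_momentPrimitive_le
    (hg2 : IntervalIntegrable (fun r => r * ‖g r‖ ^ 2) volume 0 1) :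
    ∃ C : ℝ, ∀ r, 0 < r → r ≤ 1 → ‖momentPrimitive k g r‖ ≤ C * r ^ (k + 1) := by
  set I := ∫ r in (0 : ℝ)..1, r * ‖g r‖ ^ 2 with hI
  refine ⟨I + 1, fun r hr hr1 => ?_⟩
  have i2 : IntervalIntegrable (fun r => r * ‖g r‖ ^ 2) volume 0 r :=
    hg2.mono_set (by rw [uIcc_of_le hr.le, uIcc_of_le zero_le_one]; exact Icc_subset_Icc_right hr1)
  have hIr : ∫ ρ in (0 : ℝ)..r, ρ * ‖g ρ‖ ^ 2 ≤ I := by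
    refine intervalIntegral.integral_mono_interval le_rfl hr.le hr1 ?_ hg2
    exact (ae_restrict_mem measurableSet_Ioc).mono fun ρ hρ => mul_nonneg hρ.1.le (sq_nonneg _)
  have h1 : ‖∫ ρ in (0 : ℝ)..r, (ρ ^ (k + 1) : ℝ) • g ρ‖
      ≤ ∫ ρ in (0 : ℝ)..r, r ^ k * (r * (ρ * ‖g ρ‖ ^ 2) + 1 / r * ρ) := by
    refine intervalIntegral.norm_integral_le_of_norm_le hr.le (ae_of_all _ fun ρ hρ => ?_)
      (((i2.const_mul r).add (Continuous.intervalIntegrable (by fun_prop) _ _)).const_mul _)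
    have hρ0 : 0 < ρ := hρ.1
    rw [norm_smul, Real.norm_of_nonneg (by positivity), pow_succ, mul_assoc]
    have h2 : ρ * ‖g ρ‖ ≤ r * (ρ * ‖g ρ‖ ^ 2) + 1 / r * ρ := by
      -- A weighted Young inequality in place of Cauchy–Schwarz; the weight r gives both terms the
      -- order r^{k+1} after integration over (0, r).
      have h3 : ‖g ρ‖ ≤ r * ‖g ρ‖ ^ 2 + 1 / r := by
        rw [← sub_nonneg]
        have : r * ‖g ρ‖ ^ 2 + 1 / r - ‖g ρ‖
            = ((r * ‖g ρ‖ - 1 / 2) ^ 2 + 3 / 4) / r := by field_simp; ring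
        rw [this]; positivity
      have := mul_le_mul_of_nonneg_left h3 hρ0.le
      linarith
    exact mul_le_mul (pow_le_pow_left₀ hρ0.le hρ.2 k) h2 (by positivity) (by positivity)
  have h2 : ∫ ρ in (0 : ℝ)..r, r ^ k * (r * (ρ * ‖g ρ‖ ^ 2) + 1 / r * ρ)
      ≤ r ^ k * (r * I + r) := by
    rw [intervalIntegral.integral_const_mul, intervalIntegral.integral_add (i2.const_mul r)
      (Continuous.intervalIntegrable (by fun_prop) _ _), intervalIntegral.integral_const_mul,
      intervalIntegral.integral_const_mul, integral_id]
    have h3 : 1 / r * ((r ^ 2 - 0 ^ 2) / 2) ≤ r := by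
      have : 1 / r * ((r ^ 2 - 0 ^ 2) / 2) = r / 2 := by field_simp; ring
      rw [this]; linarith
    gcongr
  have hI0 : 0 ≤ I := intervalIntegral.integral_nonneg zero_le_one fun ρ hρ =>
    mul_nonneg hρ.1 (sq_nonneg _)
  rw [momentPrimitive, norm_smul, Real.norm_of_nonneg (by norm_num)]
  have h4 := h1.trans h2
  have h5 : r ^ k * (r * I + r) = (I + 1) * r ^ (k + 1) := by ring
  rw [h5] at h4
  have h6 := norm_nonneg (∫ ρ in (0 : ℝ)..r, (ρ ^ (k + 1) : ℝ) • g ρ)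
  linarith

/-- In the first order form, y' - (k/r) y is 2 r^{-(k+1)} times the moment of g, which is bounded
because the moment is O(r^{k+1}). -/
lemma exists_limit_radialRep
    (hY : ∀ R, 0 ≤ R → IntervalIntegrable (fun r => r • Y r) volume 0 R)
    (hg : ∀ R, 0 ≤ R → IntervalIntegrable (fun r => r • g r) volume 0 R)
    (h : ∀ᵐ r, 0 < r → (r ^ (k + 2) : ℝ) • Y r = momentIterated k Y g r)
    (hg2 : IntervalIntegrable (fun r => r * ‖g r‖ ^ 2) volume 0 1) :
    ∃ a : ℂ, Tendsto (radialRep k Y g) (𝓝[>] 0) (𝓝 a) := by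
  obtain ⟨C, hC⟩ := norm_momentPrimitive_le (k := k) hg2
  refine exists_limit_of_deriv_bound (k := k) (C := 2 * C)
    (fun r hr => hasDerivAt_radialRep hY hg h hr) fun r hr hr1 => ?_
  rw [add_sub_cancel_left, norm_smul, Real.norm_of_nonneg (by positivity), div_mul_eq_mul_div,
    div_le_iff₀ (by positivity)]
  have := hC r hr hr1
  linarith

end Regularity

end GPVortex

namespace GPVortex

/-! ### The eigenvalue equation in the sense of distributions -/

section Distributions

/-- Multiplying -J(L_c + L_w)Φ = λΦ by J, with J(-J) = 1, isolates L_cΦ = λJΦ - L_wΦ. -/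
lemma IsEigenfunction.exists_mem_LcGraph {m : ℕ} {μ : ℝ} {w : ℝ → ℝ} {lam : ℂ} {Φ : PlaneL2}
    (h : IsEigenfunction m μ w lam Φ) :
    ∃ f : PlaneL2, (Φ, f) ∈ LcGraph ∧ ∀ᵐ z, f z =
      lam • Matrix.toEuclideanCLM (𝕜 := ℂ) J (Φ z) - mulFun (LwSymbol m μ w) Φ z := by
  obtain ⟨-, hd, he⟩ := h
  have hd' : Φ ∈ Lc.domain ⊓ (mulOp (LwSymbol m μ w)).domain := hd
  have hg := Submodule.mem_graph_toLinearPMap LcGraph_snd_eq_zero ⟨Φ, hd'.1⟩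
  refine ⟨Lc ⟨Φ, hd'.1⟩, hg, ?_⟩
  set f := Lc ⟨Φ, hd'.1⟩ with hf
  set v := mulOp (LwSymbol m μ w) ⟨Φ, hd'.2⟩ with hv
  have hv' : v =ᵐ[volume] mulFun (LwSymbol m μ w) Φ := MemLp.coeFn_toLp (mem_mulDomain.1 hd'.2)
  have e1 : (Matrix.toEuclideanCLM (𝕜 := ℂ) (-J)).compLpL 2 volume (f + v) = lam • Φ := he
  have e2 := ContinuousLinearMap.coeFn_compLpL (p := 2) (μ := (volume : Measure ℂ))
    (Matrix.toEuclideanCLM (𝕜 := ℂ) (-J)) (f + v)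
  rw [e1] at e2
  filter_upwards [e2, hv', Lp.coeFn_add f v, Lp.coeFn_smul lam Φ] with z h1 h2 h3 h4
  rw [h4, h3, Pi.add_apply, h2, Pi.smul_apply] at h1
  have hJ : J * (-J) = 1 := by
    ext i j
    fin_cases i <;> fin_cases j <;> simp [J]
  have h5 := congrArg (Matrix.toEuclideanCLM (𝕜 := ℂ) J) h1
  rw [← mul_apply_eq_comp, ← map_mul, hJ, map_one, map_smul] at h5
  rw [h5]
  simp

/-- The second derivatives along `e`. -/
noncomputable def planeLaplacian {E : Type*} [NormedAddCommGroup E] [NormedSpace ℝ E] (φ : ℂ → E)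
    (z : ℂ) : E :=
  fderiv ℝ (fun z => fderiv ℝ φ z 1) z 1
    + fderiv ℝ (fun z => fderiv ℝ φ z Complex.I) z Complex.I

lemma contDiff_fderiv_apply {E : Type*} [NormedAddCommGroup E] [NormedSpace ℝ E] {φ : ℂ → E}
    (hφ : ContDiff ℝ ∞ φ) (e : ℂ) : ContDiff ℝ ∞ fun z => fderiv ℝ φ z e :=
  (hφ.fderiv_right (m := ∞) (by simp)).clm_apply contDiff_const

lemma integral_inner_toLp {φ : ℂ → ℝ} (hφ : Continuous φ) (hc : HasCompactSupport φ) (c : C2)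
    (g : PlaneL2) : inner ℂ (memLp_smul_const hφ hc c).toLp g = inner ℂ c (∫ z, φ z • g z) := by
  rw [← integral_inner (integrable_smul_PlaneL2 g hφ hc) c, L2.inner_def]
  apply integral_congr_ae
  filter_upwards [(memLp_smul_const hφ hc c).coeFn_toLp] with z hz
  rw [hz, ← Complex.coe_smul, ← Complex.coe_smul, inner_smul_left, inner_smul_right,
    Complex.conj_ofReal]

/-- Test the form with v = φc for a constant vector c, move the weak derivatives of u onto φ, and
let c vary. -/
lemma LcGraph_integral {u f : PlaneL2} (h : (u, f) ∈ LcGraph) {φ : ℂ → ℝ} (hφ : ContDiff ℝ ∞ φ)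
    (hc : HasCompactSupport φ) :
    ∫ z, φ z • f z = ∫ z, (-(1 / 2) * planeLaplacian φ z + 1 / 2 * ‖z‖ ^ 2 * φ z) • u z := by
  obtain ⟨gx, gy, l, H, K⟩ := h
  simp only at H K
  have hd (e : ℂ) := contDiff_fderiv_apply hφ e
  have hdc (e : ℂ) : HasCompactSupport (fun z => fderiv ℝ φ z e) := hc.fderiv_apply ℝ e
  have hdd (e : ℂ) : Continuous fun z => fderiv ℝ (fun z => fderiv ℝ φ z e) z e :=
    (contDiff_fderiv_apply (hd e) e).continuous
  have hddc (e : ℂ) : HasCompactSupport fun z => fderiv ℝ (fun z => fderiv ℝ φ z e) z e :=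
    (hdc e).fderiv_apply ℝ e
  have hn : Continuous (fun z : ℂ => ‖z‖ * φ z) := continuous_norm.mul hφ.continuous
  have hnc : HasCompactSupport (fun z : ℂ => ‖z‖ * φ z) := hc.mul_left
  have hn2 : Continuous (fun z : ℂ => ‖z‖ ^ 2 * φ z) := (continuous_norm.pow 2).mul hφ.continuous
  have hnc2 : HasCompactSupport (fun z : ℂ => ‖z‖ ^ 2 * φ z) := hc.mul_left
  have hl : ∫ z, (‖z‖ * φ z) • l z = ∫ z, (‖z‖ ^ 2 * φ z) • u z := by
    apply integral_congr_ae
    filter_upwards [H.3] with z hz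
    rw [hz, smul_smul]
    congr 1
    ring
  have hx := H.1 _ (hd 1) (hdc 1)
  have hy := H.2 _ (hd Complex.I) (hdc Complex.I)
  refine ext_inner_left ℂ fun c => ?_
  have key := K _ _ _ _ (InFormDomain.mk
    (isWeakDeriv_test hφ hc c 1 (hd 1).continuous (hdc 1))
    (isWeakDeriv_test hφ hc c Complex.I (hd Complex.I).continuous (hdc Complex.I))
    (h := (memLp_smul_const hn hnc c).toLp) (by
      filter_upwards [(memLp_smul_const hn hnc c).coeFn_toLp,
        (memLp_smul_const hφ.continuous hc c).coeFn_toLp] with z h1 h2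
      rw [h1, h2, smul_smul]))
  rw [integral_inner_toLp (hd 1).continuous (hdc 1), integral_inner_toLp (hd _).continuous (hdc _),
    integral_inner_toLp hn hnc, integral_inner_toLp hφ.continuous hc] at key
  rw [← key, hl, ← neg_eq_iff_eq_neg.2 hx, ← neg_eq_iff_eq_neg.2 hy]
  have e : ∫ z, (-(1 / 2) * planeLaplacian φ z + 1 / 2 * ‖z‖ ^ 2 * φ z) • u z
      = (-(1 / 2) : ℝ) • ((∫ z, (fderiv ℝ (fun z => fderiv ℝ φ z 1) z 1) • u z)
        + ∫ z, (fderiv ℝ (fun z => fderiv ℝ φ z Complex.I) z Complex.I) • u z)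
        + (1 / 2 : ℝ) • ∫ z, (‖z‖ ^ 2 * φ z) • u z := by
    have i1 := integrable_smul_PlaneL2 u (hdd 1) (hddc 1)
    have i2 := integrable_smul_PlaneL2 u (hdd Complex.I) (hddc Complex.I)
    have i3 := integrable_smul_PlaneL2 u hn2 hnc2
    rw [← integral_add i1 i2, ← integral_smul, ← integral_smul]
    refine Eq.trans ?_ (integral_add ((i1.add i2).smul (-(1 / 2) : ℝ)) (i3.smul (1 / 2 : ℝ)))
    refine integral_congr_ae (ae_of_all _ fun z => ?_)
    simp only [planeLaplacian]
    module
  rw [e]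
  simp only [inner_add_right, inner_neg_right, ← Complex.coe_smul, inner_smul_right]
  push_cast
  ring

/-- The scalar distributional equation, tested against complex-valued functions. -/
lemma LcGraph_integral_complex {u f : PlaneL2} (h : (u, f) ∈ LcGraph) (l : C2 →L[ℂ] ℂ)
    {ψ : ℂ → ℂ} (hψ : ContDiff ℝ ∞ ψ) (hc : HasCompactSupport ψ) :
    Integrable (fun z => planeLaplacian ψ z * l (u z)
      - ψ z * (‖z‖ ^ 2 * l (u z) - 2 * l (f z))) ∧
    ∫ z, (planeLaplacian ψ z * l (u z) - ψ z * (‖z‖ ^ 2 * l (u z) - 2 * l (f z))) = 0 := by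
  have hlap (T : ℂ →L[ℝ] ℝ) (z : ℂ) :
      planeLaplacian (fun z => T (ψ z)) z = T (planeLaplacian ψ z) := by
    have h1 (e : ℂ) (χ : ℂ → ℂ) (hχ : ContDiff ℝ ∞ χ) (z : ℂ) :
        fderiv ℝ (fun z => T (χ z)) z e = T (fderiv ℝ χ z e) := by
      have := (T.hasFDerivAt.comp z (hχ.differentiable (by simp) z).hasFDerivAt).fderiv
      have h2 : fderiv ℝ (fun z => T (χ z)) z = T.comp (fderiv ℝ χ z) := this
      rw [h2]; rfl
    simp only [planeLaplacian, h1 _ ψ hψ, h1 _ _ (contDiff_fderiv_apply hψ _), map_add]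
  -- The distributional equation is available for real test functions; the complex case is its
  -- combination for Re ψ and Im ψ.
  have hreal (T : ℂ →L[ℝ] ℝ) :
      Integrable (fun z => (T (planeLaplacian ψ z) : ℂ) * l (u z)
        - (T (ψ z) : ℂ) * (‖z‖ ^ 2 * l (u z) - 2 * l (f z))) ∧
      ∫ z, ((T (planeLaplacian ψ z) : ℂ) * l (u z)
        - (T (ψ z) : ℂ) * (‖z‖ ^ 2 * l (u z) - 2 * l (f z))) = 0 := by
    have hφ : ContDiff ℝ ∞ fun z => T (ψ z) := T.contDiff.comp hψ
    have hφc : HasCompactSupport fun z => T (ψ z) := hc.comp_left (g := T) (map_zero T)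
    have hL : Continuous fun z => planeLaplacian (fun z => T (ψ z)) z :=
      (contDiff_fderiv_apply (contDiff_fderiv_apply hφ 1) 1).continuous.add
        (contDiff_fderiv_apply (contDiff_fderiv_apply hφ Complex.I) Complex.I).continuous
    have hLc : HasCompactSupport fun z => planeLaplacian (fun z => T (ψ z)) z :=
      ((hφc.fderiv_apply ℝ 1).fderiv_apply ℝ 1).add
        ((hφc.fderiv_apply ℝ Complex.I).fderiv_apply ℝ Complex.I)
    have i1 := integrable_smul_PlaneL2 f hφ.continuous hφc
    have hP : Continuous fun z => -(1 / 2) * planeLaplacian (fun z => T (ψ z)) z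
        + 1 / 2 * ‖z‖ ^ 2 * T (ψ z) :=
      (continuous_const.mul hL).add ((continuous_const.mul (continuous_norm.pow 2)).mul
        hφ.continuous)
    have hPc : HasCompactSupport fun z => -(1 / 2) * planeLaplacian (fun z => T (ψ z)) z
        + 1 / 2 * ‖z‖ ^ 2 * T (ψ z) := (hLc.mul_left).add hφc.mul_left
    have i2 := integrable_smul_PlaneL2 u hP hPc
    have key := congrArg l (LcGraph_integral h hφ hφc)
    rw [← l.integral_comp_comm i1, ← l.integral_comp_comm i2] at key
    have j1 := l.integrable_comp i1
    have j2 := l.integrable_comp i2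
    have e : (fun z => (T (planeLaplacian ψ z) : ℂ) * l (u z)
        - (T (ψ z) : ℂ) * (‖z‖ ^ 2 * l (u z) - 2 * l (f z)))
        = fun z => 2 * (l (T (ψ z) • f z)
          - l ((-(1 / 2) * planeLaplacian (fun z => T (ψ z)) z
            + 1 / 2 * ‖z‖ ^ 2 * T (ψ z)) • u z)) := by
      ext1 z
      rw [hlap, ← Complex.coe_smul, ← Complex.coe_smul, map_smul, map_smul, smul_eq_mul,
        smul_eq_mul]
      push_cast
      ring
    rw [e]
    refine ⟨(j1.sub j2).const_mul 2, ?_⟩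
    rw [integral_const_mul, integral_sub j1 j2, key, sub_self, mul_zero]
  obtain ⟨i1, h1⟩ := hreal Complex.reCLM
  obtain ⟨i2, h2⟩ := hreal Complex.imCLM
  have e : (fun z => planeLaplacian ψ z * l (u z) - ψ z * (‖z‖ ^ 2 * l (u z) - 2 * l (f z)))
      = fun z => ((Complex.reCLM (planeLaplacian ψ z) : ℂ) * l (u z)
        - (Complex.reCLM (ψ z) : ℂ) * (‖z‖ ^ 2 * l (u z) - 2 * l (f z)))
        + Complex.I * ((Complex.imCLM (planeLaplacian ψ z) : ℂ) * l (u z)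
        - (Complex.imCLM (ψ z) : ℂ) * (‖z‖ ^ 2 * l (u z) - 2 * l (f z))) := by
    ext1 z
    rw [Complex.reCLM_apply, Complex.reCLM_apply, Complex.imCLM_apply, Complex.imCLM_apply]
    nth_rewrite 1 [← Complex.re_add_im (planeLaplacian ψ z)]
    nth_rewrite 1 [← Complex.re_add_im (ψ z)]
    ring
  rw [e]
  refine ⟨i1.add (i2.const_mul _), ?_⟩
  rw [integral_add i1 (i2.const_mul _), integral_const_mul, h1, h2, mul_zero, add_zero]

end Distributions

/-! ### Test functions with one angular frequency -/

section AngularTest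

variable {σ : ℂ →L[ℝ] ℂ} {η : ℝ → ℝ}

lemma clm_apply_eq (σ : ℂ →L[ℝ] ℂ) (z : ℂ) : σ z = z.re * σ 1 + z.im * σ Complex.I := by
  have h : z = z.re • 1 + z.im • Complex.I := by
    rw [Complex.real_smul, Complex.real_smul, mul_one, Complex.re_add_im]
  conv_lhs => rw [h]
  rw [map_add, map_smul, map_smul, Complex.real_smul, Complex.real_smul]

lemma fderiv_angularTest (k : ℕ) (hη : Differentiable ℝ η) (z : ℂ) (e : ℂ) :
    fderiv ℝ (fun z => σ z ^ k * (η (‖z‖ ^ 2) : ℂ)) z e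
      = k * σ z ^ (k - 1) * σ e * η (‖z‖ ^ 2)
        + σ z ^ k * (2 * inner ℝ z e : ℝ) * deriv η (‖z‖ ^ 2) := by
  have h1 : HasFDerivAt (fun z : ℂ => σ z) σ z := σ.hasFDerivAt
  have h2 : HasFDerivAt (fun z : ℂ => η (‖z‖ ^ 2)) _ z :=
    (hη (‖z‖ ^ 2)).hasDerivAt.comp_hasFDerivAt z (hasStrictFDerivAt_norm_sq z).hasFDerivAt
  have h3 : HasFDerivAt (fun z : ℂ => ((η (‖z‖ ^ 2) : ℝ) : ℂ)) _ z :=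
    Complex.ofRealCLM.hasFDerivAt.comp z h2
  have h4 := ((h1.pow k).mul h3).fderiv
  have h5 : fderiv ℝ (fun z => σ z ^ k * (η (‖z‖ ^ 2) : ℂ)) z = _ := h4
  rw [h5]
  simp
  ring

lemma hasCompactSupport_angularTest (k : ℕ) (hc : HasCompactSupport η) :
    HasCompactSupport fun z => σ z ^ k * (η (‖z‖ ^ 2) : ℂ) := by
  have h : HasCompactSupport fun z : ℂ => (η (‖z‖ ^ 2) : ℂ) := by
    obtain ⟨R, hR⟩ := hc.isBounded.subset_closedBall 0
    refine HasCompactSupport.of_support_subset_isCompact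
      (isCompact_closedBall (0 : ℂ) (max R 1)) fun z hz => ?_
    have h1 : ‖z‖ ^ 2 ∈ tsupport η := subset_tsupport _ (by
      intro h0; exact hz (by simp [h0]))
    have h2 := hR h1
    rw [mem_closedBall_zero_iff, Real.norm_of_nonneg (by positivity)] at h2
    rw [mem_closedBall_zero_iff]
    by_contra! h3
    have h4 := (le_max_left R 1).trans_lt h3
    have h5 := (le_max_right R 1).trans_lt h3
    nlinarith
  exact h.mul_left

lemma contDiff_angularTest (k : ℕ) (hη : ContDiff ℝ ∞ η) :
    ContDiff ℝ ∞ fun z => σ z ^ k * (η (‖z‖ ^ 2) : ℂ) :=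
  (σ.contDiff.pow k).mul (Complex.ofRealCLM.contDiff.comp (hη.comp (contDiff_norm_sq ℝ)))

/-- The isotropy condition on σ makes σ^k harmonic. What remains is the Laplacian of η(|z|²) and the
cross term, equal to 4kη'σ^k by Euler's identity for the homogeneous σ^k; together they shift the
dimension and give the factor k + 1. -/
lemma planeLaplacian_angularTest (hσ : σ 1 ^ 2 + σ Complex.I ^ 2 = 0) (k : ℕ)
    (hη : ContDiff ℝ ∞ η) (z : ℂ) :
    planeLaplacian (fun z => σ z ^ k * (η (‖z‖ ^ 2) : ℂ)) z
      = σ z ^ k * (4 * ((k + 1) * deriv η (‖z‖ ^ 2)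
        + ‖z‖ ^ 2 * deriv (deriv η) (‖z‖ ^ 2)) : ℝ) := by
  have hη' : ContDiff ℝ ∞ (deriv η) := (contDiff_infty_iff_deriv.1 hη).2
  have hd : Differentiable ℝ η := hη.differentiable (by simp)
  have hd' : Differentiable ℝ (deriv η) := hη'.differentiable (by simp)
  have key (e : ℂ) : fderiv ℝ (fun z => fderiv ℝ (fun z => σ z ^ k * (η (‖z‖ ^ 2) : ℂ)) z e) z e
      = k * σ e * ((k - 1 : ℕ) * σ z ^ (k - 1 - 1) * σ e * η (‖z‖ ^ 2)
        + σ z ^ (k - 1) * (2 * inner ℝ z e : ℝ) * deriv η (‖z‖ ^ 2))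
        + ((k * σ z ^ (k - 1) * σ e * deriv η (‖z‖ ^ 2)
        + σ z ^ k * (2 * inner ℝ z e : ℝ) * deriv (deriv η) (‖z‖ ^ 2)) * (2 * inner ℝ z e : ℝ)
        + σ z ^ k * deriv η (‖z‖ ^ 2) * (2 * ‖e‖ ^ 2 : ℝ)) := by
    have e1 : (fun z => fderiv ℝ (fun z => σ z ^ k * (η (‖z‖ ^ 2) : ℂ)) z e)
        = fun z => (k * σ e) * (σ z ^ (k - 1) * (η (‖z‖ ^ 2) : ℂ))
          + (σ z ^ k * ((deriv η (‖z‖ ^ 2) : ℝ) : ℂ)) * ((2 * inner ℝ z e : ℝ) : ℂ) := by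
      ext1 z
      rw [fderiv_angularTest k hd]
      push_cast
      ring
    have d1 := ((contDiff_angularTest (σ := σ) (k - 1) hη).differentiable (by simp) z).hasFDerivAt
    have d2 := ((contDiff_angularTest (σ := σ) k hη').differentiable (by simp) z).hasFDerivAt
    have d3 : HasFDerivAt (fun z : ℂ => ((2 * inner ℝ z e : ℝ) : ℂ))
        ((2 : ℝ) • Complex.ofRealCLM.comp (innerSL ℝ e)) z := by
      have : (fun z : ℂ => ((2 * inner ℝ z e : ℝ) : ℂ))
          = ((2 : ℝ) • Complex.ofRealCLM.comp (innerSL ℝ e) : ℂ →L[ℝ] ℂ) := by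
        ext1 z
        simp [real_inner_comm]
        ring
      rw [this]
      exact ContinuousLinearMap.hasFDerivAt _
    have d4 := ((d1.const_mul (k * σ e)).add (d2.mul d3)).fderiv
    have d5 : fderiv ℝ (fun z => (k * σ e) * (σ z ^ (k - 1) * (η (‖z‖ ^ 2) : ℂ))
          + (σ z ^ k * ((deriv η (‖z‖ ^ 2) : ℝ) : ℂ)) * ((2 * inner ℝ z e : ℝ) : ℂ)) z = _ := d4
    rw [e1, d5]
    simp only [add_apply, smul_apply,
      fderiv_angularTest _ hd, fderiv_angularTest _ hd', smul_eq_mul,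
      ContinuousLinearMap.comp_apply, innerSL_apply_apply, real_inner_self_eq_norm_sq,
      Complex.ofRealCLM_apply, Complex.real_smul]
    push_cast
    ring
  have hz := clm_apply_eq σ z
  have i1 : inner ℝ z 1 = z.re := by simp [Complex.inner]
  have i2 : inner ℝ z Complex.I = z.im := by simp [Complex.inner]
  have hn : (‖z‖ : ℂ) ^ 2 = z.re ^ 2 + z.im ^ 2 := by
    have := Complex.sq_norm z
    rw [Complex.normSq_apply] at this
    rw [← Complex.ofReal_pow, this]; push_cast; ring
  -- The exponent k - 1 is truncated at 0; for k = 0 the prefactor k makes both sides vanish.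
  have hk : (k : ℂ) * σ z ^ (k - 1) * σ z = k * σ z ^ k := by
    rcases Nat.eq_zero_or_pos k with rfl | h
    · simp
    · rw [mul_assoc, pow_sub_one_mul h.ne']
  rw [planeLaplacian, key, key, i1, i2]
  push_cast
  rw [norm_one, Complex.norm_I, hn, Complex.ofReal_one]
  set η0 := (η (‖z‖ ^ 2) : ℂ)
  set η1 := ((deriv η (‖z‖ ^ 2) : ℝ) : ℂ)
  set η2 := ((deriv (deriv η) (‖z‖ ^ 2) : ℝ) : ℂ)
  linear_combination (k * ((k - 1 : ℕ) : ℂ) * σ z ^ (k - 1 - 1) * η0) * hσ + 4 * η1 * hk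
    - (4 * η1 * k * σ z ^ (k - 1)) * hz

end AngularTest

/-! ### The two circular components -/

section Components

/-- The component along `(1/2, ∓i/2)`. -/
noncomputable def circularComponent (s : ℂ) : C2 →L[ℂ] ℂ :=
  EuclideanSpace.proj 0 + (s * Complex.I) • EuclideanSpace.proj 1

lemma circularComponent_apply (s : ℂ) (u : C2) :
    circularComponent s u = u 0 + s * Complex.I * u 1 := by
  simp [circularComponent]

/-- The two functionals u₀ ± i u₁ are left eigenvectors of J, with eigenvalues ±i. -/
lemma circularComponent_J {s : ℂ} (hs : s ^ 2 = 1) (u : C2) :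
    circularComponent s (Matrix.toEuclideanCLM (𝕜 := ℂ) J u)
      = s * Complex.I * circularComponent s u := by
  simp [circularComponent_apply, J, Matrix.ofLp_toEuclideanCLM, Matrix.mulVec, dotProduct]
  linear_combination (-(Complex.I ^ 2) * u 1) * hs - u 1 * Complex.I_sq

/-- R exchanges the two circular components and e^{2mθJ} multiplies each by a phase: this is what
couples the angular frequencies at distance 2m. -/
lemma circularComponent_LwSymbol {m : ℕ} {μ : ℝ} {w : ℝ → ℝ} {s : ℂ} (hs : s ^ 2 = 1) (z : ℂ)
    (u : C2) :
    circularComponent s (Matrix.toEuclideanCLM (𝕜 := ℂ) (LwSymbol m μ w z) u)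
      = (2 * |w ‖z‖| ^ 2 - μ : ℝ) * circularComponent s u
        + (|w ‖z‖| ^ 2 : ℝ) * (Complex.exp (s * (2 * m * Complex.arg z : ℝ) * Complex.I)
          * circularComponent (-s) u) := by
  have he : Complex.exp (s * (2 * m * Complex.arg z : ℝ) * Complex.I)
      = (Real.cos (2 * m * Complex.arg z) : ℂ)
        + s * Real.sin (2 * m * Complex.arg z) * Complex.I := by
    rcases eq_or_eq_neg_of_sq_eq_sq s 1 (by rw [hs, one_pow]) with rfl | rfl
    · rw [one_mul, Complex.exp_mul_I, Complex.ofReal_cos, Complex.ofReal_sin, one_mul]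
    · rw [neg_one_mul, Complex.exp_mul_I, Complex.cos_neg, Complex.sin_neg, Complex.ofReal_cos,
        Complex.ofReal_sin, neg_one_mul]
  rw [he]
  simp [circularComponent_apply, LwSymbol, expJ, J, R, Matrix.ofLp_toEuclideanCLM, Matrix.mulVec,
    dotProduct]
  linear_combination (w ‖z‖ ^ 2 * Complex.sin (2 * m * Complex.arg z) * u 1)
    * (s ^ 2 * Complex.I_sq - hs)

end Components

end GPVortex

namespace GPVortex

/-! ### Fourier coefficients on `(-π, π]` -/

section AngularAverage

/-- The angular measure `dθ` on `(-π, π]`. -/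
noncomputable def angMeasure : Measure ℝ := volume.restrict (Ioc (-Real.pi) Real.pi)

instance : IsFiniteMeasure angMeasure := by unfold angMeasure; infer_instance

/-- The `n`-th Fourier coefficient of a function of the angle. -/
noncomputable def angAvg (n : ℤ) (h : ℝ → ℂ) : ℂ :=
  (2 * Real.pi)⁻¹ • ∫ θ, Complex.exp (-(n * θ * Complex.I)) * h θ ∂angMeasure

lemma neg_pi_lt_pi : -Real.pi < Real.pi := by linarith [Real.pi_pos]

lemma angAvg_eq_fourierCoeffOn (n : ℤ) (h : ℝ → ℂ) :
    angAvg n h = fourierCoeffOn neg_pi_lt_pi h n := by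
  rw [fourierCoeffOn_eq_integral, intervalIntegral.integral_of_le neg_pi_lt_pi.le, angAvg,
    angMeasure]
  have e : Real.pi - -Real.pi = 2 * Real.pi := by ring
  rw [e, one_div]
  congr 1
  refine integral_congr_ae (ae_of_all _ fun θ => ?_)
  simp only [fourier_coe_apply, smul_eq_mul]
  congr 2
  have : (Real.pi : ℂ) ≠ 0 := by exact_mod_cast Real.pi_ne_zero
  push_cast
  field_simp

lemma angAvg_congr {n : ℤ} {h h' : ℝ → ℂ} (e : h =ᵐ[angMeasure] h') : angAvg n h = angAvg n h' := by
  unfold angAvg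
  congr 1
  refine integral_congr_ae (e.mono fun θ hθ => ?_)
  simp only [hθ]

lemma integrable_exp_mul {n : ℤ} {h : ℝ → ℂ} (hh : MemLp h 2 angMeasure) :
    Integrable (fun θ : ℝ => Complex.exp (-(n * θ * Complex.I)) * h θ) angMeasure := by
  refine (hh.integrable (by norm_num)).bdd_mul (c := 1)
    (by fun_prop) (ae_of_all _ fun θ => ?_)
  have : -((n : ℂ) * θ * Complex.I) = ((-(n * θ) : ℝ) : ℂ) * Complex.I := by push_cast; ring
  rw [this, Complex.norm_exp_ofReal_mul_I]

lemma angAvg_add {n : ℤ} {h h' : ℝ → ℂ} (hh : MemLp h 2 angMeasure) (hh' : MemLp h' 2 angMeasure) :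
    angAvg n (fun θ => h θ + h' θ) = angAvg n h + angAvg n h' := by
  simp only [angAvg, mul_add]
  rw [integral_add (integrable_exp_mul hh) (integrable_exp_mul hh'), smul_add]

lemma angAvg_const_mul (n : ℤ) (c : ℂ) (h : ℝ → ℂ) :
    angAvg n (fun θ => c * h θ) = c * angAvg n h := by
  simp only [angAvg, mul_left_comm _ c]
  rw [integral_const_mul, mul_smul_comm]

lemma angAvg_exp_mul (n k : ℤ) (h : ℝ → ℂ) :
    angAvg n (fun θ => Complex.exp (k * θ * Complex.I) * h θ) = angAvg (n - k) h := by
  simp only [angAvg, ← mul_assoc, ← Complex.exp_add]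
  congr 1
  refine integral_congr_ae (ae_of_all _ fun θ => ?_)
  simp only
  congr 2
  push_cast
  ring

lemma angAvg_one (n : ℤ) : angAvg n (fun _ => 1) = if n = 0 then 1 else 0 := by
  have hpi : (Real.pi : ℂ) ≠ 0 := by exact_mod_cast Real.pi_ne_zero
  rw [angAvg, angMeasure, ← intervalIntegral.integral_of_le neg_pi_lt_pi.le]
  split_ifs with h
  · subst h
    simp
    field_simp
    norm_num
  · have hn : -((n : ℂ) * Complex.I) ≠ 0 :=
      neg_ne_zero.2 (mul_ne_zero (by exact_mod_cast h) Complex.I_ne_zero)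
    have e : ∀ θ : ℝ, Complex.exp (-(n * θ * Complex.I)) * 1
        = Complex.exp (-((n : ℂ) * Complex.I) * θ) := fun θ => by
      rw [mul_one]; congr 1; ring
    simp only [e]
    rw [integral_exp_mul_complex hn]
    have : Complex.exp (-((n : ℂ) * Complex.I) * (Real.pi : ℝ))
        = Complex.exp (-((n : ℂ) * Complex.I) * ((-Real.pi : ℝ) : ℂ)) := by
      rw [Complex.exp_eq_exp_iff_exists_int]
      refine ⟨-n, ?_⟩
      push_cast
      ring
    rw [this, sub_self, zero_div, smul_zero]

lemma memLp_exp (k : ℤ) : MemLp (fun θ : ℝ => Complex.exp (k * θ * Complex.I)) 2 angMeasure := by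
  refine MemLp.of_bound (by fun_prop) 1 (ae_of_all _ fun θ => ?_)
  have : (k : ℂ) * θ * Complex.I = ((k * θ : ℝ) : ℂ) * Complex.I := by push_cast; ring
  rw [this, Complex.norm_exp_ofReal_mul_I]

lemma memLp_exp_mul (k : ℤ) {h : ℝ → ℂ} (hh : MemLp h 2 angMeasure) :
    MemLp (fun θ : ℝ => Complex.exp (k * θ * Complex.I) * h θ) 2 angMeasure := by
  refine hh.of_le_mul (c := 1) (AEStronglyMeasurable.mul (by fun_prop) hh.1)
    (ae_of_all _ fun θ => ?_)
  have : (k : ℂ) * θ * Complex.I = ((k * θ : ℝ) : ℂ) * Complex.I := by push_cast; ring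
  rw [norm_mul, this, Complex.norm_exp_ofReal_mul_I]

lemma angAvg_exp (n k : ℤ) :
    angAvg n (fun θ => Complex.exp (k * θ * Complex.I)) = if n = k then 1 else 0 := by
  have := angAvg_exp_mul n k (fun _ => 1)
  simp only [mul_one] at this
  rw [this, angAvg_one]
  simp only [sub_eq_zero]

lemma hasSum_sq_angAvg {h : ℝ → ℂ} (hh : MemLp h 2 angMeasure) :
    HasSum (fun n => ‖angAvg n h‖ ^ 2) ((2 * Real.pi)⁻¹ * ∫ θ, ‖h θ‖ ^ 2 ∂angMeasure) := by
  have := hasSum_sq_fourierCoeffOn neg_pi_lt_pi hh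
  rw [intervalIntegral.integral_of_le neg_pi_lt_pi.le] at this
  simp only [angAvg_eq_fourierCoeffOn]
  rwa [show Real.pi - -Real.pi = 2 * Real.pi by ring, smul_eq_mul] at this

lemma norm_angAvg_sq_le {h : ℝ → ℂ} (hh : MemLp h 2 angMeasure) (n : ℤ) :
    ‖angAvg n h‖ ^ 2 ≤ (2 * Real.pi)⁻¹ * ∫ θ, ‖h θ‖ ^ 2 ∂angMeasure :=
  le_hasSum (hasSum_sq_angAvg hh) n fun _ _ => sq_nonneg _

/-- Parseval: vanishing coefficients force the L² norm to vanish. -/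
lemma ae_eq_zero_of_angAvg {h : ℝ → ℂ} (hh : MemLp h 2 angMeasure) (h0 : ∀ n, angAvg n h = 0) :
    ∀ᵐ θ ∂angMeasure, h θ = 0 := by
  have h1 := hasSum_sq_angAvg hh
  simp only [h0, norm_zero] at h1
  have h2 : (2 * Real.pi)⁻¹ * ∫ θ, ‖h θ‖ ^ 2 ∂angMeasure = 0 :=
    h1.unique (by simp)
  have h3 := (mul_eq_zero.1 h2).resolve_left (by positivity)
  rw [integral_eq_zero_iff_of_nonneg (fun _ => sq_nonneg _)
    ((memLp_two_iff_integrable_sq_norm hh.1).1 hh)] at h3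
  exact h3.mono fun θ hθ => by simpa using hθ

end AngularAverage

/-! ### Polar coordinates -/

section Polar

/-- The point of the plane with polar coordinates `(r, θ)`. -/
noncomputable def polarPoint (p : ℝ × ℝ) : ℂ := p.1 * Complex.exp (p.2 * Complex.I)

lemma continuous_polarPoint : Continuous polarPoint := by
  unfold polarPoint
  fun_prop

lemma norm_polarPoint {r : ℝ} (hr : 0 < r) (θ : ℝ) : ‖polarPoint (r, θ)‖ = r := by
  rw [polarPoint, norm_mul, Complex.norm_exp_ofReal_mul_I, mul_one, Complex.norm_real,
    Real.norm_of_nonneg hr.le]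

lemma arg_polarPoint {r θ : ℝ} (hr : 0 < r) (hθ : θ ∈ Ioc (-Real.pi) Real.pi) :
    Complex.arg (polarPoint (r, θ)) = θ := by
  rw [polarPoint, Complex.exp_mul_I]
  exact Complex.arg_mul_cos_add_sin_mul_I hr hθ

instance : SFinite radialMeasure := by unfold radialMeasure; infer_instance

/-- The angle runs over (-π, π], the range of `Complex.arg`; this differs by a null set from the
open interval of the polar coordinate formula. -/
lemma measurePreserving_polarPoint :
    MeasurePreserving polarPoint (radialMeasure.prod angMeasure) volume := by
  refine ⟨continuous_polarPoint.measurable, ?_⟩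
  ext s hs
  have hpre : MeasurableSet (polarPoint ⁻¹' s) := continuous_polarPoint.measurable hs
  rw [Measure.map_apply continuous_polarPoint.measurable hs, radialMeasure,
    prod_withDensity_left (by fun_prop), angMeasure, Measure.restrict_congr_set
      (Ioo_ae_eq_Ioc (a := -Real.pi) (b := Real.pi)).symm, Measure.prod_restrict,
    withDensity_apply _ hpre, ← lintegral_indicator hpre]
  have h := Complex.lintegral_comp_polarCoord_symm (s.indicator 1)
  rw [lintegral_indicator_one hs] at h
  rw [← h, polarCoord_target]
  refine lintegral_congr fun p => ?_
  rw [Complex.polarCoord_symm_apply]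
  have e : polarPoint p = p.1 * (Real.cos p.2 + Real.sin p.2 * Complex.I) := by
    rw [polarPoint, Complex.exp_mul_I, Complex.ofReal_cos, Complex.ofReal_sin]
  rw [← e]
  by_cases hp : polarPoint p ∈ s
  · simp [indicator, hp]
  · simp [indicator, hp]

lemma ae_ae_polarPoint {p : ℂ → Prop} (h : ∀ᵐ z, p z) :
    ∀ᵐ r ∂radialMeasure, ∀ᵐ θ ∂angMeasure, p (polarPoint (r, θ)) :=
  Measure.ae_ae_of_ae_prod (measurePreserving_polarPoint.quasiMeasurePreserving.ae h)

lemma ae_pos_radialMeasure : ∀ᵐ r ∂radialMeasure, 0 < r := by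
  rw [ae_radialMeasure_iff]
  exact ae_of_all _ fun r hr => hr

/-- Tonelli applied to |D|. The measurability of D is what turns an almost everywhere statement on
circles into one in the plane. -/
lemma ae_eq_zero_of_polar {D : ℂ → ℂ} (hD : AEStronglyMeasurable D volume)
    (h : ∀ᵐ r ∂radialMeasure, ∀ᵐ θ ∂angMeasure, D (polarPoint (r, θ)) = 0) :
    ∀ᵐ z, D z = 0 := by
  have hm : AEMeasurable (fun z => ‖D z‖ₑ) volume := hD.enorm
  have hmp := measurePreserving_polarPoint
  have h0 : ∫⁻ z, ‖D z‖ₑ = 0 := by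
    rw [← hmp.map_eq] at hm ⊢
    rw [lintegral_map' hm hmp.aemeasurable,
      lintegral_prod (fun p => ‖D (polarPoint p)‖ₑ) (hm.comp_aemeasurable hmp.aemeasurable),
      lintegral_eq_zero_of_ae_eq_zero]
    filter_upwards [h] with r hr
    refine lintegral_eq_zero_of_ae_eq_zero ?_
    filter_upwards [hr] with θ hθ
    simp [hθ]
  rw [lintegral_eq_zero_iff' hm] at h0
  exact h0.mono fun z hz => by simpa using hz

/-- The angular Fourier coefficient of a function on the plane. -/
noncomputable def angCoeff (n : ℤ) (F : ℂ → ℂ) (r : ℝ) : ℂ := angAvg n fun θ => F (polarPoint (r, θ))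

lemma memLp_slice {F : ℂ → ℂ} (hF : MemLp F 2 volume) :
    ∀ᵐ r ∂radialMeasure, MemLp (fun θ => F (polarPoint (r, θ))) 2 angMeasure := by
  have h := hF.comp_measurePreserving measurePreserving_polarPoint
  have h1 := ((memLp_two_iff_integrable_sq_norm h.1).1 h).prod_right_ae
  filter_upwards [h1, h.1.prodMk_left] with r h2 h3
  exact (memLp_two_iff_integrable_sq_norm h3).2 h2

/-- Bessel's inequality on almost every circle, then Fubini. -/
lemma memLp_angCoeff {F : ℂ → ℂ} (hF : MemLp F 2 volume) (n : ℤ) :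
    MemLp (angCoeff n F) 2 radialMeasure := by
  have h := hF.comp_measurePreserving measurePreserving_polarPoint
  have hm : AEStronglyMeasurable (angCoeff n F) radialMeasure := by
    have h1 : AEStronglyMeasurable (fun p : ℝ × ℝ => Complex.exp (-(n * p.2 * Complex.I))
        * F (polarPoint p)) (radialMeasure.prod angMeasure) :=
      AEStronglyMeasurable.mul (by fun_prop) h.1
    exact h1.integral_prod_right'.const_smul (2 * Real.pi)⁻¹
  rw [memLp_two_iff_integrable_sq_norm hm]
  have h1 := ((memLp_two_iff_integrable_sq_norm h.1).1 h).integral_prod_left.const_mul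
    (2 * Real.pi)⁻¹
  refine h1.mono' (hm.norm.pow 2) ?_
  filter_upwards [memLp_slice hF] with r hr
  rw [Real.norm_of_nonneg (sq_nonneg _)]
  exact norm_angAvg_sq_le hr n

lemma integral_polar {G : ℂ → ℂ} (hG : Integrable G) :
    ∫ z, G z = ∫ r, (∫ θ, G (polarPoint (r, θ)) ∂angMeasure) ∂radialMeasure := by
  have hmp := measurePreserving_polarPoint
  have h1 : Integrable (fun p => G (polarPoint p)) (radialMeasure.prod angMeasure) :=
    hmp.integrable_comp_of_integrable hG
  rw [← integral_prod _ h1, ← integral_map hmp.aemeasurable (by rw [hmp.map_eq]; exact hG.1),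
    hmp.map_eq]

end Polar

end GPVortex

namespace GPVortex

/-! ### Radial equations for the angular Fourier coefficients -/

section RadialReduction

/-- Conjugation for κ ≥ 0 and the identity for κ ≤ 0: either way the |κ|-th power carries the
character e^{-iκθ} that extracts the κ-th coefficient. -/
lemma exists_rotation (κ : ℤ) : ∃ σ : ℂ →L[ℝ] ℂ, σ 1 ^ 2 + σ Complex.I ^ 2 = 0 ∧
    ∀ r θ : ℝ, σ (polarPoint (r, θ)) ^ κ.natAbs
      = (r ^ κ.natAbs : ℝ) * Complex.exp (-(κ * θ * Complex.I)) := by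
  obtain ⟨k, rfl | rfl⟩ := κ.eq_nat_or_neg
  · refine ⟨Complex.conjCLE, by simp, fun r θ => ?_⟩
    rw [Int.natAbs_natCast, polarPoint]
    simp only [ContinuousLinearEquiv.coe_coe, Complex.conjCLE_apply, map_mul, Complex.conj_ofReal,
      ← Complex.exp_conj, Complex.conj_I, mul_pow, ← Complex.exp_nat_mul]
    push_cast
    congr 2
    ring
  · refine ⟨ContinuousLinearMap.id ℝ ℂ, by simp, fun r θ => ?_⟩
    rw [Int.natAbs_neg, Int.natAbs_natCast, ContinuousLinearMap.id_apply, polarPoint, mul_pow,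
      ← Complex.exp_nat_mul]
    push_cast
    congr 2
    ring

/-- The source of the radial equation for the `κ`-th angular Fourier coefficient. -/
noncomputable def radialSource (κ : ℤ) (U V : ℂ → ℂ) (r : ℝ) : ℂ :=
  (r : ℂ) ^ 2 * angCoeff κ U r - 2 * angCoeff κ V r

lemma integral_exp_mul_polar {n : ℤ} (h : ℝ → ℂ) :
    ∫ θ, Complex.exp (-(n * θ * Complex.I)) * h θ ∂angMeasure = (2 * Real.pi : ℝ) * angAvg n h := by
  have : (Real.pi : ℂ) ≠ 0 := by exact_mod_cast Real.pi_ne_zero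
  rw [angAvg, Complex.real_smul, ← mul_assoc, ← Complex.ofReal_mul,
    mul_inv_cancel₀ (by positivity), Complex.ofReal_one, one_mul]

lemma memLp_clm (l : C2 →L[ℂ] ℂ) (u : PlaneL2) : MemLp (fun z => l (u z)) 2 volume :=
  l.comp_memLp' (Lp.memLp u)

lemma intervalIntegrable_of_memLp_radial {g : ℝ → ℂ} {R : ℝ} (hR : 0 ≤ R)
    (hg : MemLp g 2 (radialMeasure.restrict (Ioc 0 R))) :
    IntervalIntegrable (fun r => r • g r) volume 0 R ∧
      IntervalIntegrable (fun r => r * ‖g r‖ ^ 2) volume 0 R := by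
  have hfin : radialMeasure (Ioc 0 R) < ⊤ := by
    rw [radialMeasure, withDensity_apply _ measurableSet_Ioc]
    refine (lintegral_mono_ae (g := fun _ => ENNReal.ofReal R) ?_).trans_lt ?_
    · refine (ae_restrict_mem measurableSet_Ioc).mono fun r hr => ENNReal.ofReal_le_ofReal hr.2
    · rw [lintegral_const, Measure.restrict_apply_univ]
      exact ENNReal.mul_lt_top ENNReal.ofReal_lt_top
        ((Measure.restrict_apply_le _ _).trans_lt measure_Ioc_lt_top)
  have hf : IsFiniteMeasure (radialMeasure.restrict (Ioc 0 R)) :=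
    ⟨by rwa [Measure.restrict_apply_univ]⟩
  have key {E : Type} [NormedAddCommGroup E] [NormedSpace ℝ E] {f : ℝ → E}
      (h : IntegrableOn f (Ioc 0 R) radialMeasure) :
      IntervalIntegrable (fun r => r • f r) volume 0 R := by
    rw [intervalIntegrable_iff_integrableOn_Ioc_of_le hR]
    rw [← integrable_indicator_iff measurableSet_Ioc, integrable_radialMeasure_iff] at h
    have h1 := h.mono_set (Ioc_subset_Ioi_self : Ioc 0 R ⊆ Ioi 0)
    refine h1.congr_fun (fun r hr => ?_) measurableSet_Ioc
    simp only [indicator_of_mem hr]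
  exact ⟨key (hg.integrable (by norm_num)),
    key ((memLp_two_iff_integrable_sq_norm hg.1).1 hg)⟩

/-- Only local in r: the harmonic term r² u need not be square integrable at infinity. -/
lemma memLp_radialSource {U V : ℂ → ℂ} (hU : MemLp U 2 volume) (hV : MemLp V 2 volume) (κ : ℤ)
    (R : ℝ) : MemLp (radialSource κ U V) 2 (radialMeasure.restrict (Ioc 0 R)) := by
  have h1 := (memLp_angCoeff hU κ).restrict (Ioc 0 R)
  have h2 := ((memLp_angCoeff hV κ).restrict (Ioc 0 R)).const_mul 2
  refine MemLp.sub (f := fun r : ℝ => (r : ℂ) ^ 2 * angCoeff κ U r) ?_ h2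
  refine h1.of_le_mul (c := R ^ 2) (AEStronglyMeasurable.mul (by fun_prop) h1.1) ?_
  refine (ae_restrict_mem measurableSet_Ioc).mono fun r hr => ?_
  rw [norm_mul, norm_pow, Complex.norm_real, Real.norm_of_nonneg hr.1.le]
  exact mul_le_mul_of_nonneg_right (pow_le_pow_left₀ hr.1.le hr.2 2) (norm_nonneg _)

lemma intervalIntegrable_angCoeff {U : ℂ → ℂ} (hU : MemLp U 2 volume) (κ : ℤ) (R : ℝ) (hR : 0 ≤ R) :
    IntervalIntegrable (fun r => r • angCoeff κ U r) volume 0 R :=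
  (intervalIntegrable_of_memLp_radial hR ((memLp_angCoeff hU κ).restrict _)).1

lemma intervalIntegrable_radialSource {U V : ℂ → ℂ} (hU : MemLp U 2 volume)
    (hV : MemLp V 2 volume) (κ : ℤ) (R : ℝ) (hR : 0 ≤ R) :
    IntervalIntegrable (fun r => r • radialSource κ U V r) volume 0 R :=
  (intervalIntegrable_of_memLp_radial hR (memLp_radialSource hU hV κ R)).1

/-- The angular Fourier coefficients of a weak solution are weak solutions of the radial
equation. -/
lemma LcGraph_angCoeff {u f : PlaneL2} (h : (u, f) ∈ LcGraph) (l : C2 →L[ℂ] ℂ) (κ : ℤ) :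
    ∀ᵐ r, 0 < r → (r ^ (κ.natAbs + 2) : ℝ) • angCoeff κ (fun z => l (u z)) r
      = momentIterated κ.natAbs (angCoeff κ fun z => l (u z))
        (radialSource κ (fun z => l (u z)) fun z => l (f z)) r := by
  have hU := memLp_clm l u
  have hV := memLp_clm l f
  refine ae_eq_of_weak_radial (intervalIntegrable_angCoeff hU κ)
    (intervalIntegrable_radialSource hU hV κ) fun η hη hc => ?_
  obtain ⟨σ, hσ, hσp⟩ := exists_rotation κ
  set k := κ.natAbs with hk
  obtain ⟨hi, h0⟩ := LcGraph_integral_complex h l (contDiff_angularTest (σ := σ) k hη)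
    (hasCompactSupport_angularTest k hc)
  rw [integral_polar hi] at h0
  have e : ∀ᵐ r ∂radialMeasure, ∫ θ, (planeLaplacian (fun z => σ z ^ k * (η (‖z‖ ^ 2) : ℂ))
        (polarPoint (r, θ)) * l (u (polarPoint (r, θ)))
      - σ (polarPoint (r, θ)) ^ k * (η (‖polarPoint (r, θ)‖ ^ 2) : ℂ) *
        (‖polarPoint (r, θ)‖ ^ 2 * l (u (polarPoint (r, θ))) - 2 * l (f (polarPoint (r, θ)))))
        ∂angMeasure
      = (2 * Real.pi : ℝ) * ((r ^ k * (4 * ((k + 1) * deriv η (r ^ 2)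
        + r ^ 2 * deriv (deriv η) (r ^ 2))) : ℝ) * angCoeff κ (fun z => l (u z)) r
        - (r ^ k * η (r ^ 2) : ℝ) * radialSource κ (fun z => l (u z)) (fun z => l (f z)) r) := by
    filter_upwards [ae_pos_radialMeasure, memLp_slice hU, memLp_slice hV] with r hr h1 h2
    have e1 : ∀ θ : ℝ, planeLaplacian (fun z => σ z ^ k * (η (‖z‖ ^ 2) : ℂ))
          (polarPoint (r, θ)) * l (u (polarPoint (r, θ)))
        - σ (polarPoint (r, θ)) ^ k * (η (‖polarPoint (r, θ)‖ ^ 2) : ℂ) *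
          (‖polarPoint (r, θ)‖ ^ 2 * l (u (polarPoint (r, θ))) - 2 * l (f (polarPoint (r, θ))))
        = (((r ^ k * (4 * ((k + 1) * deriv η (r ^ 2) + r ^ 2 * deriv (deriv η) (r ^ 2))) : ℝ) : ℂ)
            - (r ^ k * η (r ^ 2) * r ^ 2 : ℝ)) *
          (Complex.exp (-(κ * θ * Complex.I)) * l (u (polarPoint (r, θ))))
          + (2 * (r ^ k * η (r ^ 2) : ℝ)) *
          (Complex.exp (-(κ * θ * Complex.I)) * l (f (polarPoint (r, θ)))) := by
      intro θ
      rw [planeLaplacian_angularTest hσ k hη, hσp, norm_polarPoint hr]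
      push_cast
      ring
    simp only [e1]
    rw [integral_add ((integrable_exp_mul h1).const_mul _) ((integrable_exp_mul h2).const_mul _),
      integral_const_mul, integral_const_mul, integral_exp_mul_polar, integral_exp_mul_polar,
      radialSource, angCoeff, angCoeff]
    push_cast
    ring
  rw [integral_congr_ae e, integral_const_mul, integral_radialMeasure] at h0
  have h1 := (mul_eq_zero.1 h0).resolve_left (by
    exact_mod_cast (by positivity : (2 * Real.pi : ℝ) ≠ 0))
  rw [← h1]
  refine setIntegral_congr_fun measurableSet_Ioi fun r _ => ?_
  simp only [Complex.real_smul]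
  push_cast
  ring

end RadialReduction

end GPVortex

namespace GPVortex

/-! ### The modes of an eigenfunction -/

section ModeReps

/-- The continuous representative of the `κ`-th angular Fourier coefficient of a weak solution. -/
noncomputable def modeRep (κ : ℤ) (U V : ℂ → ℂ) (r : ℝ) : ℂ :=
  radialRep κ.natAbs (angCoeff κ U) (radialSource κ U V) r

variable {u f : PlaneL2}

lemma angCoeff_ae_eq_modeRep (h : (u, f) ∈ LcGraph) (l : C2 →L[ℂ] ℂ) (κ : ℤ) :
    ∀ᵐ r, 0 < r → angCoeff κ (fun z => l (u z)) r
      = modeRep κ (fun z => l (u z)) (fun z => l (f z)) r :=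
  radialRep_ae_eq (LcGraph_angCoeff h l κ)

lemma continuousOn_modeRep (l : C2 →L[ℂ] ℂ) (κ : ℤ) :
    ContinuousOn (modeRep κ (fun z => l (u z)) fun z => l (f z)) (Ioi 0) :=
  continuousOn_radialRep (intervalIntegrable_angCoeff (memLp_clm l u) κ)
    (intervalIntegrable_radialSource (memLp_clm l u) (memLp_clm l f) κ)

lemma exists_limit_modeRep (h : (u, f) ∈ LcGraph) (l : C2 →L[ℂ] ℂ) (κ : ℤ) :
    ∃ a : ℂ, Tendsto (modeRep κ (fun z => l (u z)) fun z => l (f z)) (𝓝[>] 0) (𝓝 a) :=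
  exists_limit_radialRep (intervalIntegrable_angCoeff (memLp_clm l u) κ)
    (intervalIntegrable_radialSource (memLp_clm l u) (memLp_clm l f) κ) (LcGraph_angCoeff h l κ)
    (intervalIntegrable_of_memLp_radial zero_le_one
      (memLp_radialSource (memLp_clm l u) (memLp_clm l f) κ 1)).2

lemma integrableOn_modeRep (h : (u, f) ∈ LcGraph) (l : C2 →L[ℂ] ℂ) (κ : ℤ) :
    IntegrableOn (fun r => r * ‖modeRep κ (fun z => l (u z)) (fun z => l (f z)) r‖ ^ 2)
      (Ioi 0) := by
  have h1 := memLp_angCoeff (memLp_clm l u) κ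
  have h2 := integrable_radialMeasure_iff.1 ((memLp_two_iff_integrable_sq_norm h1.1).1 h1)
  refine Integrable.congr h2 ?_
  rw [EventuallyEq, ae_restrict_iff' measurableSet_Ioi]
  filter_upwards [angCoeff_ae_eq_modeRep h l κ] with r hr h0
  rw [hr h0, smul_eq_mul]

section Source

variable {v : ℝ → ℂ} {κ : ℤ} {l : C2 →L[ℂ] ℂ}

lemma radialSource_ae_eq (h : (u, f) ∈ LcGraph)
    (hv : ∀ᵐ r, 0 < r → angCoeff κ (fun z => l (f z)) r = v r) :
    ∀ᵐ r, 0 < r → radialSource κ (fun z => l (u z)) (fun z => l (f z)) r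
      = (r : ℂ) ^ 2 * modeRep κ (fun z => l (u z)) (fun z => l (f z)) r - 2 * v r := by
  filter_upwards [angCoeff_ae_eq_modeRep h l κ, hv] with r h1 h2 h0
  rw [radialSource, h1 h0, h2 h0]

lemma continuousOn_source (hvc : ContinuousOn v (Ioi 0)) : ContinuousOn (fun r : ℝ => (r : ℂ) ^ 2 *
    modeRep κ (fun z => l (u z)) (fun z => l (f z)) r - 2 * v r) (Ioi 0) := by
  have := continuousOn_modeRep (u := u) (f := f) l κ
  fun_prop

lemma contDiffOn_modeRep (h : (u, f) ∈ LcGraph)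
    (hv : ∀ᵐ r, 0 < r → angCoeff κ (fun z => l (f z)) r = v r) (hvc : ContinuousOn v (Ioi 0)) :
    ContDiffOn ℝ 2 (modeRep κ (fun z => l (u z)) fun z => l (f z)) (Ioi 0) :=
  contDiffOn_radialRep (intervalIntegrable_angCoeff (memLp_clm l u) κ)
    (intervalIntegrable_radialSource (memLp_clm l u) (memLp_clm l f) κ) (LcGraph_angCoeff h l κ)
    (radialSource_ae_eq h hv) (continuousOn_source hvc)

lemma radialExpr_modeRep (h : (u, f) ∈ LcGraph)
    (hv : ∀ᵐ r, 0 < r → angCoeff κ (fun z => l (f z)) r = v r) (hvc : ContinuousOn v (Ioi 0))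
    (μ : ℝ) {r : ℝ} (hr : 0 < r) :
    radialExpr μ κ (modeRep κ (fun z => l (u z)) fun z => l (f z)) r
      = v r - μ * modeRep κ (fun z => l (u z)) (fun z => l (f z)) r := by
  have e := radialRep_equation (intervalIntegrable_angCoeff (memLp_clm l u) κ)
    (intervalIntegrable_radialSource (memLp_clm l u) (memLp_clm l f) κ) (LcGraph_angCoeff h l κ)
    (radialSource_ae_eq h hv) (continuousOn_source hvc) hr
  have hk : ((κ.natAbs : ℝ)) ^ 2 = (κ : ℝ) ^ 2 := by
    rw [Nat.cast_natAbs, Int.cast_abs, sq_abs]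
  rw [hk] at e
  simp only [Complex.real_smul] at e
  have e' : deriv (deriv (modeRep κ (fun z => l (u z)) fun z => l (f z))) r
      + (1 / (r : ℂ)) * deriv (modeRep κ (fun z => l (u z)) fun z => l (f z)) r
      = (r : ℂ) ^ 2 * modeRep κ (fun z => l (u z)) (fun z => l (f z)) r - 2 * v r
        + (κ : ℂ) ^ 2 / (r : ℂ) ^ 2 * modeRep κ (fun z => l (u z)) (fun z => l (f z)) r := by
    push_cast at e
    exact e
  rw [radialExpr, e']
  have hrc : (r : ℂ) ≠ 0 := by exact_mod_cast hr.ne'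
  push_cast
  field_simp
  ring

end Source

variable {m : ℕ} {μ : ℝ} {w : ℝ → ℝ} {lam : ℂ}

/-- The Fourier coefficients of the right hand side of the eigenvalue equation. -/
lemma angCoeff_eigen_source (hf : ∀ᵐ z, f z =
      lam • Matrix.toEuclideanCLM (𝕜 := ℂ) J (u z) - mulFun (LwSymbol m μ w) u z)
    {s : ℂ} (hs : s ^ 2 = 1) {n : ℤ} (hn : (n : ℂ) = s * (2 * m)) (κ : ℤ) :
    ∀ᵐ r, 0 < r → angCoeff κ (fun z => circularComponent s (f z)) r
      = (s * Complex.I * lam - (2 * |w r| ^ 2 - μ : ℝ))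
          * angCoeff κ (fun z => circularComponent s (u z)) r
        - (|w r| ^ 2 : ℝ) * angCoeff (κ - n) (fun z => circularComponent (-s) (u z)) r := by
  rw [← ae_radialMeasure_iff]
  filter_upwards [ae_ae_polarPoint hf, ae_pos_radialMeasure,
    memLp_slice (memLp_clm (circularComponent s) u),
    memLp_slice (memLp_clm (circularComponent (-s)) u)] with r h1 hr h2 h3
  have e : (fun θ => circularComponent s (f (polarPoint (r, θ)))) =ᵐ[angMeasure] fun θ =>
      (s * Complex.I * lam - (2 * |w r| ^ 2 - μ : ℝ)) * circularComponent s (u (polarPoint (r, θ)))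
        + (-(|w r| ^ 2 : ℝ)) * (Complex.exp (n * θ * Complex.I)
          * circularComponent (-s) (u (polarPoint (r, θ)))) := by
    filter_upwards [h1, ae_restrict_mem measurableSet_Ioc] with θ h4 hθ
    rw [h4, map_sub, map_smul, circularComponent_J hs, mulFun, circularComponent_LwSymbol hs,
      norm_polarPoint hr, arg_polarPoint hr hθ, hn, smul_eq_mul]
    push_cast
    rw [← mul_assoc s]
    ring
  rw [angCoeff, angAvg_congr e, angAvg_add (h2.const_mul _) ((memLp_exp_mul n h3).const_mul _),
    angAvg_const_mul, angAvg_const_mul, angAvg_exp_mul, angCoeff, angCoeff]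
  ring

/-- The radial functions of the `j`-th mode of an eigenfunction. -/
lemma isModeSolution_modeRep (hw : IsVortexProfile m μ w) (h : (u, f) ∈ LcGraph)
    (hf : ∀ᵐ z, f z =
      lam • Matrix.toEuclideanCLM (𝕜 := ℂ) J (u z) - mulFun (LwSymbol m μ w) u z) (j : ℤ) :
    IsModeSolution m μ w j lam
      (modeRep (j + m) (fun z => circularComponent 1 (u z)) fun z => circularComponent 1 (f z))
      (modeRep (j - m) (fun z => circularComponent (-1) (u z))
        fun z => circularComponent (-1) (f z)) := by
  set yp := modeRep (j + m) (fun z => circularComponent 1 (u z))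
    fun z => circularComponent 1 (f z) with hyp
  set ym := modeRep (j - m) (fun z => circularComponent (-1) (u z))
    fun z => circularComponent (-1) (f z) with hym
  have ap := angCoeff_ae_eq_modeRep h (circularComponent 1) (j + m)
  have am := angCoeff_ae_eq_modeRep h (circularComponent (-1)) (j - m)
  have cp : ContinuousOn yp (Ioi 0) := continuousOn_modeRep _ _
  have cm : ContinuousOn ym (Ioi 0) := continuousOn_modeRep _ _
  have cw := hw.continuousOn
  have vp : ∀ᵐ r, 0 < r → angCoeff (j + m) (fun z => circularComponent 1 (f z)) r
      = (Complex.I * lam - (2 * |w r| ^ 2 - μ : ℝ)) * yp r - (|w r| ^ 2 : ℝ) * ym r := by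
    -- For s = 1 the phase e^{2imθ} shifts the index j + m by 2m to j - m, the index of the other
    -- component, so the system closes.
    filter_upwards [ap, am, angCoeff_eigen_source hf (s := 1) (one_pow 2) (n := 2 * m)
      (by push_cast; ring) (j + m)] with r h1 h2 h3 h0
    rw [h3 h0, h1 h0, show j + m - 2 * (m : ℤ) = j - m by ring, h2 h0, one_mul]
  have vm : ∀ᵐ r, 0 < r → angCoeff (j - m) (fun z => circularComponent (-1) (f z)) r
      = (-Complex.I * lam - (2 * |w r| ^ 2 - μ : ℝ)) * ym r - (|w r| ^ 2 : ℝ) * yp r := by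
    filter_upwards [ap, am, angCoeff_eigen_source hf (s := -1) (by norm_num) (n := -(2 * m))
      (by push_cast; ring) (j - m)] with r h1 h2 h3 h0
    rw [h3 h0, h2 h0, show j - m - -(2 * (m : ℤ)) = j + m by ring, neg_neg, h1 h0, neg_one_mul]
  have cvp : ContinuousOn (fun r => (Complex.I * lam - (2 * |w r| ^ 2 - μ : ℝ)) * yp r
      - (|w r| ^ 2 : ℝ) * ym r) (Ioi 0) := by
    fun_prop
  have cvm : ContinuousOn (fun r => (-Complex.I * lam - (2 * |w r| ^ 2 - μ : ℝ)) * ym r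
      - (|w r| ^ 2 : ℝ) * yp r) (Ioi 0) := by
    fun_prop
  have hs : SolvesMode m μ w j lam yp ym := by
    refine ⟨contDiffOn_modeRep h vp cvp, contDiffOn_modeRep h vm cvm, fun r hr => ?_, fun r hr => ?_⟩
    · rw [LjPlus, radialExpr_modeRep h vp cvp μ hr]
      push_cast
      ring
    · rw [LjMinus, radialExpr_modeRep h vm cvm μ hr]
      push_cast
      ring
  have hI := (integrableOn_modeRep h (circularComponent 1) (j + m)).add
    (integrableOn_modeRep h (circularComponent (-1)) (j - m))
  -- The coefficients are square integrable for r dr, so their squares cannot stay above a positive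
  -- constant; decay at infinity follows from the equation.
  have hlim := (hs.decay fun δ a hδ ha hle => by
    refine not_integrableOn_Ioi_of_le (h := fun r => r * ‖yp r‖ ^ 2 + r * ‖ym r‖ ^ 2) hδ
      (fun r hr => ?_) (hI.mono_set (Ioi_subset_Ioi (zero_le_one.trans ha)))
    have h1 := hle r hr
    rw [← mul_add]
    exact h1.trans (le_mul_of_one_le_left (by positivity) (ha.trans hr.le))).2
  have hto : ∀ y : ℝ → ℂ, (∀ r, ‖y r‖ ^ 2 ≤ ‖yp r‖ ^ 2 + ‖ym r‖ ^ 2) →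
      Tendsto y atTop (𝓝 0) := by
    intro y hy
    have h1 : Tendsto (fun r => ‖y r‖ ^ 2) atTop (𝓝 0) :=
      squeeze_zero (fun r => sq_nonneg _) hy hlim
    rw [tendsto_zero_iff_norm_tendsto_zero]
    simpa using h1.sqrt
  exact ⟨hs.1, hs.2, hs.3, hs.4, exists_limit_modeRep h _ _, exists_limit_modeRep h _ _,
    hto yp fun r => le_add_of_nonneg_right (sq_nonneg _),
    hto ym fun r => le_add_of_nonneg_left (sq_nonneg _)⟩

end ModeReps

/-! ### Finite Fourier expansions -/

section Expansion

lemma aestronglyMeasurable_comp_norm {y : ℝ → ℂ} (hy : ContinuousOn y (Ioi 0)) :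
    AEStronglyMeasurable (fun z : ℂ => y ‖z‖) volume := by
  have h : ContinuousOn (fun z : ℂ => y ‖z‖) {0}ᶜ :=
    hy.comp continuous_norm.continuousOn fun z hz => norm_pos_iff.2 hz
  have h1 := h.aestronglyMeasurable (μ := volume) (measurableSet_singleton 0).compl
  rwa [Measure.restrict_eq_self_of_ae_mem] at h1
  exact compl_mem_ae_iff.2 (measure_singleton 0)

/-- A square integrable function with finitely many angular frequencies is the sum of its modes. -/
lemma ae_eq_sum_modes {U : ℂ → ℂ} (hU : MemLp U 2 volume) {S : Finset ℤ} {c : ℤ} {y : ℤ → ℝ → ℂ}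
    (hy : ∀ j, ContinuousOn (y j) (Ioi 0))
    (he : ∀ j, ∀ᵐ r, 0 < r → angCoeff (j + c) U r = y j r)
    (h0 : ∀ j, j ∉ S → ∀ r, 0 < r → y j r = 0) :
    ∀ᵐ z : ℂ, U z = ∑ j ∈ S, Complex.exp (Complex.I * (j + c) * Complex.arg z) * y j ‖z‖ := by
  have hD : AEStronglyMeasurable (fun z : ℂ => U z
      - ∑ j ∈ S, Complex.exp (Complex.I * (j + c) * Complex.arg z) * y j ‖z‖) volume := by
    refine hU.1.sub (Finset.aestronglyMeasurable_fun_sum _ fun j _ => ?_)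
    refine AEStronglyMeasurable.mul (Measurable.aestronglyMeasurable ?_)
      (aestronglyMeasurable_comp_norm (hy j))
    have := Complex.measurable_arg
    fun_prop
  have hz := ae_eq_zero_of_polar hD ?_
  · exact hz.mono fun z hz => sub_eq_zero.1 hz
  have he' : ∀ᵐ r ∂radialMeasure, ∀ j, angCoeff (j + c) U r = y j r :=
    ae_all_iff.2 fun j => ae_radialMeasure_iff.2 (he j)
  filter_upwards [he', ae_pos_radialMeasure, memLp_slice hU] with r h1 hr h2
  have hsum : MemLp (fun θ : ℝ => ∑ j ∈ S, -y j r * Complex.exp ((j + c : ℤ) * θ * Complex.I)) 2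
      angMeasure := memLp_finsetSum S fun j _ => (memLp_exp (j + c)).const_mul _
  have havg (n : ℤ) (T : Finset ℤ) :
      angAvg n (fun θ : ℝ => ∑ j ∈ T, -y j r * Complex.exp ((j + c : ℤ) * θ * Complex.I))
        = ∑ j ∈ T, -y j r * if n = j + c then 1 else 0 := by
    induction T using Finset.induction_on with
    | empty => simp [angAvg]
    | insert a T ha ih =>
      simp only [Finset.sum_insert ha]
      rw [angAvg_add ((memLp_exp (a + c)).const_mul _)
        (memLp_finsetSum T fun j _ => (memLp_exp (j + c)).const_mul _), ih, angAvg_const_mul,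
        angAvg_exp]
  -- The n-th coefficient of U minus the sum is y_{n-c} - y_{n-c} if n - c lies in S, and y_{n-c} =
  -- 0 otherwise.
  have h3 := ae_eq_zero_of_angAvg (h2.add hsum) fun n => by
    have e := angAvg_add (n := n) h2 hsum
    have e1 : angAvg n (fun θ => U (polarPoint (r, θ))) = y (n - c) r := by
      rw [← h1 (n - c), sub_add_cancel, angCoeff]
    rw [havg, e1] at e
    refine e.trans ?_
    have e2 : ∑ j ∈ S, -y j r * (if n = j + c then 1 else 0)
        = ∑ j ∈ S, if n - c = j then -y j r else 0 := by
      refine Finset.sum_congr rfl fun j _ => ?_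
      simp only [← sub_eq_iff_eq_add, mul_ite, mul_one, mul_zero]
    rw [e2, Finset.sum_ite_eq]
    split_ifs with hS
    · exact add_neg_cancel _
    · rw [h0 _ hS r hr, add_zero]
  filter_upwards [h3, ae_restrict_mem measurableSet_Ioc] with θ h4 hθ
  rw [norm_polarPoint hr, arg_polarPoint hr hθ, ← h4, Pi.add_apply, sub_eq_add_neg,
    ← Finset.sum_neg_distrib]
  congr 1
  refine Finset.sum_congr rfl fun j _ => ?_
  push_cast
  rw [show Complex.I * (j + c) * (θ : ℂ) = (j + c) * θ * Complex.I by ring]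
  ring

lemma eq_smul_circular (v : C2) :
    v = circularComponent 1 v • !₂[1 / 2, -Complex.I / 2]
      + circularComponent (-1) v • !₂[1 / 2, Complex.I / 2] := by
  ext i
  fin_cases i
  · simp [circularComponent_apply]
    ring
  · simp [circularComponent_apply]
    linear_combination v 1 * Complex.I_sq

end Expansion

/-- Unstable eigenfunctions only involve the modes `j ≠ 0`, `|j| < 2m`. -/
lemma IsEigenfunction.exists_modes {m : ℕ} (hm : 1 ≤ m) {μ : ℝ} {w : ℝ → ℝ}
    (hw : IsVortexProfile m μ w) {lam : ℂ} {Φ : PlaneL2} (hlam : 0 < lam.re)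
    (h : IsEigenfunction m μ w lam Φ) :
    ∃ yp ym : ℤ → ℝ → ℂ,
      (∀ j ∈ unstableIndices m, IsModeSolution m μ w j lam (yp j) (ym j)) ∧
      (∃ j ∈ unstableIndices m, Nontriv (yp j) (ym j)) ∧
      (∀ᵐ z : ℂ, Φ z = ∑ j ∈ unstableIndices m, modeFunction m j (yp j) (ym j) z) := by
  obtain ⟨f, hg, hf⟩ := h.exists_mem_LcGraph
  have hsol := isModeSolution_modeRep hw hg hf
  set yp : ℤ → ℝ → ℂ := fun j => modeRep (j + m) (fun z => circularComponent 1 (Φ z))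
    fun z => circularComponent 1 (f z) with hyp
  set ym : ℤ → ℝ → ℂ := fun j => modeRep (j - m) (fun z => circularComponent (-1) (Φ z))
    fun z => circularComponent (-1) (f z) with hym
  -- Such a mode would make iλ real, but Im(iλ) = Re λ > 0.
  have htriv : ∀ j, j ∉ unstableIndices m → ¬ Nontriv (yp j) (ym j) := by
    intro j hj hn
    have hj' : j = 0 ∨ 2 * (m : ℤ) ≤ |j| := by
      by_contra! hc
      exact hj (Finset.mem_erase.2 ⟨hc.1, Finset.mem_Ioo.2 (abs_lt.1 hc.2)⟩)
    have := (hsol j).I_mul_real hm hw hj' hn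
    rw [Complex.I_mul_im] at this
    linarith
  have hzero : ∀ j, ¬ Nontriv (yp j) (ym j) → ∀ r, 0 < r → yp j r = 0 ∧ ym j r = 0 := by
    intro j hj r hr
    simp only [Nontriv, not_exists, not_and, not_or, not_not] at hj
    exact hj r hr
  have ep := ae_eq_sum_modes (c := m) (memLp_clm (circularComponent 1) Φ)
    (fun j => (hsol j).contDiffOn_plus.continuousOn)
    (fun j => angCoeff_ae_eq_modeRep hg (circularComponent 1) (j + m))
    (fun j hj r hr => (hzero j (htriv j hj) r hr).1)
  have em := ae_eq_sum_modes (c := -m) (memLp_clm (circularComponent (-1)) Φ)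
    (fun j => (hsol j).contDiffOn_minus.continuousOn)
    (fun j => angCoeff_ae_eq_modeRep hg (circularComponent (-1)) (j - m))
    (fun j hj r hr => (hzero j (htriv j hj) r hr).2)
  have hΦ : ∀ᵐ z : ℂ, Φ z = ∑ j ∈ unstableIndices m, modeFunction m j (yp j) (ym j) z := by
    filter_upwards [ep, em] with z h1 h2
    rw [eq_smul_circular (Φ z), h1, h2, Finset.sum_smul, Finset.sum_smul,
      ← Finset.sum_add_distrib]
    refine Finset.sum_congr rfl fun j _ => ?_
    rw [modeFunction]
    push_cast
    rw [← sub_eq_add_neg (j : ℂ)]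
  refine ⟨yp, ym, fun j _ => hsol j, ?_, hΦ⟩
  -- If every mode were trivial, the expansion would give Φ = 0 off the origin, hence almost
  -- everywhere.
  by_contra! hc
  refine h.1 ((Lp.eq_zero_iff_ae_eq_zero).2 ?_)
  have hne : ∀ᵐ z : ℂ, z ≠ 0 := compl_mem_ae_iff.2 (measure_singleton 0)
  filter_upwards [hΦ, hne] with z hz hz0
  rw [hz, Pi.zero_apply]
  refine Finset.sum_eq_zero fun j hj => ?_
  obtain ⟨h1, h2⟩ := hzero j (hc j hj) ‖z‖ (norm_pos_iff.2 hz0)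
  rw [modeFunction, h1, h2, mul_zero, mul_zero, zero_smul, zero_smul, add_zero]

end GPVortex

/-! ### The spectral statements for all modes -/

open GPVortex in
theorem proposition4p3 (m : ℕ) (hm : 1 ≤ m) (μ : ℝ) (w : ℝ → ℝ) (hw : IsVortexProfile m μ w) :
    -- unstable eigenvalues and eigenfunctions of `A` only involve modes `j ≠ 0`, `|j| < 2m`
    (∀ (lam : ℂ) (Φ : PlaneL2), 0 < lam.re → IsEigenfunction m μ w lam Φ →
      ∃ yp ym : ℤ → ℝ → ℂ,
        (∀ j ∈ unstableIndices m, IsModeSolution m μ w j lam (yp j) (ym j)) ∧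
        (∃ j ∈ unstableIndices m, Nontriv (yp j) (ym j)) ∧
        (∀ᵐ z : ℂ, Φ z = ∑ j ∈ unstableIndices m, modeFunction m j (yp j) (ym j) z)) ∧
    -- eigenfunctions in the modes `j = 0` and `|j| ≥ 2m` lie in `D(L_j)`, and `i λ` is real
    (∀ (j : ℤ) (lam : ℂ) (yp ym : ℝ → ℂ), (j = 0 ∨ 2 * (m : ℤ) ≤ |j|) →
      IsModeSolution m μ w j lam yp ym → Nontriv yp ym →
      InDomainLj m μ w j yp ym ∧ (Complex.I * lam).im = 0) ∧
    -- for `|j| ≥ 2m`, the operator `L_j` is positive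
    (∀ (j : ℤ) (yp ym : ℝ → ℂ), 2 * (m : ℤ) ≤ |j| →
      InDomainLj m μ w j yp ym → Nontriv yp ym →
      0 < (energy m μ w j yp ym).re ∧ (energy m μ w j yp ym).im = 0) ∧
    -- hence every eigenvalue has positive Krein signature
    (∀ (j : ℤ) (lam : ℂ), 2 * (m : ℤ) ≤ |j| → PositiveKreinSignature m μ w j lam) ∧
    -- for `j = 0`, the operator `L_0` is non-negative, with null vectors `α (w, -w)` only
    (∀ yp ym : ℝ → ℂ, InDomainLj m μ w 0 yp ym →
      0 ≤ (energy m μ w 0 yp ym).re ∧ (energy m μ w 0 yp ym).im = 0 ∧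
      (energy m μ w 0 yp ym = 0 ↔
        ∃ α : ℂ, ∀ r, 0 < r → yp r = α * (w r : ℂ) ∧ ym r = -(α * (w r : ℂ)))) ∧
    -- and eigenfunctions in the mode `j = 0` with vanishing energy belong to `λ = 0`
    (∀ (lam : ℂ) (yp ym : ℝ → ℂ), IsModeSolution m μ w 0 lam yp ym → Nontriv yp ym →
      energy m μ w 0 yp ym = 0 → lam = 0) := by
  refine ⟨fun lam Φ hlam h => h.exists_modes hm hw hlam, fun j lam yp ym hj h hn => ?_,
    fun j yp ym hj h hn => ⟨h.energy_pos hm hw hj hn, h.energy_im hw (Or.inr hj)⟩,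
    fun j lam hj => positiveKreinSignature_of_two_mul_le_abs hm hw hj lam,
    fun yp ym h => ?_, fun lam yp ym h hn hE => h.eq_zero_of_energy_eq_zero hw hn hE⟩
  · exact ⟨h.inDomainLj, h.I_mul_real hm hw hj hn⟩
  · have him := h.energy_im hw (Or.inl rfl)
    have hre := h.energy_nonneg hw (Or.inl rfl)
    refine ⟨hre, him, fun hE => ?_, fun ⟨α, hα⟩ => energy_zero_of_eq_mul hw hα⟩
    exact (h.exists_eq_mul hw (Or.inl rfl) (by rw [hE, Complex.zero_re])).2.2
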